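/- Let $k$ be a field of characteristic $p>0$. Let $\mathfrak h$ be a finite-dimensional abelian restricted Lie algebra over $k$, with restricted universal enveloping algebra $A=u(\mathfrak h)$, a Hopf algebra in which the elements of $\mathfrak h$ are primitive. Write $P(H)$ for the space of primitive elements of a Hopf algebra $H$ (a restricted Lie algebra under commutator and $p$-th power), and $H^+=\ker\varepsilon$. Let $n\ge 1$, $\lambda_0,\dots,\lambda_{n-1}\in k$, let $$f(z)=z^{p^n}+\lambda_{n-1}z^{p^{n-1}}+\dots+\lambda_1z^p+\lambda_0z,\qquad B=k[z]/(f(z)),$$ a Hopf algebra with $z$ primitive, and $\mathfrak g=P(B)$. Let $\rho$ be an algebraic representation of $\mathfrak g$ on $\mathfrak h$: a linear map $\rho:\mathfrak g\to\mathrm{End}_k(\mathfrak h)$, $x\mapsto\rho_x$, with $\rho_{[x,y]}=\rho_x\rho_y-\rho_y\rho_x$, $\rho_{x^p}=(\rho_x)^p$, $\rho_x([a,b])=[\rho_x(a),b]+[a,\rho_x(b)]$ and $\rho_x(a^{[p]})=(\mathrm{ad}\,a)^{p-1}(\rho_x(a))$ (which is $0$, as $\mathfrak h$ is abelian). Extend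 $\rho_z$ to a derivation of $A$, and let $\rho_z$ act on $A\otimes A$ as $\rho_z\otimes1+1\otimes\rho_z$. In the cobar construction $\Omega A=T(A^+)$ one has $d^1(a)=a\otimes1+1\otimes a-\Delta(a)$ and $d^2(a\otimes b)=d^1(a)\otimes b-a\otimes d^1(b)$; let $Z^2(\Omega A)=\{\chi\in A^+\otimes A^+: d^2(\chi)=0\}$ and $H^2(\Omega A)=Z^2(\Omega A)/d^1(A^+)$. On $A^+\otimes A^+$ define $$\mathcal D_z^0=\mathrm{Id},\qquad \mathcal D_z^m(\xi)=\bigl(\mathcal D_z^{m-1}(\xi)\bigr)^p+\rho_z^{\,p^m-p^{m-1}}\bigl(\mathcal D_z^{m-1}(\xi)\bigr)\quad(m\ge1),\qquad \Phi_z=\mathcal D_z^n+\sum_{i=0}^{n-1}\lambda_i\mathcal D_z^i ;$$ each $\mathcal D_z^m$ maps $Z^2(\Omega A)$ into itself. Let $\Theta\in A^+$ and $\chi\in Z^2(\Omega A)$ satisfy $$\rho_z(\Theta)=0,\qquad \Phi_z(\chi)=d^1(\Theta).$$ Put $T=(\mathfrak g,\mathfrak h,\rho)$ and $\mathscr D=(T,z,\Theta,\chi)$,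 and let $u(\mathscr D)$ be the $k$-algebra generated by $A$ and an indeterminate $x$ subject to the relations $$x^{p^n}+\lambda_{n-1}x^{p^{n-1}}+\dots+\lambda_0x+\Theta=0,\qquad xa-ax=\rho_z(a)\quad(a\in A).$$ **Theorem 0.1.** The algebra $u(\mathscr D)$ has a Hopf algebra structure for which the canonical map $A\to u(\mathscr D)$ is a coalgebra map, $\Delta(x)=x\otimes1+1\otimes x+\chi$ and $\varepsilon(x)=0$. With this structure: (a) $u(\mathscr D)$ is a connected Hopf algebra (its coradical is one-dimensional) of dimension $p^{\dim P(A)+n}$. (b) $u(\mathscr D)$ is a cocentral Hopf algebra extension of $A$ by $B$: the canonical map $\iota:A\to u(\mathscr D)$ is an injective Hopf algebra map with normal image ($\iota(A^+)u(\mathscr D)=u(\mathscr D)\iota(A^+)$), and there is a surjective Hopf algebra map $\pi:u(\mathscr D)\to B$ with $\pi(x)=z$ and $\ker\pi=\iota(A^+)u(\mathscr D)$, such that $\iota(A)$ is both the algebra of left and the algebra of right $\pi$-coinvariants of $u(\mathscr D)$, and $\sum\pi(y_1)\otimes y_2=\sum\pi(y_2)\otimes y_1$ for all $y\in u(\mathscr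 D)$. (c) The following are equivalent: (i) the classes $[\mathcal D_z^i(\chi)]$, $0\le i\le n-1$, are linearly independent in $H^2(\Omega A)$ (as a family indexed by $i$); (ii) $P(u(\mathscr D))$ is the image of $\mathfrak h$ in $u(\mathscr D)$; (iii) $P(u(\mathscr D))\cong\mathfrak h$ as restricted Lie algebras; (iv) $P(u(\mathscr D))\cong\mathfrak h$ as vector spaces. -/

import Mathlib

open scoped TensorProduct

attribute [local instance 100] LieRing.ofAssociativeRing

noncomputable section

/-! ### Restricted Lie algebras -/

namespace RestrictedLie

/-- For a word `w₁ … w_m` in two letters, the iterated bracket `[w₁, [w₂, …, [w_m, x]]]`,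
where the letter `true` stands for `x` and `false` for `y`. -/
def wordBracket {L : Type*} [LieRing L] (x y : L) (w : List Bool) : L :=
  w.foldr (fun b v => ⁅if b then x else y, v⁆) x

/-- Jacobson's `∑_{i=1}^{p-1} s_i(x, y)`, where `i s_i(x, y)` is the coefficient of `t^{i-1}` in
`ad(t x + y)^{p-1}(x)`. Expanding, `i s_i(x, y)` is the sum of the iterated brackets over all words
of length `p - 1` with exactly `i - 1` letters `x`. (The word with `p - 1` letters `x` has bracket
zero and does not contribute.) -/
def jacobsonSum (k : Type*) (p : ℕ) {L : Type*} [Field k] [LieRing L] [LieAlgebra k L]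
    (x y : L) : L :=
  ∑ w : Fin (p - 1) → Bool,
    (((Finset.univ.filter fun j => w j = true).card + 1 : ℕ) : k)⁻¹ •
      wordBracket x y (List.ofFn w)

end RestrictedLie

/-- A restricted Lie algebra structure (a `p`-map `x ↦ x^[p]`) on a Lie algebra over a field `k`
of characteristic `p`. -/
class RestrictedLieAlgebra (k : Type*) (p : ℕ) (L : Type*) [Field k] [LieRing L]
    [LieAlgebra k L] where
  /-- The restricted map `x ↦ x^[p]`. -/
  pMap : L → L
  ad_pMap : ∀ x, LieAlgebra.ad k L (pMap x) = LieAlgebra.ad k L x ^ p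
  pMap_smul : ∀ (c : k) (x : L), pMap (c • x) = c ^ p • pMap x
  pMap_add : ∀ x y : L, pMap (x + y) = pMap x + pMap y + RestrictedLie.jacobsonSum k p x y

namespace RestrictedLie

theorem jacobsonSum_eq_zero (k : Type*) (p : ℕ) [hp : Fact p.Prime] {L : Type*} [Field k]
    [LieRing L] [LieAlgebra k L] [IsLieAbelian L] (x y : L) : jacobsonSum k p x y = 0 := by
  unfold jacobsonSum
  refine Finset.sum_eq_zero fun w _ => ?_
  have h2 := hp.out.two_le
  obtain ⟨m, hm⟩ : ∃ m, p - 1 = m + 1 := ⟨p - 2, by omega⟩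
  generalize hl : List.ofFn w = l
  have hlen : l.length = p - 1 := by rw [← hl]; simp
  cases l with
  | nil => simp at hlen; omega
  | cons a t => simp [wordBracket, trivial_lie_zero]

end RestrictedLie

/-! ### The restricted universal enveloping algebra -/

/-- The relations `x^p = x^[p]`, `x ∈ L`, in the universal enveloping algebra of `L`. -/
inductive RestrictedEnveloping.Rel (k : Type*) (p : ℕ) (L : Type*) [Field k] [LieRing L]
    [LieAlgebra k L] [RestrictedLieAlgebra k p L] :
    UniversalEnvelopingAlgebra k L → UniversalEnvelopingAlgebra k L → Prop
  | pow (x : L) : RestrictedEnveloping.Rel k p L (UniversalEnvelopingAlgebra.ι k x ^ p)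
      (UniversalEnvelopingAlgebra.ι k (RestrictedLieAlgebra.pMap k p x))

/-- The restricted universal enveloping algebra `u(L)`. -/
def RestrictedEnveloping (k : Type*) (p : ℕ) (L : Type*) [Field k] [LieRing L]
    [LieAlgebra k L] [RestrictedLieAlgebra k p L] : Type _ :=
  RingQuot (RestrictedEnveloping.Rel k p L)

namespace RestrictedEnveloping

section Basic

variable (k : Type*) (p : ℕ) (L : Type*) [Field k] [LieRing L] [LieAlgebra k L]
  [RestrictedLieAlgebra k p L]

instance : Ring (RestrictedEnveloping k p L) :=
  inferInstanceAs (Ring (RingQuot (RestrictedEnveloping.Rel k p L)))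

instance : Algebra k (RestrictedEnveloping k p L) :=
  inferInstanceAs (Algebra k (RingQuot (RestrictedEnveloping.Rel k p L)))

/-- The quotient map `U(L) → u(L)`. -/
def mkAlgHom : UniversalEnvelopingAlgebra k L →ₐ[k] RestrictedEnveloping k p L :=
  RingQuot.mkAlgHom k (RestrictedEnveloping.Rel k p L)

/-- The canonical map `L → u(L)`. -/
def ι : L →ₗ⁅k⁆ RestrictedEnveloping k p L :=
  (mkAlgHom k p L).toLieHom.comp (UniversalEnvelopingAlgebra.ι k)

variable {L}

theorem ι_apply (x : L) : ι k p L x = mkAlgHom k p L (UniversalEnvelopingAlgebra.ι k x) := rfl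

theorem ι_pMap (x : L) : ι k p L (RestrictedLieAlgebra.pMap k p x) = ι k p L x ^ p := by
  rw [ι_apply, ι_apply, ← map_pow]
  exact (RingQuot.mkAlgHom_rel k (Rel.pow x)).symm

variable {C : Type*} [Ring C] [Algebra k C]

/-- The universal property of `u(L)`. -/
def lift (f : L →ₗ⁅k⁆ C) (hf : ∀ x, f (RestrictedLieAlgebra.pMap k p x) = f x ^ p) :
    RestrictedEnveloping k p L →ₐ[k] C :=
  RingQuot.liftAlgHom k ⟨UniversalEnvelopingAlgebra.lift k f, by
    rintro _ _ ⟨x⟩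
    rw [map_pow, UniversalEnvelopingAlgebra.lift_ι_apply, UniversalEnvelopingAlgebra.lift_ι_apply,
      hf]⟩

@[simp]
theorem lift_ι (f : L →ₗ⁅k⁆ C) (hf : ∀ x, f (RestrictedLieAlgebra.pMap k p x) = f x ^ p) (x : L) :
    lift k p f hf (ι k p L x) = f x := by
  rw [ι_apply, lift, mkAlgHom]
  erw [RingQuot.liftAlgHom_mkAlgHom_apply]
  rw [UniversalEnvelopingAlgebra.lift_ι_apply]

variable {k p}

theorem algHom_ext {f g : RestrictedEnveloping k p L →ₐ[k] C}
    (h : ∀ x, f (ι k p L x) = g (ι k p L x)) : f = g := by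
  apply RingQuot.ringQuot_ext' k
  apply UniversalEnvelopingAlgebra.hom_ext
  ext x
  exact h x

theorem induction {q : RestrictedEnveloping k p L → Prop}
    (hal : ∀ r : k, q (algebraMap k _ r)) (hι : ∀ x, q (ι k p L x))
    (hadd : ∀ a b, q a → q b → q (a + b)) (hmul : ∀ a b, q a → q b → q (a * b)) (a) : q a := by
  let S : Subalgebra k (RestrictedEnveloping k p L) :=
    { carrier := {a | q a}
      mul_mem' := fun {a b} ha hb => hmul a b ha hb
      add_mem' := fun {a b} ha hb => hadd a b ha hb
      algebraMap_mem' := hal }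
  let f : L →ₗ⁅k⁆ S :=
    { toFun := fun x => ⟨ι k p L x, hι x⟩
      map_add' := fun x y => Subtype.ext (by simp)
      map_smul' := fun c x => Subtype.ext (by simp)
      map_lie' := fun {x y} => Subtype.ext (by
        simp [LieRing.of_associative_ring_bracket]) }
  let F := lift k p f (fun x => Subtype.ext (by simp [f, ι_pMap]))
  have : S.val.comp F = AlgHom.id k _ := algHom_ext fun x => by simp [F, f]
  have h2 := congrArg (fun g => g a) this
  simp only [AlgHom.comp_apply, AlgHom.id_apply] at h2
  rw [← h2]
  exact (F a).2

end Basic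

end RestrictedEnveloping

/-! ### The Hopf algebra structure of `u(L)` -/

namespace HopfExt

theorem add_pow_of_commute (k : Type*) (p : ℕ) [Field k] [hp : Fact p.Prime] [CharP k p]
    {R : Type*} [Ring R] [Algebra k R] {a b : R} (h : Commute a b) :
    (a + b) ^ p = a ^ p + b ^ p := by
  obtain ⟨r, hr⟩ := h.exists_add_pow_prime_eq hp.out
  have h0 : (p : R) = 0 := by
    rw [← map_natCast (algebraMap k R), CharP.cast_eq_zero, map_zero]
  rw [hr, h0]
  simp

theorem sub_pow_of_commute (k : Type*) (p : ℕ) [Field k] [hp : Fact p.Prime] [CharP k p]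
    {R : Type*} [Ring R] [Algebra k R] {a b : R} (h : Commute a b) :
    (a - b) ^ p = a ^ p - b ^ p := by
  have h1 : Commute (a - b) b := h.sub_left (Commute.refl b)
  rw [eq_sub_iff_add_eq, ← add_pow_of_commute k p h1, sub_add_cancel]

end HopfExt

namespace RestrictedEnveloping

section Hopf

variable (k : Type*) (p : ℕ) (L : Type*) [Field k] [LieRing L] [LieAlgebra k L]
  [RestrictedLieAlgebra k p L] [hp : Fact p.Prime] [CharP k p]

open TensorProduct in
/-- The comultiplication of `u(L)`, for which the elements of `L` are primitive. -/
def comul : RestrictedEnveloping k p L →ₐ[k]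
    RestrictedEnveloping k p L ⊗[k] RestrictedEnveloping k p L :=
  lift k p
    { toFun := fun x => ι k p L x ⊗ₜ[k] 1 + 1 ⊗ₜ[k] ι k p L x
      map_add' := fun x y => by simp only [map_add, add_tmul, tmul_add]; abel
      map_smul' := fun c x => by simp [smul_tmul', tmul_smul]
      map_lie' := fun {x y} => by
        simp only [LieHom.map_lie, LieRing.of_associative_ring_bracket, sub_tmul, tmul_sub,
          add_mul, mul_add, Algebra.TensorProduct.tmul_mul_tmul, one_mul, mul_one]
        abel }
    (fun x => by
      have hc : Commute (ι k p L x ⊗ₜ[k] (1 : RestrictedEnveloping k p L))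
          ((1 : RestrictedEnveloping k p L) ⊗ₜ[k] ι k p L x) := by
        simp [commute_iff_eq]
      change ι k p L (RestrictedLieAlgebra.pMap k p x) ⊗ₜ[k] 1 +
        1 ⊗ₜ[k] ι k p L (RestrictedLieAlgebra.pMap k p x) = (ι k p L x ⊗ₜ[k] 1 +
        1 ⊗ₜ[k] ι k p L x) ^ p
      rw [HopfExt.add_pow_of_commute k p hc, ι_pMap]
      simp [Algebra.TensorProduct.tmul_pow])

@[simp]
theorem comul_ι (x : L) : comul k p L (ι k p L x) = ι k p L x ⊗ₜ[k] 1 + 1 ⊗ₜ[k] ι k p L x :=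
  lift_ι _ _ _ _ _

/-- The counit of `u(L)`, which vanishes on `L`. -/
def counit : RestrictedEnveloping k p L →ₐ[k] k :=
  lift k p 0 (fun x => by simp [hp.out.ne_zero])

@[simp]
theorem counit_ι (x : L) : counit k p L (ι k p L x) = 0 := by
  rw [counit, lift_ι]; rfl

instance : Bialgebra k (RestrictedEnveloping k p L) :=
  Bialgebra.ofAlgHom (comul k p L) (counit k p L)
    (algHom_ext fun x => by
      simp [TensorProduct.add_tmul, TensorProduct.tmul_add, Algebra.TensorProduct.one_def]; abel)
    (algHom_ext fun x => by simp)
    (algHom_ext fun x => by simp)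

end Hopf

section Abelian

variable (k : Type*) (p : ℕ) (L : Type*) [Field k] [LieRing L] [LieAlgebra k L]
  [RestrictedLieAlgebra k p L] [IsLieAbelian L]

theorem commute_ι (x y : L) : Commute (ι k p L x) (ι k p L y) := by
  have h := (ι k p L).map_lie x y
  rw [trivial_lie_zero, map_zero, LieRing.of_associative_ring_bracket] at h
  exact (sub_eq_zero.mp h.symm)

theorem commute_all (a b : RestrictedEnveloping k p L) : Commute a b := by
  induction a using induction with
  | hal r => exact Algebra.commutes r b
  | hadd a a' h h' => exact h.add_left h'
  | hmul a a' h h' => exact h.mul_left h'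
  | hι x =>
    induction b using induction with
    | hal r => exact (Algebra.commutes r _).symm
    | hadd a a' h h' => exact h.add_right h'
    | hmul a a' h h' => exact h.mul_right h'
    | hι y => exact commute_ι k p L x y

/-- `u(L)` is commutative when `L` is abelian. -/
instance : CommRing (RestrictedEnveloping k p L) :=
  { (inferInstance : Ring (RestrictedEnveloping k p L)) with
    mul_comm := fun a b => commute_all k p L a b }

variable [hp : Fact p.Prime] [CharP k p]

/-- For `L` abelian, the antipode of `u(L)` is the algebra map with `x ↦ -x` for `x ∈ L`. -/
def antipode : RestrictedEnveloping k p L →ₐ[k] RestrictedEnveloping k p L :=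
  lift k p
    { toFun := fun x => - ι k p L x
      map_add' := fun x y => by rw [map_add]; abel
      map_smul' := fun c x => by simp
      map_lie' := fun {x y} => by
        simp [LieRing.of_associative_ring_bracket, trivial_lie_zero, mul_comm] }
    (fun x => by
      change - ι k p L (RestrictedLieAlgebra.pMap k p x) = (- ι k p L x) ^ p
      have h := HopfExt.sub_pow_of_commute k p (Commute.zero_left (ι k p L x))
      rw [zero_pow hp.out.ne_zero, zero_sub, zero_sub] at h
      rw [h, ι_pMap])

@[simp]
theorem antipode_ι (x : L) : antipode k p L (ι k p L x) = - ι k p L x := by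
  rw [antipode, lift_ι]; rfl

instance : HopfAlgebra k (RestrictedEnveloping k p L) :=
  HopfAlgebra.ofAlgHom (antipode k p L)
    (algHom_ext fun x => by
      have h1 : Bialgebra.comulAlgHom k (RestrictedEnveloping k p L) (ι k p L x) =
        ι k p L x ⊗ₜ[k] 1 + 1 ⊗ₜ[k] ι k p L x := comul_ι k p L x
      have h2 : Bialgebra.counitAlgHom k (RestrictedEnveloping k p L) (ι k p L x) = 0 :=
        counit_ι k p L x
      simp only [AlgHom.comp_apply, h1, h2]
      rw [map_add, map_zero]
      change antipode k p L (ι k p L x) * 1 + antipode k p L 1 * ι k p L x = 0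
      simp)
    (algHom_ext fun x => by
      have h1 : Bialgebra.comulAlgHom k (RestrictedEnveloping k p L) (ι k p L x) =
        ι k p L x ⊗ₜ[k] 1 + 1 ⊗ₜ[k] ι k p L x := comul_ι k p L x
      have h2 : Bialgebra.counitAlgHom k (RestrictedEnveloping k p L) (ι k p L x) = 0 :=
        counit_ι k p L x
      simp only [AlgHom.comp_apply, h1, h2]
      simp)

end Abelian

end RestrictedEnveloping

/-! ### Primitive elements -/

namespace HopfExt

section Primitives

variable (k : Type*) (H : Type*) [Field k] [Ring H] [Bialgebra k H]

/-- The primitive space `P(H)`, as a Lie subalgebra of `H` under the commutator. -/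
def primitives : LieSubalgebra k H where
  carrier := {x | Coalgebra.comul (R := k) x = x ⊗ₜ[k] 1 + 1 ⊗ₜ[k] x}
  zero_mem' := by simp
  add_mem' {x y} hx hy := by
    simp only [Set.mem_ofPred_eq] at hx hy ⊢
    rw [map_add, hx, hy, TensorProduct.add_tmul, TensorProduct.tmul_add]; abel
  smul_mem' c x hx := by
    simp only [Set.mem_ofPred_eq] at hx ⊢
    rw [map_smul, hx, smul_add, TensorProduct.smul_tmul', TensorProduct.tmul_smul]
  lie_mem' {x y} hx hy := by
    change Coalgebra.comul (R := k) _ = _ at hx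
    change Coalgebra.comul (R := k) _ = _ at hy
    change Coalgebra.comul (R := k) _ = _
    rw [LieRing.of_associative_ring_bracket, map_sub, Bialgebra.comul_mul, Bialgebra.comul_mul,
      hx, hy]
    simp only [TensorProduct.sub_tmul, TensorProduct.tmul_sub,
      add_mul, mul_add, Algebra.TensorProduct.tmul_mul_tmul, one_mul, mul_one]
    abel

variable {k H}

theorem mem_primitives {x : H} :
    x ∈ primitives k H ↔ Coalgebra.comul (R := k) x = x ⊗ₜ[k] 1 + 1 ⊗ₜ[k] x := Iff.rfl

variable (p : ℕ) [hp : Fact p.Prime] [CharP k p]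

theorem pow_mem_primitives {x : H} (hx : x ∈ primitives k H) : x ^ p ∈ primitives k H := by
  rw [mem_primitives] at hx ⊢
  have hc : Commute (x ⊗ₜ[k] (1 : H)) ((1 : H) ⊗ₜ[k] x) := by simp [commute_iff_eq]
  rw [Bialgebra.comul_pow, hx, add_pow_of_commute k p hc]
  simp [Algebra.TensorProduct.tmul_pow]

/-- The restricted map of `P(H)`: the `p`-th power in `H`. -/
def primitivePow (x : primitives k H) : primitives k H :=
  ⟨(x : H) ^ p, pow_mem_primitives p x.2⟩

end Primitives

section CommPrimitives

variable (k : Type*) (p : ℕ) (H : Type*) [Field k] [CommRing H] [Bialgebra k H]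

instance : IsLieAbelian (primitives k H) where
  trivial x y := Subtype.ext (by
    rw [LieSubalgebra.coe_bracket, LieRing.of_associative_ring_bracket, mul_comm, sub_self]; rfl)

/-- For a commutative Hopf algebra `H`, the `p`-th power makes `P(H)` a restricted Lie algebra. -/
instance [hp : Fact p.Prime] [CharP k p] : RestrictedLieAlgebra k p (primitives k H) where
  pMap := primitivePow p
  ad_pMap x := by
    have h (y : primitives k H) : LieAlgebra.ad k (primitives k H) y = 0 := by
      ext1 z; simp [trivial_lie_zero]
    rw [h, h, zero_pow hp.out.ne_zero]
  pMap_smul c x := Subtype.ext (by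
    change (((c • x : primitives k H) : H)) ^ p = c ^ p • (x : H) ^ p
    rw [show ((c • x : primitives k H) : H) = c • (x : H) from rfl, smul_pow])
  pMap_add x y := Subtype.ext (by
    rw [RestrictedLie.jacobsonSum_eq_zero, add_zero]
    change (((x + y : primitives k H) : H)) ^ p = (x : H) ^ p + (y : H) ^ p
    rw [show ((x + y : primitives k H) : H) = (x : H) + y from rfl, add_pow_of_commute k p (Commute.all _ _)])

end CommPrimitives

end HopfExt

/-! ### The Hopf algebra `B = k[z]/f(z)` for a `p`-polynomial `f` -/

open Polynomial in
/-- The `p`-polynomial `z^{p^n} + λ_{n-1} z^{p^{n-1}} + ⋯ + λ_1 z^p + λ_0 z`. -/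
def pPolynomial (k : Type*) (p : ℕ) [Field k] {n : ℕ} (lam : Fin n → k) : k[X] :=
  X ^ p ^ n + ∑ i : Fin n, C (lam i) * X ^ p ^ (i : ℕ)

/-- `B = k[z]/f(z)`, with `f` the `p`-polynomial with coefficients `lam`. -/
def MonogenicHopf (k : Type*) (p : ℕ) [Field k] {n : ℕ} (lam : Fin n → k) : Type _ :=
  AdjoinRoot (pPolynomial k p lam)

namespace MonogenicHopf

variable (k : Type*) (p : ℕ) [Field k] {n : ℕ} (lam : Fin n → k)

instance : CommRing (MonogenicHopf k p lam) :=
  inferInstanceAs (CommRing (AdjoinRoot (pPolynomial k p lam)))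

instance : Algebra k (MonogenicHopf k p lam) :=
  inferInstanceAs (Algebra k (AdjoinRoot (pPolynomial k p lam)))

/-- The generator `z` of `B`. -/
def z : MonogenicHopf k p lam := AdjoinRoot.root (pPolynomial k p lam)

/-- The value `c^{p^n} + λ_{n-1} c^{p^{n-1}} + ⋯ + λ_0 c` of the `p`-polynomial. -/
theorem aeval_pPolynomial {C : Type*} [Ring C] [Algebra k C] (c : C) :
    Polynomial.aeval c (pPolynomial k p lam) =
      c ^ p ^ n + ∑ i : Fin n, lam i • c ^ p ^ (i : ℕ) := by
  simp [pPolynomial, Algebra.smul_def]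

theorem aeval_z : Polynomial.aeval (z k p lam) (pPolynomial k p lam) = 0 := by
  have := AdjoinRoot.aeval_eq (f := pPolynomial k p lam) (pPolynomial k p lam)
  rw [AdjoinRoot.mk_self] at this
  exact this

variable {C : Type*} [CommRing C] [Algebra k C]

/-- The universal property of `B`. -/
def lift (c : C) (hc : Polynomial.aeval c (pPolynomial k p lam) = 0) :
    MonogenicHopf k p lam →ₐ[k] C :=
  AdjoinRoot.liftAlgHom (pPolynomial k p lam) (Algebra.ofId k C) c hc

@[simp]
theorem lift_z (c : C) (hc : Polynomial.aeval c (pPolynomial k p lam) = 0) :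
    lift k p lam c hc (z k p lam) = c :=
  AdjoinRoot.liftAlgHom_root _ _ _ _

variable {k p lam} in
theorem algHom_ext {f g : MonogenicHopf k p lam →ₐ[k] C}
    (h : f (z k p lam) = g (z k p lam)) : f = g :=
  AdjoinRoot.algHom_ext h

variable [hp : Fact p.Prime] [CharP k p]

theorem aeval_add_of_commute {C : Type*} [Ring C] [Algebra k C] {a b : C} (h : Commute a b) :
    Polynomial.aeval (a + b) (pPolynomial k p lam) =
      Polynomial.aeval a (pPolynomial k p lam) + Polynomial.aeval b (pPolynomial k p lam) := by
  have key : ∀ m : ℕ, (a + b) ^ p ^ m = a ^ p ^ m + b ^ p ^ m := by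
    intro m
    induction m with
    | zero => simp
    | succ m ih =>
      rw [pow_succ, pow_mul, ih, HopfExt.add_pow_of_commute k p ((h.pow_left _).pow_right _),
        pow_mul, pow_mul]
  simp only [aeval_pPolynomial, key, smul_add, Finset.sum_add_distrib]
  abel

/-- The comultiplication of `B`, for which `z` is primitive. -/
def comul : MonogenicHopf k p lam →ₐ[k] MonogenicHopf k p lam ⊗[k] MonogenicHopf k p lam :=
  lift k p lam (z k p lam ⊗ₜ[k] 1 + 1 ⊗ₜ[k] z k p lam) (by
    rw [aeval_add_of_commute k p lam (Commute.all _ _)]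
    have h1 := Polynomial.aeval_algHom_apply (Algebra.TensorProduct.includeLeft :
      MonogenicHopf k p lam →ₐ[k] MonogenicHopf k p lam ⊗[k] MonogenicHopf k p lam)
      (z k p lam) (pPolynomial k p lam)
    have h2 := Polynomial.aeval_algHom_apply (Algebra.TensorProduct.includeRight :
      MonogenicHopf k p lam →ₐ[k] MonogenicHopf k p lam ⊗[k] MonogenicHopf k p lam)
      (z k p lam) (pPolynomial k p lam)
    rw [aeval_z, map_zero] at h1 h2
    simp only [Algebra.TensorProduct.includeLeft_apply,
      Algebra.TensorProduct.includeRight_apply] at h1 h2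
    rw [h1, h2, add_zero])

@[simp]
theorem comul_z : comul k p lam (z k p lam) = z k p lam ⊗ₜ[k] 1 + 1 ⊗ₜ[k] z k p lam :=
  lift_z _ _ _ _ _

/-- The counit of `B`, which vanishes on `z`. -/
def counit : MonogenicHopf k p lam →ₐ[k] k :=
  lift k p lam 0 (by simp [aeval_pPolynomial, hp.out.ne_zero])

@[simp]
theorem counit_z : counit k p lam (z k p lam) = 0 :=
  lift_z _ _ _ _ _

instance : Bialgebra k (MonogenicHopf k p lam) :=
  Bialgebra.ofAlgHom (comul k p lam) (counit k p lam)
    (algHom_ext <| by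
      simp [TensorProduct.add_tmul, TensorProduct.tmul_add, Algebra.TensorProduct.one_def]; abel)
    (algHom_ext <| by simp)
    (algHom_ext <| by simp)

/-- The antipode of `B`, with `z ↦ -z`. -/
def antipode : MonogenicHopf k p lam →ₐ[k] MonogenicHopf k p lam :=
  lift k p lam (- z k p lam) (by
    have h := aeval_add_of_commute k p lam (Commute.all (z k p lam) (- z k p lam))
    have h0 : Polynomial.aeval (0 : MonogenicHopf k p lam) (pPolynomial k p lam) = 0 := by
      simp [aeval_pPolynomial, hp.out.ne_zero]
    rw [add_neg_cancel, h0, aeval_z, zero_add] at h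
    exact h.symm)

@[simp]
theorem antipode_z : antipode k p lam (z k p lam) = - z k p lam :=
  lift_z _ _ _ _ _

instance : HopfAlgebra k (MonogenicHopf k p lam) :=
  HopfAlgebra.ofAlgHom (antipode k p lam)
    (algHom_ext <| by
      have h1 : Bialgebra.comulAlgHom k (MonogenicHopf k p lam) (z k p lam) =
        z k p lam ⊗ₜ[k] 1 + 1 ⊗ₜ[k] z k p lam := comul_z k p lam
      have h2 : Bialgebra.counitAlgHom k (MonogenicHopf k p lam) (z k p lam) = 0 :=
        counit_z k p lam
      simp only [AlgHom.comp_apply, h1, h2]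
      rw [map_add, map_zero]
      change antipode k p lam (z k p lam) * 1 + antipode k p lam 1 * z k p lam = 0
      simp)
    (algHom_ext <| by
      have h1 : Bialgebra.comulAlgHom k (MonogenicHopf k p lam) (z k p lam) =
        z k p lam ⊗ₜ[k] 1 + 1 ⊗ₜ[k] z k p lam := comul_z k p lam
      have h2 : Bialgebra.counitAlgHom k (MonogenicHopf k p lam) (z k p lam) = 0 :=
        counit_z k p lam
      simp only [AlgHom.comp_apply, h1, h2]
      rw [map_add, map_zero]
      change z k p lam * antipode k p lam 1 + 1 * antipode k p lam (z k p lam) = 0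
      simp)

/-- The generator `z` as an element of `P(B)`. -/
def zPrim : HopfExt.primitives k (MonogenicHopf k p lam) :=
  ⟨z k p lam, comul_z k p lam⟩

end MonogenicHopf

/-! ### Algebraic representations -/

/-- An algebraic representation of a restricted Lie algebra `g` on a restricted Lie algebra `h`.
In `map_pMap_right`, `(ad a)^{p-1}` acts from the left; it agrees with the `(p-1)`-st power of
`b ↦ [b, a]`, since `(-1)^{p-1} = 1` in `k`. -/
structure AlgebraicRep (k : Type*) (p : ℕ) (g h : Type*) [Field k] [LieRing g] [LieAlgebra k g]
    [RestrictedLieAlgebra k p g] [LieRing h] [LieAlgebra k h] [RestrictedLieAlgebra k p h] where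
  /-- The underlying linear map `x ↦ ρ_x`. -/
  toLin : g →ₗ[k] Module.End k h
  map_lie : ∀ x y : g, toLin ⁅x, y⁆ = toLin x * toLin y - toLin y * toLin x
  map_pMap : ∀ x : g, toLin (RestrictedLieAlgebra.pMap k p x) = toLin x ^ p
  leibniz : ∀ (x : g) (a b : h), toLin x ⁅a, b⁆ = ⁅toLin x a, b⁆ + ⁅a, toLin x b⁆
  map_pMap_right : ∀ (x : g) (a : h), toLin x (RestrictedLieAlgebra.pMap k p a) =
    (LieAlgebra.ad k h a ^ (p - 1)) (toLin x a)

namespace AlgebraicRep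

variable {k : Type*} {p : ℕ} {g h : Type*} [Field k] [LieRing g] [LieAlgebra k g]
    [RestrictedLieAlgebra k p g] [LieRing h] [LieAlgebra k h] [RestrictedLieAlgebra k p h]
    [IsLieAbelian h] [hp : Fact p.Prime] [CharP k p]

theorem map_pMap_right_eq_zero (ρ : AlgebraicRep k p g h) (x : g) (a : h) :
    ρ.toLin x (RestrictedLieAlgebra.pMap k p a) = 0 := by
  have h0 : LieAlgebra.ad k h a = 0 := by ext1 b; simp [trivial_lie_zero]
  rw [ρ.map_pMap_right, h0, zero_pow (by have := hp.out.two_le; omega)]; rfl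

/-- The algebra map `u(h) → u(h)[ε]/(ε²)`, `a ↦ a + ε ρ_x(a)` for `a ∈ h`. -/
def toTriv (ρ : AlgebraicRep k p g h) (x : g) :
    RestrictedEnveloping k p h →ₐ[k]
      TrivSqZeroExt (RestrictedEnveloping k p h) (RestrictedEnveloping k p h) :=
  RestrictedEnveloping.lift k p
    { toFun := fun a => TrivSqZeroExt.inl (RestrictedEnveloping.ι k p h a) +
        TrivSqZeroExt.inr (RestrictedEnveloping.ι k p h (ρ.toLin x a))
      map_add' := fun a b => by ext <;> simp
      map_smul' := fun c a => by ext <;> simp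
      map_lie' := fun {a b} => by
        rw [LieRing.of_associative_ring_bracket, mul_comm, sub_self]
        simp [trivial_lie_zero] }
    (fun a => by
      have hp0 : (p : RestrictedEnveloping k p h) = 0 := by
        rw [← map_natCast (algebraMap k (RestrictedEnveloping k p h)), CharP.cast_eq_zero,
          map_zero]
      change TrivSqZeroExt.inl (RestrictedEnveloping.ι k p h (RestrictedLieAlgebra.pMap k p a)) +
        TrivSqZeroExt.inr (RestrictedEnveloping.ι k p h
          (ρ.toLin x (RestrictedLieAlgebra.pMap k p a))) =
        (TrivSqZeroExt.inl (RestrictedEnveloping.ι k p h a) +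
        TrivSqZeroExt.inr (RestrictedEnveloping.ι k p h (ρ.toLin x a))) ^ p
      rw [ρ.map_pMap_right_eq_zero]
      ext
      · simp [RestrictedEnveloping.ι_pMap]
      · simp [TrivSqZeroExt.snd_pow, hp0])

theorem toTriv_ι (ρ : AlgebraicRep k p g h) (x : g) (a : h) :
    ρ.toTriv x (RestrictedEnveloping.ι k p h a) =
      TrivSqZeroExt.inl (RestrictedEnveloping.ι k p h a) +
        TrivSqZeroExt.inr (RestrictedEnveloping.ι k p h (ρ.toLin x a)) :=
  RestrictedEnveloping.lift_ι _ _ _ _ _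

theorem fst_toTriv (ρ : AlgebraicRep k p g h) (x : g) (a : RestrictedEnveloping k p h) :
    (ρ.toTriv x a).fst = a := by
  have : (TrivSqZeroExt.fstHom k (RestrictedEnveloping k p h) (RestrictedEnveloping k p h)).comp
      (ρ.toTriv x) = AlgHom.id k _ :=
    RestrictedEnveloping.algHom_ext fun b => by simp [toTriv_ι]
  exact congrArg (fun f => f a) this

/-- For `h` abelian, the derivation of `u(h)` extending `ρ_x : h → h`, by which `x ∈ g` acts on
`u(h)`. It is again denoted `ρ_x`. -/
def derivation (ρ : AlgebraicRep k p g h) (x : g) :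
    Derivation k (RestrictedEnveloping k p h) (RestrictedEnveloping k p h) :=
  Derivation.mk' (TrivSqZeroExt.sndHom (RestrictedEnveloping k p h)
      (RestrictedEnveloping k p h) |>.restrictScalars k |>.comp (ρ.toTriv x).toLinearMap) (by
    intro a b
    simp [fst_toTriv, mul_comm, add_comm])

@[simp]
theorem derivation_ι (ρ : AlgebraicRep k p g h) (x : g) (a : h) :
    ρ.derivation x (RestrictedEnveloping.ι k p h a) =
      RestrictedEnveloping.ι k p h (ρ.toLin x a) := by
  change (ρ.toTriv x _).snd = _
  rw [toTriv_ι]; simp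

end AlgebraicRep

/-! ### The cobar construction in low degrees

Over a field the tensor powers of the augmentation ideal `A⁺` embed in those of `A`, so the
degree-`m` part `(A⁺)^{⊗m}` of the cobar construction is treated as a subspace of `A^{⊗m}`. The
second cohomology only involves the degrees `1, 2, 3`. -/

namespace Cobar

open TensorProduct

section Defs

variable (k : Type*) (A : Type*) [Field k] [Ring A] [Bialgebra k A]

/-- The augmentation ideal `A⁺ = ker ε`. -/
def augIdeal : Submodule k A := LinearMap.ker (Coalgebra.counit (R := k) (A := A))

/-- `A⁺ ⊗ A⁺`, as a subspace of `A ⊗ A`. -/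
def augSq : Submodule k (A ⊗[k] A) :=
  LinearMap.range (TensorProduct.map (augIdeal k A).subtype (augIdeal k A).subtype)

/-- `d¹(a) = -(Δ(a) - a ⊗ 1 - 1 ⊗ a)`. -/
def d1 : A →ₗ[k] A ⊗[k] A :=
  -(Coalgebra.comul - (TensorProduct.mk k A A).flip 1 - TensorProduct.mk k A A 1)

/-- `d²(a ⊗ b) = d¹(a) ⊗ b - a ⊗ d¹(b)`. -/
def d2 : A ⊗[k] A →ₗ[k] A ⊗[k] (A ⊗[k] A) :=
  (TensorProduct.assoc k A A A).toLinearMap ∘ₗ (d1 k A).rTensor A - (d1 k A).lTensor A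

/-- The 2-cocycles `Z²(ΩA)`. -/
def cocycles : Submodule k (A ⊗[k] A) := augSq k A ⊓ LinearMap.ker (d2 k A)

/-- The 2-coboundaries `B²(ΩA)`. -/
def coboundaries : Submodule k (A ⊗[k] A) := (augIdeal k A).map (d1 k A)

/-- `H²(ΩA) = Z²(ΩA) / B²(ΩA)`. -/
abbrev H2 : Type _ := cocycles k A ⧸ (coboundaries k A).submoduleOf (cocycles k A)

end Defs

section Operators

variable {k : Type*} {A : Type*} [Field k] [CommRing A] [Bialgebra k A]

/-- The action `δ ⊗ 1 + 1 ⊗ δ` on `A ⊗ A` of a primitive element acting on `A` by `δ`. -/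
def act (δ : A →ₗ[k] A) : A ⊗[k] A →ₗ[k] A ⊗[k] A := δ.rTensor A + δ.lTensor A

/-- The operators `D^m` on `A ⊗ A`: `D^0 = Id` and `D^m = P ∘ D^{m-1} + ρ^{p^m - p^{m-1}} ∘ D^{m-1}`,
where `P` is the `p`-th power and `ρ` is the action of `δ` on `A ⊗ A`. -/
def opD (p : ℕ) (δ : A →ₗ[k] A) : ℕ → A ⊗[k] A → A ⊗[k] A
  | 0, f => f
  | m + 1, f => opD p δ m f ^ p + (act δ ^ (p ^ (m + 1) - p ^ m)) (opD p δ m f)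

/-- `Φ = D^n + λ_{n-1} D^{n-1} + ⋯ + λ_0 D^0`. -/
def opPhi (p : ℕ) {n : ℕ} (lam : Fin n → k) (δ : A →ₗ[k] A) (f : A ⊗[k] A) : A ⊗[k] A :=
  opD p δ n f + ∑ i : Fin n, lam i • opD p δ i f

theorem d1_apply (a : A) : d1 k A a = a ⊗ₜ 1 + 1 ⊗ₜ a - Coalgebra.comul a := by
  simp [d1]; abel

theorem d2_tmul (a b : A) : d2 k A (a ⊗ₜ b) =
    TensorProduct.assoc k A A A (d1 k A a ⊗ₜ b) - a ⊗ₜ d1 k A b := by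
  simp [d2]

/-- `d²` as an alternating sum of four algebra maps. -/
theorem d2_eq (x : A ⊗[k] A) : d2 k A x =
    ((Algebra.TensorProduct.includeRight : A ⊗[k] A →ₐ[k] A ⊗[k] (A ⊗[k] A)) x +
      Algebra.TensorProduct.map (AlgHom.id k A) (Bialgebra.comulAlgHom k A) x) -
    (Algebra.TensorProduct.assoc k k k A A A
      (Algebra.TensorProduct.map (Bialgebra.comulAlgHom k A) (AlgHom.id k A) x) +
      Algebra.TensorProduct.assoc k k k A A A
        ((Algebra.TensorProduct.includeLeft : A ⊗[k] A →ₐ[k] (A ⊗[k] A) ⊗[k] A) x)) := by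
  induction x with
  | zero => simp
  | add x y hx hy => simp only [map_add, hx, hy]; abel
  | tmul a b =>
    have hassoc (y : (A ⊗[k] A) ⊗[k] A) : Algebra.TensorProduct.assoc k k k A A A y =
      TensorProduct.assoc k A A A y := rfl
    simp only [hassoc]
    simp [d2_tmul, d1_apply, add_tmul, sub_tmul, tmul_add, tmul_sub]
    abel

variable (p : ℕ) [hp : Fact p.Prime] [CharP k p]

theorem d2_pow {x : A ⊗[k] A} (hx : d2 k A x = 0) : d2 k A (x ^ p) = 0 := by
  have h : d2 k A (x ^ p) = (d2 k A x) ^ p := by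
    have hc (y z : A ⊗[k] (A ⊗[k] A)) : Commute y z := mul_comm y z
    rw [d2_eq, d2_eq, HopfExt.sub_pow_of_commute k p (hc _ _),
      HopfExt.add_pow_of_commute k p (hc _ _), HopfExt.add_pow_of_commute k p (hc _ _)]
    simp only [map_pow]
  rw [h, hx, zero_pow hp.out.ne_zero]

theorem augSq_pow {x : A ⊗[k] A} (hx : x ∈ augSq k A) : x ^ p ∈ augSq k A := by
  obtain ⟨t, rfl⟩ := hx
  induction t with
  | zero => simp [hp.out.ne_zero]
  | add x y hx hy =>
    rw [map_add, HopfExt.add_pow_of_commute k p (Commute.all _ _)]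
    exact add_mem hx hy
  | tmul a b =>
    have h (a : augIdeal k A) : (a : A) ^ p ∈ augIdeal k A := by
      have : Coalgebra.counit (R := k) (a : A) = 0 := a.2
      change Coalgebra.counit (R := k) ((a : A) ^ p) = 0
      rw [Bialgebra.counit_pow, this, zero_pow hp.out.ne_zero]
    exact ⟨⟨_, h a⟩ ⊗ₜ ⟨_, h b⟩, by simp [Algebra.TensorProduct.tmul_pow]⟩

variable {δ : A →ₗ[k] A}

theorem augSq_act (hε : ∀ a, Coalgebra.counit (R := k) (δ a) = 0) {x : A ⊗[k] A}
    (hx : x ∈ augSq k A) : act δ x ∈ augSq k A := by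
  obtain ⟨t, rfl⟩ := hx
  induction t with
  | zero => simp
  | add x y hx hy => rw [map_add, map_add]; exact add_mem hx hy
  | tmul a b =>
    exact ⟨⟨δ a, hε a⟩ ⊗ₜ b + a ⊗ₜ ⟨δ b, hε b⟩, by simp [act]⟩

theorem d2_act (h1 : δ 1 = 0)
    (hΔ : ∀ a, Coalgebra.comul (R := k) (δ a) = act δ (Coalgebra.comul (R := k) a))
    (x : A ⊗[k] A) :
    d2 k A (act δ x) = (δ.rTensor (A ⊗[k] A) + (act δ).lTensor A) (d2 k A x) := by
  have hd1 (a : A) : d1 k A (δ a) = act δ (d1 k A a) := by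
    rw [d1_apply, d1_apply, map_sub, map_add, hΔ]
    simp [act, h1]
  have hassoc (y : A ⊗[k] A) (b : A) :
      (δ.rTensor (A ⊗[k] A) + (act δ).lTensor A) (TensorProduct.assoc k A A A (y ⊗ₜ b)) =
        TensorProduct.assoc k A A A (act δ y ⊗ₜ b + y ⊗ₜ δ b) := by
    induction y with
    | zero => simp
    | add x y hx hy =>
      rw [add_tmul, map_add, map_add, hx, hy, map_add (act δ), add_tmul, add_tmul]
      simp only [map_add]
      abel
    | tmul a c => simp [act, add_tmul]; abel
  induction x with
  | zero => simp
  | add x y hx hy => simp only [map_add, hx, hy]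
  | tmul a b =>
    rw [d2_tmul, map_sub, hassoc]
    have : act δ (a ⊗ₜ[k] b) = δ a ⊗ₜ b + a ⊗ₜ δ b := by simp [act]
    rw [this, map_add, d2_tmul, d2_tmul, hd1, hd1, map_add]
    simp
    abel

theorem opD_mem_cocycles (h1 : δ 1 = 0)
    (hε : ∀ a, Coalgebra.counit (R := k) (δ a) = 0)
    (hΔ : ∀ a, Coalgebra.comul (R := k) (δ a) = act δ (Coalgebra.comul (R := k) a))
    {f : A ⊗[k] A} (hf : f ∈ cocycles k A) (m : ℕ) : opD p δ m f ∈ cocycles k A := by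
  have hact {x : A ⊗[k] A} (hx : x ∈ cocycles k A) : act δ x ∈ cocycles k A := by
    refine ⟨augSq_act hε hx.1, ?_⟩
    have h0 : d2 k A x = 0 := hx.2
    change d2 k A (act δ x) = 0
    rw [d2_act h1 hΔ, h0, map_zero]
  have hiter (j : ℕ) {x : A ⊗[k] A} (hx : x ∈ cocycles k A) :
      (act δ ^ j) x ∈ cocycles k A := by
    induction j with
    | zero => exact hx
    | succ j ih => rw [pow_succ']; exact hact ih
  induction m with
  | zero => exact hf
  | succ m ih => exact add_mem ⟨augSq_pow p ih.1, d2_pow p ih.2⟩ (hiter _ ih)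

end Operators

end Cobar

namespace AlgebraicRep

variable {k : Type*} {p : ℕ} {g h : Type*} [Field k] [LieRing g] [LieAlgebra k g]
    [RestrictedLieAlgebra k p g] [LieRing h] [LieAlgebra k h] [RestrictedLieAlgebra k p h]
    [IsLieAbelian h] [hp : Fact p.Prime] [CharP k p]

theorem act_mul {A : Type*} [CommRing A] [Bialgebra k A] (δ : Derivation k A A)
    (x y : A ⊗[k] A) : Cobar.act (δ : A →ₗ[k] A) (x * y) =
      Cobar.act (δ : A →ₗ[k] A) x * y + x * Cobar.act (δ : A →ₗ[k] A) y := by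
  induction x with
  | zero => simp
  | add x x' hx hx' => simp only [add_mul, map_add, hx, hx']; abel
  | tmul a b =>
    induction y with
    | zero => simp
    | add y y' hy hy' => simp only [mul_add, map_add, hy, hy']; abel
    | tmul c d =>
      simp [Cobar.act, TensorProduct.add_tmul, TensorProduct.tmul_add, add_mul, mul_add,
        mul_comm c (δ a), mul_comm d (δ b)]
      abel

theorem counit_derivation (ρ : AlgebraicRep k p g h) (x : g) (a : RestrictedEnveloping k p h) :
    Coalgebra.counit (R := k) (ρ.derivation x a) = 0 := by
  induction a using RestrictedEnveloping.induction with
  | hal r => simp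
  | hι y => rw [derivation_ι]; exact RestrictedEnveloping.counit_ι k p h _
  | hadd a b ha hb => simp [ha, hb]
  | hmul a b ha hb => simp [ha, hb]

theorem comul_derivation (ρ : AlgebraicRep k p g h) (x : g) (a : RestrictedEnveloping k p h) :
    Coalgebra.comul (R := k) (ρ.derivation x a) =
      Cobar.act (ρ.derivation x : RestrictedEnveloping k p h →ₗ[k] RestrictedEnveloping k p h)
        (Coalgebra.comul (R := k) a) := by
  induction a using RestrictedEnveloping.induction with
  | hal r => simp [Cobar.act, Algebra.TensorProduct.algebraMap_apply]
  | hι y =>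
    have hc (y : h) : Coalgebra.comul (R := k) (RestrictedEnveloping.ι k p h y) = 
      RestrictedEnveloping.ι k p h y ⊗ₜ[k] 1 + 1 ⊗ₜ[k] RestrictedEnveloping.ι k p h y :=
      RestrictedEnveloping.comul_ι k p h y
    rw [derivation_ι, hc, hc, map_add]
    simp [Cobar.act]
  | hadd a b ha hb => simp [ha, hb]
  | hmul a b ha hb =>
    rw [Bialgebra.comul_mul, act_mul, ← ha, ← hb, Derivation.leibniz, map_add, smul_eq_mul,
      smul_eq_mul, Bialgebra.comul_mul, Bialgebra.comul_mul]
    ring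

end AlgebraicRep

/-! ### Coradical, connectedness, extensions -/

namespace HopfExt

section Coradical

variable (k : Type*) (H : Type*) [Field k] [AddCommGroup H] [Module k H] [Coalgebra k H]

variable {H} in
/-- `C` is a subcoalgebra: `Δ(C) ⊆ C ⊗ C`. -/
def IsSubcoalgebra (C : Submodule k H) : Prop :=
  ∀ c ∈ C, Coalgebra.comul (R := k) c ∈ LinearMap.range (TensorProduct.map C.subtype C.subtype)

variable {H} in
/-- `C` is a simple subcoalgebra: it is non-zero and has no subcoalgebras but `0` and `C`. -/
def IsSimpleSubcoalgebra (C : Submodule k H) : Prop :=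
  IsSubcoalgebra k C ∧ C ≠ ⊥ ∧ ∀ E, IsSubcoalgebra k E → E ≤ C → E = ⊥ ∨ E = C

/-- The coradical: the sum of all simple subcoalgebras. -/
def coradical : Submodule k H := sSup {C | IsSimpleSubcoalgebra k C}

/-- `H` is connected if its coradical is one-dimensional. -/
def IsConnected : Prop := Module.finrank k (coradical k H) = 1

end Coradical

section Extension

variable {k : Type*} {A H B : Type*} [Field k] [Ring A] [Ring H] [Ring B]
  [HopfAlgebra k A] [HopfAlgebra k H] [HopfAlgebra k B]

/-- `1 → A → H → B → 1` is an extension of Hopf algebras (an exact sequence) : `ι` is injective,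
`π` is surjective, `A` is normal in `H`, the kernel of `π` is generated by the augmentation ideal
of `A`, and `A` is the algebra of (left and right) coinvariants of `π`. -/
structure IsExtension (ι : A →ₐc[k] H) (π : H →ₐc[k] B) : Prop where
  injective : Function.Injective ι
  surjective : Function.Surjective π
  normal : (Cobar.augIdeal k A).map (ι : A →ₗ[k] H) * ⊤ =
    ⊤ * (Cobar.augIdeal k A).map (ι : A →ₗ[k] H)
  ker_eq : LinearMap.ker (π : H →ₗ[k] B) = (Cobar.augIdeal k A).map (ι : A →ₗ[k] H) * ⊤
  right_coinvariants : ∀ x : H, x ∈ Set.range ι ↔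
    (π : H →ₗ[k] B).lTensor H (Coalgebra.comul (R := k) x) = x ⊗ₜ[k] 1
  left_coinvariants : ∀ x : H, x ∈ Set.range ι ↔
    (π : H →ₗ[k] B).rTensor H (Coalgebra.comul (R := k) x) = 1 ⊗ₜ[k] x

/-- `π : H → B` is cocentral: `∑ π(h₁) ⊗ h₂ = ∑ π(h₂) ⊗ h₁`. In finite dimension this says that
the image of `B*` in `H*` is central. -/
def IsCocentral (π : H →ₐc[k] B) : Prop :=
  ∀ x : H, (π : H →ₗ[k] B).rTensor H (Coalgebra.comul (R := k) x) =
    (π : H →ₗ[k] B).rTensor H (TensorProduct.comm k H H (Coalgebra.comul (R := k) x))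

end Extension

end HopfExt

/-- The data of a Hopf algebra structure on a given `k`-algebra `U`: a coassociative and counital
pair of algebra maps `Δ`, `ε`, and an antipode. -/
structure HopfStructure (k : Type*) (U : Type*) [Field k] [Ring U] [Algebra k U] where
  /-- The comultiplication `Δ`. -/
  comul : U →ₐ[k] U ⊗[k] U
  /-- The counit `ε`. -/
  counit : U →ₐ[k] k
  /-- The antipode `S`. -/
  antipode : U →ₗ[k] U
  coassoc : (Algebra.TensorProduct.assoc k k k U U U).toAlgHom.comp
    ((Algebra.TensorProduct.map comul (.id k U)).comp comul) =
    (Algebra.TensorProduct.map (.id k U) comul).comp comul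
  counit_left : (Algebra.TensorProduct.map counit (.id k U)).comp comul =
    (Algebra.TensorProduct.lid k U).symm
  counit_right : (Algebra.TensorProduct.map (.id k U) counit).comp comul =
    (Algebra.TensorProduct.rid k k U).symm
  antipode_left : ∀ u : U, LinearMap.mul' k U (antipode.rTensor U (comul u)) =
    algebraMap k U (counit u)
  antipode_right : ∀ u : U, LinearMap.mul' k U (antipode.lTensor U (comul u)) =
    algebraMap k U (counit u)

/-- The Hopf algebra given by a Hopf algebra structure. -/
abbrev HopfStructure.toHopfAlgebra {k : Type*} {U : Type*} [Field k] [Ring U] [Algebra k U]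
    (S : HopfStructure k U) : HopfAlgebra k U :=
  { Bialgebra.ofAlgHom S.comul S.counit S.coassoc S.counit_left S.counit_right with
    antipode := S.antipode
    mul_antipode_rTensor_comul := LinearMap.ext S.antipode_left
    mul_antipode_lTensor_comul := LinearMap.ext S.antipode_right }

/-! ### The datum `D` and the algebra `u(D)` -/

section Datum

variable (k : Type*) (p : ℕ) (h : Type*) [Field k] [Fact p.Prime] [CharP k p]
  [LieRing h] [LieAlgebra k h] [IsLieAbelian h] [RestrictedLieAlgebra k p h]

/-- A compatible datum `D = (T, z, Θ, χ)` with `A = u(h)`, `h` abelian, and `B = k[z]/f(z)`: here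
`T = (g, h, ρ)` is a type with `g = P(B)`, the element `Θ` is in `A⁺`, and `χ` is a 2-cocycle in
`A⁺ ⊗ A⁺`, such that `ρ_z(Θ) = 0` and `Φ_z(χ) = d¹(Θ)` (so that `χ` is a `z`-cocycle). -/
structure CompatibleDatum {n : ℕ} (lam : Fin n → k) where
  /-- The algebraic representation of `g = P(B)` on `h`. -/
  ρ : AlgebraicRep k p (HopfExt.primitives k (MonogenicHopf k p lam)) h
  /-- The element `Θ` of `A⁺`. -/
  Θ : RestrictedEnveloping k p h
  /-- The 2-cocycle `χ`. -/
  χ : RestrictedEnveloping k p h ⊗[k] RestrictedEnveloping k p h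
  Θ_mem : Θ ∈ Cobar.augIdeal k (RestrictedEnveloping k p h)
  χ_mem : χ ∈ Cobar.cocycles k (RestrictedEnveloping k p h)
  ρ_Θ : ρ.derivation (MonogenicHopf.zPrim k p lam) Θ = 0
  Φ_χ : Cobar.opPhi p lam (ρ.derivation (MonogenicHopf.zPrim k p lam)).toLinearMap χ =
    Cobar.d1 k (RestrictedEnveloping k p h) Θ

namespace CompatibleDatum

variable {k p h} {n : ℕ} {lam : Fin n → k} (D : CompatibleDatum k p h lam)

/-- The derivation `ρ_z` of `A = u(h)`. -/
def ρz : Derivation k (RestrictedEnveloping k p h) (RestrictedEnveloping k p h) :=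
  D.ρ.derivation (MonogenicHopf.zPrim k p lam)

/-- The cocycle `D_z^m(χ)`. -/
def cocycle (m : ℕ) : Cobar.cocycles k (RestrictedEnveloping k p h) :=
  ⟨Cobar.opD p D.ρz.toLinearMap m D.χ, Cobar.opD_mem_cocycles p (by simp)
    (D.ρ.counit_derivation _) (D.ρ.comul_derivation _) D.χ_mem m⟩

/-- The class `[D_z^m(χ)]` in `H²(ΩA)`. -/
def cohomologyClass (m : ℕ) : Cobar.H2 k (RestrictedEnveloping k p h) :=
  Submodule.Quotient.mk (D.cocycle m)

/-- The free algebra on the elements of `A` and an indeterminate `x`. -/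
abbrev Free (_ : CompatibleDatum k p h lam) : Type _ :=
  FreeAlgebra k (RestrictedEnveloping k p h ⊕ Unit)

/-- The generator of the free algebra that belongs to `a ∈ A`. -/
abbrev genA (a : RestrictedEnveloping k p h) : D.Free := FreeAlgebra.ι k (Sum.inl a)

/-- The generator `x` of the free algebra. -/
abbrev genX : D.Free := FreeAlgebra.ι k (Sum.inr ())

/-- The defining relations of `u(D)`: those of the algebra `A`, together with
`[x, a] = ρ_z(a)` for `a ∈ A` and `x^{p^n} + λ_{n-1} x^{p^{n-1}} + ⋯ + λ_0 x + Θ = 0`. -/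
inductive Rel : D.Free → D.Free → Prop
  | add (a b : RestrictedEnveloping k p h) : Rel (D.genA (a + b)) (D.genA a + D.genA b)
  | mul (a b : RestrictedEnveloping k p h) : Rel (D.genA (a * b)) (D.genA a * D.genA b)
  | scalar (c : k) : Rel (D.genA (algebraMap k _ c)) (algebraMap k _ c)
  | bracket (a : RestrictedEnveloping k p h) :
      Rel (D.genX * D.genA a - D.genA a * D.genX) (D.genA (D.ρz a))
  | top : Rel (Polynomial.aeval D.genX (pPolynomial k p lam) + D.genA D.Θ) 0

/-- The algebra `u(D)`, generated by `A` and `x` subject to the relations `Rel`. -/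
def u : Type _ := RingQuot D.Rel

instance : Ring D.u := inferInstanceAs (Ring (RingQuot D.Rel))

instance : Algebra k D.u := inferInstanceAs (Algebra k (RingQuot D.Rel))

/-- The quotient map from the free algebra to `u(D)`. -/
def quotMap : D.Free →ₐ[k] D.u := RingQuot.mkAlgHom k D.Rel

/-- The generator `x` of `u(D)`. -/
def x : D.u := D.quotMap D.genX

/-- The canonical map `A → u(D)`. -/
def incl : RestrictedEnveloping k p h →ₐ[k] D.u where
  toFun a := D.quotMap (D.genA a)
  map_one' := by
    have h := RingQuot.mkAlgHom_rel k (Rel.scalar (D := D) 1)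
    rw [map_one, map_one, map_one] at h
    exact h
  map_mul' a b := (RingQuot.mkAlgHom_rel k (Rel.mul (D := D) a b)).trans (map_mul _ _ _)
  map_zero' := by
    have h := RingQuot.mkAlgHom_rel k (Rel.scalar (D := D) 0)
    rw [map_zero, map_zero, map_zero] at h
    exact h
  map_add' a b := (RingQuot.mkAlgHom_rel k (Rel.add (D := D) a b)).trans (map_add _ _ _)
  commutes' c := (RingQuot.mkAlgHom_rel k (Rel.scalar (D := D) c)).trans (AlgHom.commutes _ _)

/-- A Hopf algebra structure on the algebra `u(D)` is the one prescribed by `D` if `A → u(D)` is a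
coalgebra map and `Δ(x) = x ⊗ 1 + 1 ⊗ x + χ`, `ε(x) = 0`. -/
structure IsPrescribed (S : HopfStructure k D.u) : Prop where
  comul_incl : ∀ a, S.comul (D.incl a) =
    Algebra.TensorProduct.map D.incl D.incl (Coalgebra.comul (R := k) a)
  counit_incl : ∀ a, S.counit (D.incl a) = Coalgebra.counit (R := k) a
  comul_x : S.comul D.x = D.x ⊗ₜ[k] 1 + 1 ⊗ₜ[k] D.x + Algebra.TensorProduct.map D.incl D.incl D.χ
  counit_x : S.counit D.x = 0

end CompatibleDatum

end Datum

end

/-!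
In an algebra of characteristic `p`, Jacobson's formula computes the powers of `a + ψ(c)` for an
algebra map `ψ` out of `A ⊗ A` on whose image `ad a` acts as `ρ_z`: it gives
`(a + ψ(c))^{p^m} = a^{p^m} + ψ(D_z^m(c))`, hence `f(a + ψ(c)) = f(a) + ψ(Φ_z(c))`. With `c = χ` and
`a = x ⊗ 1 + 1 ⊗ x`, the condition `Φ_z(χ) = d¹(Θ)` is what makes `Δ(x)` satisfy the defining
relation of `u(D)`; with `a = x` and `ψ(a ⊗ b) = S(a) b` it is what makes `S(x)` satisfy it.

The algebra `u(D)` acts on the commutative algebra `A[t]/(f(t) + Θ)`, with `x` acting as `t + ∂`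
for the derivation `∂` extending `ρ_z` and killing `t`. Since `(t + ∂)^j 1 = t^j`, the elements
`x^j` for `j < p^n` form a basis of `u(D)` over `A`.

Giving `x` a weight larger than that of `χ` yields a coalgebra filtration which starts with the
scalars, so `u(D)` is connected. The primitive elements of `B` are the combinations of the
`z^{p^i}`, so those of `u(D)` have the form `∑ c_i x^{p^i} + b` with `b ∈ A`, and such an element is
primitive exactly if `d¹(b) = ∑ c_i D_z^i(χ)`.
-/

noncomputable section

/-! ### Jacobson's formula and the operators `D_z^m` -/

namespace HopfExt

section Jacobson

open LieAlgebra Polynomial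

theorem cast_choose_prime_sub_one (p : ℕ) [hp : Fact p.Prime] {R : Type*} [Ring R] [CharP R p]
    {m : ℕ} (hm : m < p) : ((p - 1).choose m : R) = (-1) ^ m := by
  induction m with
  | zero => simp
  | succ m ih =>
    have hpascal : p.choose (m + 1) = (p - 1).choose m + (p - 1).choose (m + 1) := by
      rw [← Nat.choose_succ_succ, Nat.succ_eq_add_one, Nat.sub_add_cancel hp.out.one_le]
    have hdvd : (p.choose (m + 1) : R) = 0 :=
      (CharP.cast_eq_zero_iff R p _).mpr (hp.out.dvd_choose_self (by lia) hm)
    rw [hpascal, Nat.cast_add, ih (by lia)] at hdvd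
    rw [eq_neg_of_add_eq_zero_right hdvd, pow_succ, mul_neg_one]

theorem sub_pow_prime_sub_one_of_commute (k : Type*) (p : ℕ) [Field k] [hp : Fact p.Prime]
    [CharP k p] {V : Type*} [Ring V] [Algebra k V] {a b : V} (h : Commute a b) :
    (a - b) ^ (p - 1) = ∑ i ∈ Finset.range p, a ^ i * b ^ (p - 1 - i) := by
  rw [sub_eq_add_neg, h.neg_right.add_pow, Nat.sub_add_cancel hp.out.one_le]
  refine Finset.sum_congr rfl fun i hi => ?_
  have hip : i < p := Finset.mem_range.mp hi
  have hchoose : ((p - 1).choose i : V) = (-1) ^ (p - 1 - i) := by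
    rw [← Nat.choose_symm (by lia), ← map_natCast (algebraMap k V),
      cast_choose_prime_sub_one p (by lia), map_pow, map_neg, map_one]
  rw [hchoose, neg_pow b, mul_assoc, ((Commute.neg_one_left (b ^ _)).pow_left _).eq,
    mul_assoc (b ^ _), ← pow_add, Even.neg_one_pow ⟨_, rfl⟩, mul_one]

variable (k : Type*) (p : ℕ) [Field k] [hp : Fact p.Prime] [CharP k p]
  {V : Type*} [Ring V] [Algebra k V]

theorem ad_pow_prime_pow (a : V) (m : ℕ) : ad k V a ^ p ^ m = ad k V (a ^ p ^ m) := by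
  induction m with
  | zero => simp
  | succ m ih =>
    rw [pow_succ, pow_mul, ih, pow_mul]
    simp only [ad_eq_lmul_left_sub_lmul_right, Pi.sub_apply, LinearMap.pow_mulLeft,
      LinearMap.pow_mulRight,
      sub_pow_of_commute k p (LinearMap.commute_mulLeft_right (R := k) (a ^ p ^ m) (a ^ p ^ m))]

theorem ad_pow_prime_sub_one_apply (a b : V) :
    (ad k V a ^ (p - 1)) b = ∑ i ∈ Finset.range p, a ^ i * b * a ^ (p - 1 - i) := by
  simp [ad_eq_lmul_left_sub_lmul_right, mul_assoc,
    sub_pow_prime_sub_one_of_commute k p (LinearMap.commute_mulLeft_right (R := k) a a)]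

theorem map_pow_eq_sum_of_leibniz {V : Type*} [Ring V] {D : V → V}
    (hD : ∀ a b, D (a * b) = D a * b + a * D b)
    (a : V) (n : ℕ) : D (a ^ n) = ∑ i ∈ Finset.range n, a ^ i * D a * a ^ (n - 1 - i) := by
  induction n with
  | zero => simpa using hD 1 1
  | succ n ih =>
    rw [pow_succ', hD, ih, Finset.sum_range_succ', Finset.mul_sum, add_comm]
    simp [pow_succ', mul_assoc, Nat.sub_sub, add_comm 1]

theorem map_pow_prime_of_leibniz {D : V → V} (hD : ∀ a b, D (a * b) = D a * b + a * D b)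
    (a : V) : D (a ^ p) = (ad k V a ^ (p - 1)) (D a) := by
  rw [map_pow_eq_sum_of_leibniz hD, ad_pow_prime_sub_one_apply]

theorem eval_one_eq_of_derivative_eq_C (k : Type*) (p : ℕ) [Field k] [hp : Fact p.Prime]
    [CharP k p] {V : Type*} [Ring V] [Algebra k V] {P : V[X]} {v : V} (hdeg : P.natDegree ≤ p)
    (hP : derivative P = C v) : P.eval 1 = P.coeff 0 + P.coeff p + v := by
  have hp2 := hp.out.two_le
  have hcoeff_one : P.coeff 1 = v := by
    simpa [coeff_derivative] using congrArg (coeff · 0) hP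
  have hcoeff {j : ℕ} (hj : 1 < j) (hjp : j < p) : P.coeff j = 0 := by
    obtain ⟨i, rfl⟩ : ∃ i, j = i + 1 := ⟨j - 1, by lia⟩
    have hmul : P.coeff (i + 1) * ((i + 1 : ℕ) : V) = 0 := by
      simpa [coeff_derivative, coeff_C, show i ≠ 0 by lia] using congrArg (coeff · i) hP
    have hunit : IsUnit ((i + 1 : ℕ) : V) := by
      rw [← map_natCast (algebraMap k V)]
      exact .map _ <| .mk0 _ <| mt (CharP.cast_eq_zero_iff k p _).mp <|
        Nat.not_dvd_of_pos_of_lt (by lia) hjp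
    exact hunit.mul_left_eq_zero.mp hmul
  obtain ⟨q, rfl⟩ : ∃ q, p = q + 1 + 1 := ⟨p - 2, by lia⟩
  rw [eval_eq_sum_range' (n := q + 1 + 1 + 1) (by lia), Finset.sum_range_succ,
    Finset.sum_range_succ', Finset.sum_range_succ', Finset.sum_eq_zero]
  · simp [hcoeff_one]; abel
  · intro i hi
    rw [hcoeff (by lia) (by have := Finset.mem_range.mp hi; lia), zero_mul]

theorem add_pow_prime_of_ad_eq_C {a b v : V}
    (h : (ad k V[X] (C a + X * C b) ^ (p - 1)) (C b) = C v) :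
    (a + b) ^ p = a ^ p + b ^ p + v := by
  set P : V[X] := C a + X * C b with hP
  have hderiv : derivative (P ^ p) = C v := by
    have hleibniz := map_pow_prime_of_leibniz k p (D := fun Q : V[X] => derivative Q)
      (fun _ _ => derivative_mul) P
    rw [hleibniz, ← h]
    simp [hP]
  have hdeg : P.natDegree ≤ 1 :=
    natDegree_add_le_of_degree_le (by simp) ((natDegree_mul_C_le _ _).trans natDegree_X_le)
  have heval : (P ^ p).eval 1 = (a + b) ^ p := by
    let ev : V[X] →+* V := eval₂RingHom' (.id V) 1 fun _ => .one_right _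
    have hev (Q : V[X]) : Q.eval 1 = ev Q := rfl
    rw [hev, map_pow, ← hev]
    simp [hP, X_mul_C]
  have hcoeff_zero : (P ^ p).coeff 0 = a ^ p := by
    simpa [hP] using map_pow constantCoeff P p
  have hcoeff_prime : (P ^ p).coeff p = b ^ p := by
    simpa [hP] using coeff_pow_of_natDegree_le (m := p) hdeg
  rw [← heval, eval_one_eq_of_derivative_eq_C k p (by simpa using natDegree_pow_le_of_le p hdeg)
    hderiv, hcoeff_zero, hcoeff_prime]

variable {k} {R : Type*} [CommRing R] [Algebra k R] {a : V} {ψ : R →ₐ[k] V} {d : Module.End k R}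

theorem ad_pow_apply_of_lie_eq (ha : ∀ r, ⁅a, ψ r⁆ = ψ (d r)) (j : ℕ) (r : R) :
    (ad k V a ^ j) (ψ r) = ψ ((d ^ j) r) := by
  induction j with
  | zero => simp
  | succ j ih => simp [pow_succ', ih, ha]

theorem add_map_pow_prime (ha : ∀ r, ⁅a, ψ r⁆ = ψ (d r)) (r : R) :
    (a + ψ r) ^ p = a ^ p + ψ (r ^ p + (d ^ (p - 1)) r) := by
  let ψX : R →ₐ[k] V[X] := (CAlgHom (R := k)).comp ψ
  have hψX (s : R) : ⁅C a + X * C (ψ r), ψX s⁆ = ψX (d s) := by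
    have hcomm : Commute (X * C (ψ r)) (C (ψ s)) :=
      (commute_X _).mul_left (by rw [commute_iff_eq, ← C_mul, ← C_mul, ← map_mul, ← map_mul,
        mul_comm])
    change ⁅C a + X * C (ψ r), C (ψ s)⁆ = C (ψ (d s))
    rw [add_lie, hcomm.lie_eq, add_zero, LieRing.of_associative_ring_bracket, ← C_mul, ← C_mul,
      ← C_sub, ← ha, LieRing.of_associative_ring_bracket]
  have h : (ad k V[X] (C a + X * C (ψ r)) ^ (p - 1)) (C (ψ r)) = C (ψ ((d ^ (p - 1)) r)) :=
    ad_pow_apply_of_lie_eq hψX _ _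
  rw [add_pow_prime_of_ad_eq_C k p h, map_add, map_pow, add_assoc]

end Jacobson

end HopfExt

namespace Cobar

variable {k : Type*} {p : ℕ} [Field k] [hp : Fact p.Prime] [CharP k p]
  {V : Type*} [Ring V] [Algebra k V] {A : Type*} [CommRing A] [Bialgebra k A]
  {δ : Module.End k A} {a : V} {ψ : A ⊗[k] A →ₐ[k] V}

theorem add_map_pow_prime_pow (ha : ∀ c, ⁅a, ψ c⁆ = ψ (act δ c)) (c : A ⊗[k] A) (m : ℕ) :
    (a + ψ c) ^ p ^ m = a ^ p ^ m + ψ (opD p δ m c) := by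
  induction m with
  | zero => simp [opD]
  | succ m ih =>
    have hpow (b : A ⊗[k] A) : ⁅a ^ p ^ m, ψ b⁆ = ψ ((act δ ^ p ^ m) b) := by
      rw [← HopfExt.ad_pow_apply_of_lie_eq ha, HopfExt.ad_pow_prime_pow, LieAlgebra.ad_apply]
    have hexp : p ^ m * (p - 1) = p ^ (m + 1) - p ^ m := by rw [Nat.mul_sub, mul_one, ← pow_succ]
    rw [pow_succ p m, pow_mul, ih, HopfExt.add_map_pow_prime p hpow, ← pow_mul (act δ), hexp,
      pow_mul, opD]

theorem aeval_add_map {n : ℕ} (lam : Fin n → k) (ha : ∀ c, ⁅a, ψ c⁆ = ψ (act δ c))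
    (c : A ⊗[k] A) :
    Polynomial.aeval (a + ψ c) (pPolynomial k p lam) =
      Polynomial.aeval a (pPolynomial k p lam) + ψ (opPhi p lam δ c) := by
  simp only [MonogenicHopf.aeval_pPolynomial, add_map_pow_prime_pow ha, opPhi, map_add, map_sum,
    map_smul, smul_add, Finset.sum_add_distrib]
  abel

end Cobar

/-! ### The restricted enveloping algebra -/

namespace RestrictedMonomials

open MvPolynomial

variable {R : Type*} [CommRing R] {σ : Type*}

variable (R σ) in
/-- The polynomials of total degree less than `n`. In contrast to `MvPolynomial.restrictTotalDegree`
the bound is strict, so that the filtration starts with `0` and inductions on it have a trivial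
base case. -/
def lowDegree (n : ℕ) : Submodule R (MvPolynomial σ R) := restrictSupport R {m | m.degree < n}

theorem monomial_mem_lowDegree {m : σ →₀ ℕ} {n : ℕ} (h : m.degree < n) (r : R) :
    monomial m r ∈ lowDegree R σ n :=
  (monomial_mem_restrictSupport R).mpr (.inl h)

theorem lowDegree_mono : Monotone (lowDegree R σ) := fun _ _ h =>
  restrictSupport_mono R fun _ hm => lt_of_lt_of_le hm h

theorem eq_zero_of_mem_lowDegree_zero {f : MvPolynomial σ R} (hf : f ∈ lowDegree R σ 0) :
    f = 0 := by
  simpa [lowDegree, mem_restrictSupport_iff] using hf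

theorem mul_mem_lowDegree {f g : MvPolynomial σ R} {a b : ℕ} (hf : f ∈ lowDegree R σ a)
    (hg : g ∈ lowDegree R σ (b + 1)) : f * g ∈ lowDegree R σ (a + b) := by
  have hmul := Submodule.mul_mem_mul hf hg
  rw [lowDegree, lowDegree, ← restrictSupport_add] at hmul
  refine restrictSupport_mono R (Set.add_subset_iff.mpr fun m hm m' hm' => ?_) hmul
  simp only [Set.mem_ofPred_eq, map_add] at hm hm' ⊢
  lia

theorem mem_lowDegree_totalDegree_succ (f : MvPolynomial σ R) :
    f ∈ lowDegree R σ (f.totalDegree + 1) :=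
  (mem_restrictSupport_iff R).mpr fun _ hm => Nat.lt_succ_of_le (le_totalDegree hm)

theorem mul_sub_monomial_mem {f g : MvPolynomial σ R} {a b : σ →₀ ℕ}
    (hf : f - monomial a 1 ∈ lowDegree R σ a.degree)
    (hg : g - monomial b 1 ∈ lowDegree R σ b.degree) :
    f * g - monomial (a + b) 1 ∈ lowDegree R σ (a + b).degree := by
  have hg' : g ∈ lowDegree R σ (b.degree + 1) := by
    simpa using add_mem (lowDegree_mono b.degree.le_succ hg)
      (monomial_mem_lowDegree b.degree.lt_succ_self 1)
  have hleft : (f - monomial a 1) * g ∈ lowDegree R σ (a.degree + b.degree) :=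
    mul_mem_lowDegree hf hg'
  have hright : (g - monomial b 1) * monomial a 1 ∈ lowDegree R σ (b.degree + a.degree) :=
    mul_mem_lowDegree hg (monomial_mem_lowDegree a.degree.lt_succ_self 1)
  have hsplit : f * g - monomial (a + b) 1 =
      (f - monomial a 1) * g + (g - monomial b 1) * monomial a 1 := by
    rw [← mul_one (1 : R), ← monomial_mul, mul_one]
    ring
  rw [hsplit, map_add]
  exact add_mem hleft (add_comm b.degree a.degree ▸ hright)

/-- The substitution `X_i ↦ X_i^p - L_i`. -/
def subst (p : ℕ) (L : σ → MvPolynomial σ R) : MvPolynomial σ R →ₐ[R] MvPolynomial σ R :=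
  aeval fun i => X i ^ p - L i

variable {p : ℕ} {L : σ → MvPolynomial σ R}

theorem subst_X (i : σ) : subst p L (X i) = X i ^ p - L i := aeval_X _ i

theorem subst_monomial_sub_mem (hL : ∀ i, L i ∈ lowDegree R σ p) (a : σ →₀ ℕ) :
    subst p L (monomial a 1) - monomial (p • a) 1 ∈ lowDegree R σ (p • a).degree := by
  induction a using Finsupp.induction_linear with
  | zero => simp
  | add a b ha hb =>
    rw [← mul_one (1 : R), ← monomial_mul, map_mul, smul_add, mul_one]
    exact mul_sub_monomial_mem ha hb
  | single i n =>
    have hbase : subst p L (X i) - monomial (p • Finsupp.single i 1) 1 ∈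
        lowDegree R σ (p • Finsupp.single i 1).degree := by
      simpa [subst_X, X_pow_eq_monomial] using hL i
    induction n with
    | zero => simp
    | succ n ih =>
      rw [add_comm, Finsupp.single_add, monomial_single_add, pow_one, map_mul, smul_add]
      exact mul_sub_monomial_mem hbase ih

/-- The linear map which sends `X^{pa + e}`, `e_i < p`, to `∏ (X_i^p - L_i)^{a_i} X^e`. For `L_i` of
degree less than `p` it is unitriangular with respect to the degree, and it carries the span of the
monomials that are divisible by some `X_i^p` onto the ideal generated by the `X_i^p - L_i`. -/
def triangular (p : ℕ) (L : σ → MvPolynomial σ R) : MvPolynomial σ R →ₗ[R] MvPolynomial σ R :=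
  (basisMonomials σ R).constr R fun m =>
    subst p L (monomial (m.mapRange (· / p) (Nat.zero_div p)) 1) *
      monomial (m.mapRange (· % p) (Nat.zero_mod p)) 1

theorem triangular_monomial (m : σ →₀ ℕ) : triangular p L (monomial m 1) =
    subst p L (monomial (m.mapRange (· / p) (Nat.zero_div p)) 1) *
      monomial (m.mapRange (· % p) (Nat.zero_mod p)) 1 := by
  simpa only [triangular, coe_basisMonomials] using (basisMonomials σ R).constr_basis R _ m

theorem triangular_monomial_of_lt {m : σ →₀ ℕ} (hm : ∀ i, m i < p) :
    triangular p L (monomial m 1) = monomial m 1 := by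
  have hdiv : m.mapRange (· / p) (Nat.zero_div p) = 0 := by
    ext i; simp [Nat.div_eq_of_lt (hm i)]
  have hmod : m.mapRange (· % p) (Nat.zero_mod p) = m := by
    ext i; simp [Nat.mod_eq_of_lt (hm i)]
  rw [triangular_monomial, hdiv, hmod, monomial_zero', C_1, map_one, one_mul]

theorem sub_triangular_mem (hL : ∀ i, L i ∈ lowDegree R σ p) {n : ℕ} {f : MvPolynomial σ R}
    (hf : f ∈ lowDegree R σ (n + 1)) : f - triangular p L f ∈ lowDegree R σ n := by
  suffices h : lowDegree R σ (n + 1) ≤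
      (lowDegree R σ n).comap (LinearMap.id - triangular p L) from h hf
  rw [lowDegree, restrictSupport_eq_span, Submodule.span_le]
  rintro _ ⟨m, hm, rfl⟩
  have hdivmod : p • m.mapRange (· / p) (Nat.zero_div p) +
      m.mapRange (· % p) (Nat.zero_mod p) = m := by
    ext i
    simp [Nat.div_add_mod]
  have hlead := mul_sub_monomial_mem
    (subst_monomial_sub_mem hL (m.mapRange (· / p) (Nat.zero_div p)))
    (g := monomial (m.mapRange (· % p) (Nat.zero_mod p)) 1) (by rw [sub_self]; exact zero_mem _)
  rw [← triangular_monomial, hdivmod, ← neg_mem_iff, neg_sub] at hlead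
  exact lowDegree_mono (Nat.lt_succ_iff.mp hm) hlead

theorem triangular_bijective (hL : ∀ i, L i ∈ lowDegree R σ p) :
    Function.Bijective (triangular p L) := by
  refine ⟨(injective_iff_map_eq_zero _).mpr fun f hf => ?_, fun f => ?_⟩
  · suffices ∀ n, f ∈ lowDegree R σ n → f = 0 from this _ (mem_lowDegree_totalDegree_succ f)
    intro n
    induction n with
    | zero => exact eq_zero_of_mem_lowDegree_zero
    | succ n ih => exact fun hn => ih (by simpa [hf] using sub_triangular_mem hL hn)
  · suffices ∀ n f, f ∈ lowDegree R σ n → ∃ g, triangular p L g = f from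
      this _ f (mem_lowDegree_totalDegree_succ f)
    intro n
    induction n with
    | zero => exact fun f hf => ⟨0, by rw [eq_zero_of_mem_lowDegree_zero hf, map_zero]⟩
    | succ n ih =>
      intro f hf
      obtain ⟨g, hg⟩ := ih _ (sub_triangular_mem hL hf)
      exact ⟨f + g, by rw [map_add, hg, add_sub_cancel]⟩

theorem triangular_X_pow_mul (hp : 0 < p) (i : σ) (f : MvPolynomial σ R) :
    triangular p L (X i ^ p * f) = (X i ^ p - L i) * triangular p L f := by
  classical
  suffices h : triangular p L ∘ₗ LinearMap.mulLeft R (X i ^ p) =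
      LinearMap.mulLeft R (X i ^ p - L i) ∘ₗ triangular p L from LinearMap.congr_fun h f
  refine (basisMonomials σ R).ext fun m => ?_
  have hdiv : (Finsupp.single i p + m).mapRange (· / p) (Nat.zero_div p) =
      Finsupp.single i 1 + m.mapRange (· / p) (Nat.zero_div p) := by
    ext j
    obtain rfl | hj := eq_or_ne i j
    · simp [Nat.add_div_left, hp, add_comm]
    · simp [hj]
  have hmod : (Finsupp.single i p + m).mapRange (· % p) (Nat.zero_mod p) =
      m.mapRange (· % p) (Nat.zero_mod p) := by
    ext j
    obtain rfl | hj := eq_or_ne i j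
    · simp
    · simp [hj]
  simp only [coe_basisMonomials, LinearMap.comp_apply, LinearMap.mulLeft_apply,
    ← monomial_single_add, triangular_monomial, hdiv, hmod]
  rw [monomial_single_add, map_mul, pow_one, subst_X, mul_assoc]

theorem triangular_eq_self {f : MvPolynomial σ R}
    (hf : f ∈ restrictSupport R {m : σ →₀ ℕ | ∀ i, m i < p}) : triangular p L f = f := by
  rw [restrictSupport_eq_span] at hf
  refine LinearMap.eqOn_span (g := LinearMap.id) ?_ hf
  rintro _ ⟨m, hm, rfl⟩
  exact triangular_monomial_of_lt hm

theorem span_X_pow_sub_le_map_triangular (hL : ∀ i, L i ∈ lowDegree R σ p) (hp : 0 < p) :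
    (Ideal.span (Set.range fun i => X i ^ p - L i)).restrictScalars R ≤
      (restrictSupport R {m | ∃ i, p ≤ m i}).map (triangular p L) := by
  classical
  intro f hf
  obtain ⟨c, rfl⟩ := Finsupp.mem_ideal_span_range_iff_exists_finsupp.mp hf
  refine sum_mem fun i _ => ?_
  obtain ⟨g, hg⟩ := (triangular_bijective hL).2 (c i)
  refine ⟨X i ^ p * g, (mem_restrictSupport_iff R).mpr fun m hm => ⟨i, ?_⟩, by
    rw [triangular_X_pow_mul hp, hg, mul_comm]⟩
  by_contra hlt
  rw [Finset.mem_coe, mem_support_iff, X_pow_eq_monomial, coeff_monomial_mul', if_neg] at hm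
  · exact hm rfl
  · simpa using hlt

theorem isCompl_restrictSupport_span_X_pow_sub (hL : ∀ i, L i ∈ lowDegree R σ p) (hp : 0 < p) :
    IsCompl (restrictSupport R {m : σ →₀ ℕ | ∀ i, m i < p})
      ((Ideal.span (Set.range fun i => X i ^ p - L i)).restrictScalars R) := by
  constructor
  · rw [Submodule.disjoint_def]
    intro f hf hfI
    obtain ⟨g, hg, hgf⟩ := span_X_pow_sub_le_map_triangular hL hp hfI
    obtain rfl := (triangular_bijective hL).1 (hgf.trans (triangular_eq_self hf).symm)
    rw [← support_eq_empty, Finset.eq_empty_iff_forall_notMem]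
    intro m hm
    obtain ⟨i, hi⟩ := hg hm
    exact hi.not_gt (hf hm i)
  · rw [codisjoint_iff_le_sup, ← LinearMap.range_eq_top.mpr (triangular_bijective hL).2,
      ← Submodule.map_top, ← (basisMonomials σ R).span_eq, Submodule.map_span_le]
    rintro _ ⟨m, rfl⟩
    rw [coe_basisMonomials]
    beta_reduce
    by_cases hm : ∀ i, m i < p
    · exact Submodule.mem_sup_left <| by
        rw [triangular_monomial_of_lt hm]
        exact (monomial_mem_restrictSupport R).mpr (.inl hm)
    · obtain ⟨i, hi⟩ := not_forall.mp hm
      obtain ⟨m', rfl⟩ := exists_add_of_le (Finsupp.single_le_iff.mpr (not_lt.mp hi))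
      exact Submodule.mem_sup_right <| by
        rw [monomial_single_add, triangular_X_pow_mul hp]
        exact Ideal.mul_mem_right _ _ (Ideal.subset_span ⟨i, rfl⟩)

end RestrictedMonomials

namespace HopfExt

section PrimitiveElements

variable {k : Type*} {H : Type*} [Field k] [Ring H] [Bialgebra k H]

theorem counit_of_mem_primitives {x : H} (hx : x ∈ primitives k H) :
    Coalgebra.counit (R := k) x = 0 := by
  have h := congrArg (Coalgebra.counit (R := k) ∘ TensorProduct.lid k H ∘
    Coalgebra.counit.rTensor H) (mem_primitives.mp hx)
  simpa using h

theorem comul_pow_of_mem_primitives {x : H} (hx : x ∈ primitives k H) (m : ℕ) :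
    Coalgebra.comul (R := k) (x ^ m) =
      ∑ j ∈ Finset.range (m + 1), m.choose j • ((x ^ j) ⊗ₜ[k] (x ^ (m - j))) := by
  have hcomm : Commute (x ⊗ₜ[k] (1 : H)) ((1 : H) ⊗ₜ[k] x) := by simp [Commute, SemiconjBy]
  rw [Bialgebra.comul_pow, mem_primitives.mp hx, hcomm.add_pow]
  refine Finset.sum_congr rfl fun j _ => ?_
  rw [← Nat.cast_comm, ← nsmul_eq_mul]
  simp [Algebra.TensorProduct.tmul_pow]

/-- The operator `(φ ⊗ id) ∘ Δ`: the action on `H` of the element `φ` of the dual algebra. -/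
def contract (φ : H →ₗ[k] k) : H →ₗ[k] H :=
  (TensorProduct.lid k H).toLinearMap ∘ₗ φ.rTensor H ∘ₗ Coalgebra.comul

theorem contract_of_mem_primitives (φ : H →ₗ[k] k) {x : H} (hx : x ∈ primitives k H) :
    contract φ x = φ x • 1 + φ 1 • x := by
  simp [contract, mem_primitives.mp hx]

theorem eq_sum_of_mem_primitives {S : Type*} [Fintype S] [DecidableEq S] {x : S → H}
    (hx : ∀ s, x s ∈ primitives k H) {φ : S → H →ₗ[k] k} (hφ_one : ∀ s, φ s 1 = 0)
    (hφ_dual : ∀ s t, φ s (x t) = if s = t then 1 else 0)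
    (hφ_ker : ∀ y, (∀ s, contract (φ s) y = 0) → y ∈ Submodule.span k {1})
    {y : H} (hy : y ∈ primitives k H) : y = ∑ s, φ s y • x s := by
  rw [← sub_eq_zero]
  set d := y - ∑ s, φ s y • x s with hd
  have hprim : d ∈ primitives k H :=
    sub_mem hy (sum_mem fun s _ => (primitives k H).smul_mem _ (hx s))
  have hcontract (s : S) : contract (φ s) d = 0 := by
    rw [contract_of_mem_primitives _ hprim, hφ_one, zero_smul, add_zero]
    simp [hd, hφ_dual]
  obtain ⟨r, hr⟩ := Submodule.mem_span_singleton.mp (hφ_ker d hcontract)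
  have hcounit := counit_of_mem_primitives hprim
  rw [← hr, map_smul, Bialgebra.counit_one, smul_eq_mul, mul_one] at hcounit
  rw [← hr, hcounit, zero_smul]

theorem mem_span_singleton_of_forall_map_eq_zero {M : Type*} [AddCommGroup M] [Module k M]
    {E S : Type*} (β : Module.Basis E k M) (e₀ : E) {T : S → M →ₗ[k] M}
    {c : S → E → k} {shift : S → E → E}
    (hT : ∀ s e, T s (β e) = c s e • β (shift s e))
    (hshift : ∀ s, Set.InjOn (shift s) {e | c s e ≠ 0}) (hc : ∀ e, e ≠ e₀ → ∃ s, c s e ≠ 0)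
    {y : M} (hy : ∀ s, T s y = 0) : y ∈ Submodule.span k {β e₀} := by
  have hcoord {e : E} (he : e ≠ e₀) : β.repr y e = 0 := by
    obtain ⟨s, hs⟩ := hc e he
    have hcomp : β.coord (shift s e) ∘ₗ T s = c s e • β.coord e := by
      classical
      refine β.ext fun e' => ?_
      obtain rfl | he' := eq_or_ne e' e
      · simp [hT]
      · by_cases hs' : c s e' = 0
        · simp [hT, hs', he']
        · have hne := mt (hshift s hs' hs) he'
          simp [hT, he', hne]
    have happly := LinearMap.congr_fun hcomp y
    rw [LinearMap.comp_apply, hy, map_zero, LinearMap.smul_apply, smul_eq_mul] at happly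
    exact (mul_eq_zero.mp happly.symm).resolve_left hs
  rw [← β.linearCombination_repr y, Finsupp.linearCombination_apply, Finsupp.sum]
  refine sum_mem fun e _ => ?_
  obtain rfl | he := eq_or_ne e e₀
  · exact Submodule.smul_mem _ _ (Submodule.mem_span_singleton_self _)
  · simp [hcoord he]

end PrimitiveElements

end HopfExt

namespace RestrictedEnveloping

open MvPolynomial RestrictedMonomials

theorem prod_tmul_prod {k A B S : Type*} [CommSemiring k] [CommSemiring A] [CommSemiring B]
    [Algebra k A] [Algebra k B] (s : Finset S) (f : S → A) (g : S → B) :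
    (∏ i ∈ s, f i) ⊗ₜ[k] (∏ i ∈ s, g i) = ∏ i ∈ s, f i ⊗ₜ[k] g i := by
  classical
  induction s using Finset.induction_on with
  | empty => simp [Algebra.TensorProduct.one_def]
  | insert i s hi ih => simp [Finset.prod_insert hi, ← ih]

theorem val_pi_single_one {p : ℕ} [NeZero p] (hp : 1 < p) {σ : Type*} [DecidableEq σ] (i j : σ) :
    ((Pi.single i 1 : σ → Fin p) j : ℕ) = (Pi.single i 1 : σ → ℕ) j := by
  obtain rfl | hij := eq_or_ne i j
  · simp [Nat.mod_eq_of_lt hp]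
  · simp [hij.symm]

section Presentation

variable {k : Type*} {L : Type*} [Field k] [AddCommGroup L] [Module k L] {σ : Type*}
  (b : Module.Basis σ k L)

/-- The elements of `L` as linear forms in variables `X i` which stand for the `b i`. -/
def toLinearForm : L →ₗ[k] MvPolynomial σ k := b.constr k X

@[simp]
theorem toLinearForm_basis (i : σ) : toLinearForm b (b i) = X i := b.constr_basis ..

theorem toLinearForm_mem_lowDegree {n : ℕ} (hn : 1 < n) (x : L) :
    toLinearForm b x ∈ lowDegree k σ n := by
  induction b.mem_span x using Submodule.span_induction with
  | mem x hx =>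
    obtain ⟨i, rfl⟩ := hx
    rw [toLinearForm_basis]
    exact monomial_mem_lowDegree (by simpa using hn) 1
  | zero => simp
  | add x y _ _ hx hy => rw [map_add]; exact add_mem hx hy
  | smul c x _ hx => rw [map_smul]; exact Submodule.smul_mem _ _ hx

end Presentation

section Presentation

variable {k : Type*} {p : ℕ} {L : Type*} [Field k] [LieRing L] [LieAlgebra k L]
  [RestrictedLieAlgebra k p L] {σ : Type*} (b : Module.Basis σ k L)

variable (p) in
/-- The ideal generated by the relations `X_i^p = b_i^[p]` of `u(L)`. -/
def relIdeal : Ideal (MvPolynomial σ k) :=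
  Ideal.span (Set.range fun i => X i ^ p - toLinearForm b (RestrictedLieAlgebra.pMap k p (b i)))

theorem isCompl_restrictSupport_relIdeal [hp : Fact p.Prime] :
    IsCompl (restrictSupport k {m : σ →₀ ℕ | ∀ i, m i < p})
      ((relIdeal p b).restrictScalars k) :=
  isCompl_restrictSupport_span_X_pow_sub
    (fun _ => toLinearForm_mem_lowDegree b hp.out.one_lt _) hp.out.pos

theorem ι_mem_primitives [Fact p.Prime] [CharP k p] (x : L) :
    ι k p L x ∈ HopfExt.primitives k (RestrictedEnveloping k p L) :=
  comul_ι k p L x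

variable [IsLieAbelian L]

theorem pMap_add_of_isLieAbelian [Fact p.Prime] (x y : L) : RestrictedLieAlgebra.pMap k p (x + y) =
    RestrictedLieAlgebra.pMap k p x + RestrictedLieAlgebra.pMap k p y := by
  rw [RestrictedLieAlgebra.pMap_add, RestrictedLie.jacobsonSum_eq_zero, add_zero]

/-- The evaluation of polynomials at the basis elements `b i` in `u(L)`. -/
def ofPolynomial : MvPolynomial σ k →ₐ[k] RestrictedEnveloping k p L :=
  MvPolynomial.aeval fun i => ι k p L (b i)

@[simp]
theorem ofPolynomial_X (i : σ) : ofPolynomial (p := p) b (X i) = ι k p L (b i) := aeval_X _ i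

theorem ofPolynomial_toLinearForm (x : L) :
    ofPolynomial (p := p) b (toLinearForm b x) = ι k p L x := by
  have h : (ofPolynomial (p := p) b).toLinearMap ∘ₗ toLinearForm b = (ι k p L).toLinearMap :=
    b.ext fun i => by simp
  exact LinearMap.congr_fun h x

/-- The monomials in the elements of a basis. -/
def monom [Fintype σ] (e : σ → ℕ) : RestrictedEnveloping k p L := ∏ i, ι k p L (b i) ^ e i

theorem ofPolynomial_monomial [Fintype σ] (m : σ →₀ ℕ) :
    ofPolynomial (p := p) b (monomial m 1) = monom b m := by
  rw [monomial_eq, Finsupp.prod_fintype _ _ (by simp), C_1, one_mul, map_prod]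
  simp [monom]

theorem ofPolynomial_eq_zero {f : MvPolynomial σ k} (hf : f ∈ relIdeal p b) :
    ofPolynomial (p := p) b f = 0 := by
  suffices h : relIdeal p b ≤ RingHom.ker (ofPolynomial (p := p) b) from h hf
  rw [relIdeal, Ideal.span_le]
  rintro _ ⟨i, rfl⟩
  simp [ofPolynomial_toLinearForm, ι_pMap]

theorem ofPolynomial_surjective : Function.Surjective (ofPolynomial (p := p) b) := by
  rw [← AlgHom.range_eq_top, eq_top_iff]
  rintro a -
  induction a using induction with
  | hal r => exact algebraMap_mem _ r
  | hι x => exact ⟨_, ofPolynomial_toLinearForm b x⟩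
  | hadd x y hx hy => exact add_mem hx hy
  | hmul x y hx hy => exact mul_mem hx hy

theorem monom_single [Fintype σ] [DecidableEq σ] (i : σ) :
    monom b (Pi.single i 1) = ι k p L (b i) := by
  rw [monom, Finset.prod_eq_single i] <;> simp +contextual

variable [hp : Fact p.Prime]

theorem span_monom [Fintype σ] : ⊤ ≤ Submodule.span k
    (Set.range fun e : σ → Fin p => (monom b fun i => (e i : ℕ) : RestrictedEnveloping k p L)) := by
  rintro a -
  obtain ⟨f, rfl⟩ := ofPolynomial_surjective b a
  obtain ⟨g, hg, g', hg', rfl⟩ := Submodule.mem_sup.mp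
    ((isCompl_restrictSupport_relIdeal (p := p) b).sup_eq_top.ge (Submodule.mem_top (x := f)))
  rw [map_add, ofPolynomial_eq_zero b hg', add_zero]
  rw [restrictSupport_eq_span] at hg
  refine Submodule.span_le.mpr ?_ (Submodule.apply_mem_span_image_of_mem_span
    (ofPolynomial (p := p) b).toLinearMap hg)
  rintro _ ⟨_, ⟨m, hm, rfl⟩, rfl⟩
  exact Submodule.subset_span ⟨fun i => ⟨m i, hm i⟩, (ofPolynomial_monomial b m).symm⟩

variable [CharP k p]

theorem mk_toLinearForm_pMap (x : L) :
    Ideal.Quotient.mkₐ k (relIdeal p b) (toLinearForm b (RestrictedLieAlgebra.pMap k p x)) =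
      Ideal.Quotient.mkₐ k (relIdeal p b) (toLinearForm b x) ^ p := by
  induction b.mem_span x using Submodule.span_induction with
  | mem x hx =>
    obtain ⟨i, rfl⟩ := hx
    rw [← map_pow, eq_comm, toLinearForm_basis]
    exact Ideal.Quotient.eq.mpr (Ideal.subset_span ⟨i, rfl⟩)
  | zero =>
    have hzero : RestrictedLieAlgebra.pMap k p (0 : L) = 0 := by
      simpa [hp.out.ne_zero] using RestrictedLieAlgebra.pMap_smul (p := p) (0 : k) (0 : L)
    simp [hzero, hp.out.ne_zero]
  | add x y _ _ hx hy =>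
    rw [pMap_add_of_isLieAbelian]
    simp only [map_add, hx, hy]
    exact (HopfExt.add_pow_of_commute k p (Commute.all _ _)).symm
  | smul c x _ hx => simp only [RestrictedLieAlgebra.pMap_smul, map_smul, hx, smul_pow]

/-- The comparison of `u(L)` with its presentation; see `toQuotient_ofPolynomial`. -/
def toQuotient : RestrictedEnveloping k p L →ₐ[k] MvPolynomial σ k ⧸ relIdeal p b :=
  lift k p
    { toLinearMap := (Ideal.Quotient.mkₐ k (relIdeal p b)).toLinearMap ∘ₗ toLinearForm b
      map_lie' := fun {x y} => by
        rw [LieRing.of_associative_ring_bracket, mul_comm, sub_self]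
        simp [trivial_lie_zero] }
    (mk_toLinearForm_pMap b)

theorem toQuotient_ι (x : L) :
    toQuotient b (ι k p L x) = Ideal.Quotient.mkₐ k (relIdeal p b) (toLinearForm b x) :=
  lift_ι _ _ _ _ _

theorem toQuotient_ofPolynomial (f : MvPolynomial σ k) :
    toQuotient b (ofPolynomial b f) = Ideal.Quotient.mkₐ k (relIdeal p b) f := by
  have h : (toQuotient b).comp (ofPolynomial b) = Ideal.Quotient.mkₐ k (relIdeal p b) :=
    MvPolynomial.algHom_ext fun i => by simp [toQuotient_ι]
  exact DFunLike.congr_fun h f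

end Presentation

variable {k : Type*} {p : ℕ} {L : Type*} [Field k] [LieRing L] [LieAlgebra k L]
  [RestrictedLieAlgebra k p L] [IsLieAbelian L] [hp : Fact p.Prime] [CharP k p]
  {σ : Type*} [Fintype σ] (b : Module.Basis σ k L)

theorem linearIndependent_monom : LinearIndependent k
    fun e : σ → Fin p => (monom b fun i => (e i : ℕ) : RestrictedEnveloping k p L) := by
  let exponent (e : σ → Fin p) : σ →₀ ℕ := Finsupp.equivFunOnFinite.symm fun i => (e i : ℕ)
  have hinj : Function.Injective exponent := fun e e' h => by
    simpa [exponent, funext_iff, Fin.ext_iff] using h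
  have hdisj : Disjoint (Submodule.span k (Set.range (basisMonomials σ k ∘ exponent)))
      (LinearMap.ker (Ideal.Quotient.mkₐ k (relIdeal p b)).toLinearMap) := by
    refine (isCompl_restrictSupport_relIdeal (p := p) b).disjoint.mono ?_ fun f hf => ?_
    · rw [Submodule.span_le, coe_basisMonomials]
      rintro _ ⟨e, rfl⟩
      exact (monomial_mem_restrictSupport k).mpr (.inl fun i => (e i).isLt)
    · exact Ideal.Quotient.eq_zero_iff_mem.mp hf
  refine LinearIndependent.of_comp (toQuotient b).toLinearMap ?_
  have hcomp : ⇑(toQuotient b).toLinearMap ∘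
      (fun e : σ → Fin p => (monom b fun i => (e i : ℕ) : RestrictedEnveloping k p L)) =
      (Ideal.Quotient.mkₐ k (relIdeal p b)).toLinearMap ∘ basisMonomials σ k ∘ exponent := by
    ext e
    simp only [Function.comp_apply, coe_basisMonomials, AlgHom.toLinearMap_apply,
      ← toQuotient_ofPolynomial, ofPolynomial_monomial]
    rfl
  rw [hcomp]
  exact ((basisMonomials σ k).linearIndependent.comp exponent hinj).map hdisj

variable (p) in
/-- The basis of `u(L)` which consists of the monomials with exponents less than `p`. -/
def monomBasis : Module.Basis (σ → Fin p) k (RestrictedEnveloping k p L) :=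
  .mk (linearIndependent_monom b) (span_monom b)

theorem monomBasis_apply (e : σ → Fin p) : monomBasis p b e = monom b fun i => (e i : ℕ) := by
  simp [monomBasis]

theorem comul_monom [DecidableEq σ] (n : σ → ℕ) :
    Coalgebra.comul (R := k) (monom b n : RestrictedEnveloping k p L) =
      ∑ f ∈ Fintype.piFinset fun i => Finset.range (n i + 1),
        (∏ i, (n i).choose (f i)) • (monom b f ⊗ₜ[k] monom b (n - f)) := by
  rw [← Bialgebra.comulAlgHom_apply, monom, map_prod]
  simp only [Bialgebra.comulAlgHom_apply,
    HopfExt.comul_pow_of_mem_primitives (ι_mem_primitives (k := k) (p := p) _),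
    Finset.prod_univ_sum, Finset.prod_smul,
    ← prod_tmul_prod]
  rfl

theorem coord_monom (e : σ → Fin p) {n : σ → ℕ} (hn : ∀ i, n i < p) :
    (monomBasis p b).coord e (monom b n) = if n = (fun i => (e i : ℕ)) then 1 else 0 := by
  classical
  have h : monom b n = monomBasis p b fun i => ⟨n i, hn i⟩ := by rw [monomBasis_apply]
  rw [h, Module.Basis.coord_apply, Module.Basis.repr_self, Finsupp.single_apply]
  simp only [funext_iff, Fin.ext_iff]

theorem contract_monom [DecidableEq σ] (i : σ) {n : σ → ℕ} (hn : ∀ i, n i < p) :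
    HopfExt.contract ((monomBasis p b).coord (Pi.single i 1)) (monom b n) =
      n i • monom b (n - Pi.single i 1) := by
  simp only [HopfExt.contract, LinearMap.comp_apply, comul_monom, map_sum, map_nsmul,
    LinearMap.rTensor_tmul, LinearEquiv.coe_coe]
  rw [Finset.sum_eq_single (Pi.single i 1)]
  · have hchoose : ∏ j, (n j).choose ((Pi.single i 1 : σ → ℕ) j) = n i := by
      rw [Finset.prod_eq_single i] <;> simp +contextual
    rw [hchoose, coord_monom b _ fun j => ?_, if_pos, TensorProduct.lid_tmul, one_smul]
    · simp only [val_pi_single_one hp.out.one_lt]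
    · rw [← val_pi_single_one hp.out.one_lt]
      exact Fin.isLt _
  · intro f hf hfi
    have hfp (j : σ) : f j < p :=
      (Nat.lt_succ_iff.mp (Finset.mem_range.mp (Fintype.mem_piFinset.mp hf j))).trans_lt (hn j)
    rw [coord_monom b _ hfp, if_neg, TensorProduct.lid_tmul, zero_smul, smul_zero]
    simpa only [val_pi_single_one hp.out.one_lt] using hfi
  · intro h
    have h0 : n i = 0 := by
      by_contra h0
      refine h (Fintype.mem_piFinset.mpr fun j => ?_)
      rw [Finset.mem_range, Pi.single_apply]
      split_ifs with hj
      · subst hj; lia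
      · lia
    rw [Finset.prod_eq_zero (Finset.mem_univ i) (by simp [h0]), zero_smul]

theorem contract_monomBasis [DecidableEq σ] (i : σ) (e : σ → Fin p) :
    HopfExt.contract ((monomBasis p b).coord (Pi.single i 1)) (monomBasis p b e) =
      ((e i : ℕ) : k) • monomBasis p b (e - Pi.single i 1) := by
  rw [monomBasis_apply, contract_monom b i fun j => (e j).isLt, Nat.cast_smul_eq_nsmul]
  by_cases hei : e i = 0
  · simp [hei]
  congr 1
  rw [monomBasis_apply]
  congr 1 with j
  obtain rfl | hij := eq_or_ne i j
  · simp [Fin.val_sub_one_of_ne_zero hei]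
  · simp [hij.symm]

theorem coord_ι [DecidableEq σ] (i : σ) (x : L) :
    (monomBasis p b).coord (Pi.single i 1) (ι k p L x) = b.coord i x := by
  have h : (monomBasis p b).coord (Pi.single i 1) ∘ₗ (ι k p L).toLinearMap = b.coord i := by
    refine b.ext fun j => ?_
    have hsingle : ι k p L (b j) = monomBasis p b (Pi.single j 1) := by
      rw [monomBasis_apply, ← monom_single]
      simp only [val_pi_single_one hp.out.one_lt]
    have hinj : Function.Injective fun i : σ => (Pi.single i 1 : σ → Fin p) := by
      intro i j h
      by_contra hij
      exact hp.out.ne_one (by simpa [hij] using congrFun h i)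
    change (monomBasis p b).coord _ (ι k p L (b j)) = _
    simp only [hsingle, Module.Basis.coord_apply, Module.Basis.repr_self, Finsupp.single_apply,
      hinj.eq_iff]
  exact LinearMap.congr_fun h x

theorem eq_sum_of_mem_primitives [DecidableEq σ] {y : RestrictedEnveloping k p L}
    (hy : y ∈ HopfExt.primitives k (RestrictedEnveloping k p L)) :
    y = ∑ i, (monomBasis p b).coord (Pi.single i 1) y • ι k p L (b i) := by
  have hone : monomBasis p b 0 = 1 := by simp [monomBasis_apply, monom]
  refine HopfExt.eq_sum_of_mem_primitives (fun i => ι_mem_primitives (b i)) (fun i => ?_)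
    (fun i j => ?_) (fun y hy => ?_) hy
  · have hne : (Pi.single i 1 : σ → Fin p) ≠ 0 := by
      simpa using (Fin.one_eq_zero_iff.not.mpr hp.out.one_lt.ne')
    rw [← hone, Module.Basis.coord_apply, Module.Basis.repr_self, Finsupp.single_eq_of_ne hne]
  · rw [coord_ι]
    simp [Finsupp.single_apply, eq_comm]
  · rw [← hone]
    refine HopfExt.mem_span_singleton_of_forall_map_eq_zero (monomBasis p b) 0
      (contract_monomBasis b) (fun i => (sub_left_injective).injOn) (fun e he => ?_) hy
    obtain ⟨i, hi⟩ := Function.ne_iff.mp he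
    refine ⟨i, fun h => hi (Fin.ext ?_)⟩
    exact Nat.eq_zero_of_dvd_of_lt ((CharP.cast_eq_zero_iff k p _).mp h) (e i).isLt

section FiniteDimensional

variable (k p L) [FiniteDimensional k L]

theorem ι_injective : Function.Injective (ι k p L) := by
  classical
  intro x y h
  refine (Module.finBasis k L).ext_elem fun i => ?_
  have hcoord := congrArg ((monomBasis p (Module.finBasis k L)).coord (Pi.single i 1)) h
  rwa [coord_ι, coord_ι] at hcoord

theorem primitives_eq_range :
    (HopfExt.primitives k (RestrictedEnveloping k p L) : Set (RestrictedEnveloping k p L)) =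
      Set.range (ι k p L) := by
  classical
  refine Set.Subset.antisymm (fun y hy => ?_) (Set.range_subset_iff.mpr ι_mem_primitives)
  rw [eq_sum_of_mem_primitives (Module.finBasis k L) hy]
  exact (ι k p L).range.sum_mem fun i _ => (ι k p L).range.smul_mem _ ⟨_, rfl⟩

theorem finrank_primitives :
    Module.finrank k (HopfExt.primitives k (RestrictedEnveloping k p L)) =
      Module.finrank k L := by
  have h : (HopfExt.primitives k (RestrictedEnveloping k p L)).toSubmodule =
      LinearMap.range (ι k p L).toLinearMap := SetLike.coe_injective (primitives_eq_range k p L)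
  change Module.finrank k (HopfExt.primitives k (RestrictedEnveloping k p L)).toSubmodule = _
  rw [h]
  exact LinearMap.finrank_range_of_inj (ι_injective k p L)

theorem finrank_eq : Module.finrank k (RestrictedEnveloping k p L) = p ^ Module.finrank k L := by
  rw [Module.finrank_eq_card_basis (monomBasis p (Module.finBasis k L))]
  simp

instance : FiniteDimensional k (RestrictedEnveloping k p L) :=
  (monomBasis p (Module.finBasis k L)).finiteDimensional_of_finite

end FiniteDimensional

end RestrictedEnveloping

/-! ### The Hopf algebra `B` -/

section PPolynomial

open Polynomial

variable (k : Type*) (p : ℕ) [Field k] {n : ℕ} (lam : Fin n → k) [hp : Fact p.Prime]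

theorem degree_pPolynomial_tail :
    (∑ i : Fin n, C (lam i) * X ^ p ^ (i : ℕ) : k[X]).degree < (p ^ n : ℕ) := by
  refine (degree_sum_le _ _).trans_lt ((Finset.sup_lt_iff (WithBot.bot_lt_coe _)).mpr fun i _ => ?_)
  exact (degree_C_mul_X_pow_le _ _).trans_lt (mod_cast Nat.pow_lt_pow_right hp.out.one_lt i.2)

theorem monic_pPolynomial : (pPolynomial k p lam).Monic :=
  monic_X_pow_add (degree_pPolynomial_tail k p lam)

theorem natDegree_pPolynomial : (pPolynomial k p lam).natDegree = p ^ n := by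
  refine natDegree_eq_of_degree_eq_some ?_
  rw [pPolynomial, degree_add_eq_left_of_degree_lt, degree_X_pow]
  exact (degree_pPolynomial_tail k p lam).trans_eq (degree_X_pow _).symm

variable {A : Type*} [CommRing A] [Algebra k A]

theorem natDegree_pPolynomial_map_add_C [Nontrivial A] (Θ : A) :
    ((pPolynomial k p lam).map (algebraMap k A) + C Θ).natDegree = p ^ n := by
  rw [natDegree_add_C, (monic_pPolynomial k p lam).natDegree_map, natDegree_pPolynomial]

theorem monic_pPolynomial_map_add_C (Θ : A) :
    ((pPolynomial k p lam).map (algebraMap k A) + C Θ).Monic := by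
  nontriviality A
  refine ((monic_pPolynomial k p lam).map _).add_of_left (degree_C_le.trans_lt ?_)
  rw [← natDegree_pos_iff_degree_pos, (monic_pPolynomial k p lam).natDegree_map,
    natDegree_pPolynomial]
  exact Nat.pow_pos hp.out.pos

end PPolynomial

/-- The basis of the powers of the root in `AdjoinRoot g`, for a monic polynomial `g` whose degree
is given as `N`. -/
def adjoinRootBasis {R : Type*} [CommRing R] {g : Polynomial R} (hg : g.Monic) {N : ℕ}
    (hN : g.natDegree = N) : Module.Basis (Fin N) R (AdjoinRoot g) :=
  (AdjoinRoot.powerBasisAux' hg).reindex (finCongr hN)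

theorem adjoinRootBasis_apply {R : Type*} [CommRing R] {g : Polynomial R} (hg : g.Monic) {N : ℕ}
    (hN : g.natDegree = N) (j : Fin N) :
    adjoinRootBasis hg hN j = AdjoinRoot.root g ^ (j : ℕ) := by
  subst hN
  rw [adjoinRootBasis, Module.Basis.reindex_apply]
  exact (AdjoinRoot.powerBasis' hg).basis_eq_pow j

theorem HopfExt.choose_pow_mul_modEq (p v m : ℕ) [hp : Fact p.Prime] :
    (p ^ v * m).choose (p ^ v) ≡ m [MOD p] := by
  induction v with
  | zero => simpa using Nat.ModEq.rfl
  | succ v ih =>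
    refine Choose.choose_modEq_choose_mod_mul_choose_div_nat.trans ?_
    rw [pow_succ', mul_assoc, Nat.mul_mod_right, Nat.mul_mod_right,
      Nat.mul_div_cancel_left _ hp.out.pos, Nat.mul_div_cancel_left _ hp.out.pos, Nat.choose_self,
      one_mul]
    exact ih

namespace MonogenicHopf

variable (k : Type*) (p : ℕ) [Field k] {n : ℕ} (lam : Fin n → k) [hp : Fact p.Prime]

/-- The basis of the powers of `z`. -/
def powerBasis : Module.Basis (Fin (p ^ n)) k (MonogenicHopf k p lam) :=
  adjoinRootBasis (monic_pPolynomial k p lam) (natDegree_pPolynomial k p lam)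

theorem powerBasis_apply (j : Fin (p ^ n)) : powerBasis k p lam j = z k p lam ^ (j : ℕ) :=
  adjoinRootBasis_apply _ _ j

/-- The exponent `p^i`. -/
def powIdx (n : ℕ) (i : Fin n) : Fin (p ^ n) :=
  ⟨p ^ (i : ℕ), Nat.pow_lt_pow_right hp.out.one_lt i.2⟩

variable {k p lam}

theorem coord_pow (j : Fin (p ^ n)) {m : ℕ} (hm : m < p ^ n) :
    (powerBasis k p lam).coord j (z k p lam ^ m) = if m = j then 1 else 0 := by
  have h : z k p lam ^ m = powerBasis k p lam ⟨m, hm⟩ :=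
    (powerBasis_apply k p lam ⟨m, hm⟩).symm
  rw [h, Module.Basis.coord_apply, Module.Basis.repr_self, Finsupp.single_apply]
  simp only [Fin.ext_iff]

variable [CharP k p]

theorem z_pow_mem_primitives (i : ℕ) :
    z k p lam ^ p ^ i ∈ HopfExt.primitives k (MonogenicHopf k p lam) := by
  induction i with
  | zero => rw [pow_zero, pow_one]; exact (zPrim k p lam).2
  | succ m ih => rw [pow_succ, pow_mul]; exact HopfExt.pow_mem_primitives p ih

theorem contract_powerBasis (i : Fin n) (e : Fin (p ^ n)) :
    HopfExt.contract ((powerBasis k p lam).coord (powIdx p n i)) (powerBasis k p lam e) =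
      ((e : ℕ).choose (p ^ (i : ℕ)) : k) • powerBasis k p lam (e - powIdx p n i) := by
  rw [powerBasis_apply, HopfExt.contract, LinearMap.comp_apply, LinearMap.comp_apply,
    HopfExt.comul_pow_of_mem_primitives (comul_z k p lam), map_sum, map_sum]
  simp only [map_nsmul, LinearMap.rTensor_tmul, LinearEquiv.coe_coe, TensorProduct.lid_tmul]
  rw [Finset.sum_eq_single (p ^ (i : ℕ))]
  · rw [coord_pow _ (m := p ^ (i : ℕ)) (powIdx p n i).2, if_pos (by rfl), one_smul,
      Nat.cast_smul_eq_nsmul]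
    obtain hlt | hle := lt_or_ge (e : ℕ) (p ^ (i : ℕ))
    · rw [Nat.choose_eq_zero_of_lt hlt, zero_smul, zero_smul]
    · rw [powerBasis_apply, Fin.sub_val_of_le (Fin.le_def.mpr hle), powIdx]
  · intro j hj hji
    rw [coord_pow _ ((Nat.lt_succ_iff.mp (Finset.mem_range.mp hj)).trans_lt e.2),
      if_neg (by exact hji), zero_smul, smul_zero]
  · intro h
    rw [Nat.choose_eq_zero_of_lt (by simpa using h), zero_smul]

theorem exists_choose_pow_ne_zero {e : Fin (p ^ n)} (he : (e : ℕ) ≠ 0) :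
    ∃ i : Fin n, ((e : ℕ).choose (p ^ (i : ℕ)) : k) ≠ 0 := by
  obtain ⟨v, m, hm, hv⟩ := Nat.exists_eq_pow_mul_and_not_dvd he p hp.out.ne_one
  have hle : p ^ v ≤ e := Nat.le_of_dvd (Nat.pos_of_ne_zero he) ⟨m, hv⟩
  refine ⟨⟨v, (Nat.pow_lt_pow_iff_right hp.out.one_lt).mp (hle.trans_lt e.2)⟩, ?_⟩
  have hchoose := (HopfExt.choose_pow_mul_modEq p v m).dvd_iff dvd_rfl
  rwa [← hv, ← CharP.cast_eq_zero_iff k p, ← not_iff_not, iff_true_right hm] at hchoose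

theorem eq_sum_of_mem_primitives {y : MonogenicHopf k p lam}
    (hy : y ∈ HopfExt.primitives k (MonogenicHopf k p lam)) :
    y = ∑ i, (powerBasis k p lam).coord (powIdx p n i) y • z k p lam ^ p ^ (i : ℕ) := by
  refine HopfExt.eq_sum_of_mem_primitives (fun i : Fin n => z_pow_mem_primitives i) (fun i => ?_)
    (fun i j => ?_) (fun y hy => ?_) hy
  · rw [← pow_zero (z k p lam), coord_pow _ (Nat.pow_pos hp.out.pos), if_neg]
    exact (Nat.pow_pos hp.out.pos).ne
  · rw [coord_pow _ (m := p ^ (j : ℕ)) (powIdx p n j).2]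
    simp [powIdx, Nat.pow_right_inj hp.out.one_lt, Fin.ext_iff, eq_comm]
  · have hone : powerBasis k p lam 0 = 1 := by simp [powerBasis_apply]
    rw [← hone]
    refine HopfExt.mem_span_singleton_of_forall_map_eq_zero (powerBasis k p lam) 0
      contract_powerBasis (fun i => sub_left_injective.injOn) (fun e he => ?_) hy
    exact exists_choose_pow_ne_zero fun h => he (Fin.ext h)

end MonogenicHopf

/-! ### The algebra `u(D)` -/

namespace CompatibleDatum

section UniversalProperty

variable {k : Type*} {p : ℕ} {h : Type*} [Field k] [Fact p.Prime] [CharP k p]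
  [LieRing h] [LieAlgebra k h] [IsLieAbelian h] [RestrictedLieAlgebra k p h]
  {n : ℕ} {lam : Fin n → k} (D : CompatibleDatum k p h lam)

theorem quotMap_rel {a b : D.Free} (hab : D.Rel a b) : D.quotMap a = D.quotMap b :=
  RingQuot.mkAlgHom_rel k hab

theorem incl_apply (a : RestrictedEnveloping k p h) : D.incl a = D.quotMap (D.genA a) := rfl

theorem lie_x_incl (a : RestrictedEnveloping k p h) : ⁅D.x, D.incl a⁆ = D.incl (D.ρz a) := by
  rw [LieRing.of_associative_ring_bracket, incl_apply, incl_apply,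
    ← D.quotMap_rel (Rel.bracket a), map_sub, map_mul, map_mul, x]

theorem x_mul_incl (a : RestrictedEnveloping k p h) :
    D.x * D.incl a = D.incl a * D.x + D.incl (D.ρz a) := by
  rw [← lie_x_incl, LieRing.of_associative_ring_bracket, add_sub_cancel]

theorem aeval_x : Polynomial.aeval D.x (pPolynomial k p lam) + D.incl D.Θ = 0 := by
  have htop := D.quotMap_rel Rel.top
  rwa [map_add, map_zero, ← Polynomial.aeval_algHom_apply] at htop

variable {C : Type*} [Ring C] [Algebra k C]

/-- The universal property of `u(D)`: an algebra map out of `A` and an element `c` satisfying the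
defining relations of `x` give an algebra map out of `u(D)`. -/
def lift (φ : RestrictedEnveloping k p h →ₐ[k] C) (c : C)
    (hlie : ∀ a, ⁅c, φ a⁆ = φ (D.ρz a))
    (htop : Polynomial.aeval c (pPolynomial k p lam) + φ D.Θ = 0) : D.u →ₐ[k] C :=
  RingQuot.liftAlgHom k ⟨FreeAlgebra.lift k (Sum.elim φ fun _ => c), by
    intro _ _ hrel
    induction hrel with
    | add a b => simp
    | mul a b => simp
    | scalar r => simp
    | bracket a => simpa [LieRing.of_associative_ring_bracket] using hlie a
    | top => simpa [← Polynomial.aeval_algHom_apply] using htop⟩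

@[simp]
theorem lift_incl (φ : RestrictedEnveloping k p h →ₐ[k] C) (c : C) (hlie htop)
    (a : RestrictedEnveloping k p h) : D.lift φ c hlie htop (D.incl a) = φ a :=
  (RingQuot.liftAlgHom_mkAlgHom_apply ..).trans (FreeAlgebra.lift_ι_apply ..)

@[simp]
theorem lift_x (φ : RestrictedEnveloping k p h →ₐ[k] C) (c : C) (hlie htop) :
    D.lift φ c hlie htop D.x = c :=
  (RingQuot.liftAlgHom_mkAlgHom_apply ..).trans (FreeAlgebra.lift_ι_apply ..)

variable {D}

theorem induction {q : D.u → Prop} (incl : ∀ a, q (D.incl a)) (x : q D.x)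
    (add : ∀ u v, q u → q v → q (u + v)) (mul : ∀ u v, q u → q v → q (u * v)) (u : D.u) : q u := by
  obtain ⟨f, rfl⟩ := RingQuot.mkAlgHom_surjective k D.Rel u
  change q (D.quotMap f)
  induction f using FreeAlgebra.induction with
  | grade0 r => rw [AlgHom.commutes, ← D.incl.commutes]; exact incl _
  | grade1 a => exact a.rec incl fun _ => x
  | mul f g hf hg => rw [map_mul]; exact mul _ _ hf hg
  | add f g hf hg => rw [map_add]; exact add _ _ hf hg

theorem algHom_ext {f g : D.u →ₐ[k] C} (hincl : ∀ a, f (D.incl a) = g (D.incl a))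
    (hx : f D.x = g D.x) : f = g := by
  ext u
  induction u using induction with
  | incl a => exact hincl a
  | x => exact hx
  | add u v hu hv => rw [map_add, map_add, hu, hv]
  | mul u v hu hv => rw [map_mul, map_mul, hu, hv]

end UniversalProperty

end CompatibleDatum

namespace HopfExt

section Derivations

open Polynomial

variable {k : Type*} [Field k]

theorem map_aeval_apply {M N : Type*} [AddCommGroup M] [Module k M] [AddCommGroup N] [Module k N]
    {δ : Module.End k M} {ε : Module.End k N} {ψ : M →ₗ[k] N} (hψ : ∀ m, ψ (δ m) = ε (ψ m))
    (f : k[X]) (m : M) : ψ (aeval δ f m) = aeval ε f (ψ m) := by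
  induction f using Polynomial.induction_on' with
  | add f g hf hg => simp [hf, hg]
  | monomial j c =>
    have hpow : ψ ((δ ^ j) m) = (ε ^ j) (ψ m) := by
      induction j with
      | zero => rfl
      | succ j ih => rw [pow_succ', pow_succ', Module.End.mul_apply, hψ, ih, Module.End.mul_apply]
    simp [aeval_monomial, Algebra.algebraMap_eq_smul_one, hpow]

variable {R : Type*} [CommRing R] [Algebra k R]

/-- The derivation of `R[X]` acting as `d` on coefficients. -/
def mapCoeffs (d : Derivation k R R) : Derivation k R[X] R[X] :=
  PolynomialModule.equivPolynomialSelf.compDer d.mapCoeffs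

theorem coeff_mapCoeffs (d : Derivation k R R) (f : R[X]) (i : ℕ) :
    (mapCoeffs d f).coeff i = d (f.coeff i) := rfl

variable (p : ℕ) [Fact p.Prime] [CharP k p]

theorem derivation_pow_prime_pow_mul (d : Derivation k R R) (m : ℕ) (r s : R) :
    ((d : Module.End k R) ^ p ^ m) (r * s) =
      r • ((d : Module.End k R) ^ p ^ m) s + s • ((d : Module.End k R) ^ p ^ m) r := by
  have hlie (r : R) : ⁅(d : Module.End k R), Algebra.lmul k R r⁆ = Algebra.lmul k R (d r) := by
    ext s
    simp [LieRing.of_associative_ring_bracket, mul_comm]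
  have hpow := ad_pow_apply_of_lie_eq hlie (p ^ m) r
  rw [ad_pow_prime_pow, LieAlgebra.ad_apply, LieRing.of_associative_ring_bracket,
    sub_eq_iff_eq_add'] at hpow
  simpa [mul_comm s] using LinearMap.congr_fun hpow s

/-- A polynomial in the `p ^ i`-th powers of a derivation in characteristic `p` is again a
derivation. -/
def aevalDerivation {n : ℕ} (lam : Fin n → k) (d : Derivation k R R) : Derivation k R R :=
  Derivation.mk' (aeval (d : Module.End k R) (pPolynomial k p lam)) fun r s => by
    simp only [MonogenicHopf.aeval_pPolynomial, LinearMap.add_apply, LinearMap.sum_apply,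
      LinearMap.smul_apply, derivation_pow_prime_pow_mul, smul_add, Finset.sum_add_distrib,
      Finset.smul_sum, smul_comm (lam _)]
    abel

end Derivations

end HopfExt

theorem HopfExt.coe_pMap_iterate {k : Type*} (p : ℕ) [Field k] [Fact p.Prime] [CharP k p]
    {H : Type*} [CommRing H] [Bialgebra k H] (x : primitives k H) (m : ℕ) :
    (((RestrictedLieAlgebra.pMap k p)^[m] x : primitives k H) : H) = (x : H) ^ p ^ m := by
  induction m with
  | zero => rw [pow_zero, pow_one]; rfl
  | succ m ih =>
    rw [Function.iterate_succ_apply', pow_succ, pow_mul, ← ih]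
    rfl

theorem AlgebraicRep.toLin_pMap_iterate {k : Type*} {p : ℕ} {g h : Type*} [Field k] [LieRing g]
    [LieAlgebra k g] [RestrictedLieAlgebra k p g] [LieRing h] [LieAlgebra k h]
    [RestrictedLieAlgebra k p h] (ρ : AlgebraicRep k p g h) (x : g) (m : ℕ) :
    ρ.toLin ((RestrictedLieAlgebra.pMap k p)^[m] x) = ρ.toLin x ^ p ^ m := by
  induction m with
  | zero => simp
  | succ m ih => rw [Function.iterate_succ_apply', ρ.map_pMap, ih, ← pow_mul, ← pow_succ]

namespace CompatibleDatum

open Polynomial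

variable {k : Type*} {p : ℕ} {h : Type*} [Field k] [hp : Fact p.Prime] [CharP k p]
  [LieRing h] [LieAlgebra k h] [IsLieAbelian h] [RestrictedLieAlgebra k p h]
  {n : ℕ} {lam : Fin n → k} (D : CompatibleDatum k p h lam)

section Representation

theorem aeval_toLin_zPrim :
    aeval (D.ρ.toLin (MonogenicHopf.zPrim k p lam)) (pPolynomial k p lam) = 0 := by
  set z := MonogenicHopf.zPrim k p lam
  have hrel : (RestrictedLieAlgebra.pMap k p)^[n] z +
      ∑ i : Fin n, lam i • (RestrictedLieAlgebra.pMap k p)^[(i : ℕ)] z = 0 := by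
    refine Subtype.ext ?_
    change (HopfExt.primitives k (MonogenicHopf k p lam)).incl (_ + _) = 0
    simp only [map_add, map_sum, map_smul, LieSubalgebra.coe_incl, HopfExt.coe_pMap_iterate]
    exact (MonogenicHopf.aeval_pPolynomial k p lam _).symm.trans (MonogenicHopf.aeval_z k p lam)
  simpa [D.ρ.toLin_pMap_iterate, MonogenicHopf.aeval_pPolynomial] using congrArg D.ρ.toLin hrel

theorem aeval_ρz :
    aeval (D.ρz : Module.End k (RestrictedEnveloping k p h)) (pPolynomial k p lam) = 0 := by
  ext a
  change HopfExt.aevalDerivation p lam D.ρz a = 0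
  induction a using RestrictedEnveloping.induction with
  | hal r => exact Derivation.map_algebraMap _ r
  | hι v =>
    have hv := HopfExt.map_aeval_apply
      (ψ := (RestrictedEnveloping.ι k p h : h →ₗ[k] RestrictedEnveloping k p h))
      (fun v => (D.ρ.derivation_ι (MonogenicHopf.zPrim k p lam) v).symm) (pPolynomial k p lam) v
    rw [D.aeval_toLin_zPrim, LinearMap.zero_apply, map_zero] at hv
    exact hv.symm
  | hadd a b ha hb => rw [map_add, ha, hb, add_zero]
  | hmul a b ha hb => rw [Derivation.leibniz, ha, hb, smul_zero, smul_zero, add_zero]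

/-- The polynomial `f(t) + Θ` over `A`. -/
def poly : (RestrictedEnveloping k p h)[X] :=
  (pPolynomial k p lam).map (algebraMap k (RestrictedEnveloping k p h)) + C D.Θ

/-- The commutative algebra `A[t]/(f(t) + Θ)`, on which `u(D)` is represented. -/
abbrev Model : Type _ := AdjoinRoot D.poly

/-- The canonical map `A → A[t]/(f(t) + Θ)`. -/
def toModel : RestrictedEnveloping k p h →ₐ[k] D.Model := AdjoinRoot.ofAlgHom k D.poly

/-- The generator `t` of the model. -/
def t : D.Model := AdjoinRoot.root D.poly

theorem aeval_t : aeval D.t (pPolynomial k p lam) + D.toModel D.Θ = 0 := by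
  have hroot := AdjoinRoot.eval₂_root D.poly
  rwa [poly, eval₂_add, eval₂_map, eval₂_C] at hroot

theorem mapCoeffs_poly : HopfExt.mapCoeffs D.ρz D.poly = 0 := by
  ext i
  have hΘ : D.ρz D.Θ = 0 := D.ρ_Θ
  rw [HopfExt.coeff_mapCoeffs, poly, coeff_add, coeff_map, coeff_C, map_add,
    Derivation.map_algebraMap, zero_add, coeff_zero, apply_ite D.ρz, hΘ, map_zero, ite_self]

theorem mk_mapCoeffs_eq_zero (f : (RestrictedEnveloping k p h)[X])
    (hf : AdjoinRoot.mkₐ (R := RestrictedEnveloping k p h) D.poly f = 0) :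
    AdjoinRoot.mk D.poly (HopfExt.mapCoeffs D.ρz f) = 0 := by
  obtain ⟨g, rfl⟩ := AdjoinRoot.mk_eq_zero.mp hf
  rw [Derivation.leibniz, mapCoeffs_poly, smul_zero, add_zero, smul_eq_mul, map_mul,
    AdjoinRoot.mk_self, zero_mul]

/-- The derivation of the model which extends `ρ_z` and vanishes on `t`. -/
def modelDer : Derivation k D.Model D.Model :=
  Derivation.liftOfSurjective (f := (AdjoinRoot.mkₐ D.poly).restrictScalars k)
    AdjoinRoot.mk_surjective D.mk_mapCoeffs_eq_zero

theorem modelDer_mk (f : (RestrictedEnveloping k p h)[X]) :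
    D.modelDer (AdjoinRoot.mk D.poly f) = AdjoinRoot.mk D.poly (HopfExt.mapCoeffs D.ρz f) :=
  Derivation.liftOfSurjective_apply (f := (AdjoinRoot.mkₐ D.poly).restrictScalars k)
    AdjoinRoot.mk_surjective D.mk_mapCoeffs_eq_zero f

theorem modelDer_toModel (a : RestrictedEnveloping k p h) :
    D.modelDer (D.toModel a) = D.toModel (D.ρz a) := by
  have hC : HopfExt.mapCoeffs D.ρz (C a) = C (D.ρz a) := by
    ext i
    rw [HopfExt.coeff_mapCoeffs, coeff_C, coeff_C, apply_ite D.ρz, map_zero]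
  exact (D.modelDer_mk (C a)).trans (congrArg _ hC)

theorem modelDer_t : D.modelDer D.t = 0 := by
  have hX : HopfExt.mapCoeffs D.ρz X = 0 := by
    ext i
    rw [HopfExt.coeff_mapCoeffs, coeff_X, apply_ite D.ρz, map_zero, Derivation.map_one_eq_zero,
      ite_self, coeff_zero]
  exact (D.modelDer_mk X).trans ((congrArg _ hX).trans (map_zero _))

theorem aeval_modelDer : aeval (D.modelDer : Module.End k D.Model) (pPolynomial k p lam) = 0 := by
  ext r
  obtain ⟨f, rfl⟩ := AdjoinRoot.mk_surjective r
  have hcoeffs : aeval (HopfExt.mapCoeffs D.ρz : Module.End k (RestrictedEnveloping k p h)[X])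
      (pPolynomial k p lam) f = 0 := by
    ext i
    have hi := HopfExt.map_aeval_apply (δ := (HopfExt.mapCoeffs D.ρz : Module.End k _))
      (ε := (D.ρz : Module.End k _))
      (ψ := (lcoeff (RestrictedEnveloping k p h) i).restrictScalars k)
      (HopfExt.coeff_mapCoeffs D.ρz · i) (pPolynomial k p lam) f
    rwa [D.aeval_ρz] at hi
  have hmk := HopfExt.map_aeval_apply
    (ψ := ((AdjoinRoot.mkₐ D.poly).restrictScalars k).toLinearMap)
    (fun f => (D.modelDer_mk f).symm) (pPolynomial k p lam) f
  rw [hcoeffs, map_zero] at hmk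
  exact hmk.symm

/-- The representation of `u(D)` on the model: `A` acts by multiplication, and `x` acts as
`t + ∂`. -/
def rep : D.u →ₐ[k] Module.End k D.Model :=
  D.lift ((Algebra.lmul k D.Model).comp D.toModel) (Algebra.lmul k D.Model D.t + D.modelDer)
    (fun a => LinearMap.ext fun r => by
      simp only [LieRing.of_associative_ring_bracket, AlgHom.comp_apply, LinearMap.sub_apply,
        Module.End.mul_apply, LinearMap.add_apply, Algebra.coe_lmul_eq_mul,
        LinearMap.mul_apply', Derivation.coeFn_coe, Derivation.leibniz, modelDer_toModel,
        smul_eq_mul]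
      ring)
    (by
      have hcomm : Commute (Algebra.lmul k D.Model D.t) (D.modelDer : Module.End k D.Model) :=
        LinearMap.ext fun r => by simp [modelDer_t]
      rw [MonogenicHopf.aeval_add_of_commute k p lam hcomm, aeval_modelDer, add_zero,
        aeval_algHom_apply, AlgHom.comp_apply, ← map_add, aeval_t, map_zero])

theorem rep_incl (a : RestrictedEnveloping k p h) (r : D.Model) :
    D.rep (D.incl a) r = D.toModel a * r := by
  rw [rep, lift_incl]; rfl

theorem rep_x_pow_one (j : ℕ) : D.rep (D.x ^ j) 1 = D.t ^ j := by
  induction j with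
  | zero => simp
  | succ j ih =>
    have hder : D.modelDer (D.t ^ j) = 0 := by simp [Derivation.leibniz_pow, modelDer_t]
    rw [pow_succ', map_mul, Module.End.mul_apply, ih, rep, lift_x, LinearMap.add_apply,
      Derivation.coeFn_coe, hder, add_zero, pow_succ']
    rfl

end Representation

section Coefficients

/-- The linear map `(a_j) ↦ ∑ a_j x^j`. -/
def ofCoeffs : (Fin (p ^ n) → RestrictedEnveloping k p h) →ₗ[k] D.u :=
  ∑ j : Fin (p ^ n), LinearMap.mulRight k (D.x ^ (j : ℕ)) ∘ₗ D.incl.toLinearMap ∘ₗ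
    LinearMap.proj j

theorem ofCoeffs_apply (c : Fin (p ^ n) → RestrictedEnveloping k p h) :
    D.ofCoeffs c = ∑ j, D.incl (c j) * D.x ^ (j : ℕ) := by
  simp [ofCoeffs]

theorem ofCoeffs_single (j : Fin (p ^ n)) (a : RestrictedEnveloping k p h) :
    D.ofCoeffs (Pi.single j a) = D.incl a * D.x ^ (j : ℕ) := by
  rw [ofCoeffs_apply, Finset.sum_eq_single j] <;> simp +contextual

instance : Nontrivial (RestrictedEnveloping k p h) :=
  (Bialgebra.counitAlgHom k (RestrictedEnveloping k p h)).toRingHom.domain_nontrivial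

theorem ofCoeffs_injective : Function.Injective D.ofCoeffs := by
  let β := adjoinRootBasis (monic_pPolynomial_map_add_C k p lam D.Θ)
    (natDegree_pPolynomial_map_add_C k p lam D.Θ)
  have hβ (c) : D.rep (D.ofCoeffs c) 1 = β.equivFun.symm c := by
    rw [ofCoeffs_apply, map_sum, LinearMap.sum_apply, Module.Basis.equivFun_symm_apply]
    refine Finset.sum_congr rfl fun j _ => ?_
    rw [map_mul, Module.End.mul_apply, D.rep_x_pow_one, rep_incl, adjoinRootBasis_apply,
      Algebra.smul_def]
    rfl
  intro c c' hc
  refine β.equivFun.symm.injective ?_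
  rw [← hβ, ← hβ, hc]

theorem incl_mul_x_pow_mem (a : RestrictedEnveloping k p h) {j : ℕ} (hj : j < p ^ n) :
    D.incl a * D.x ^ j ∈ LinearMap.range D.ofCoeffs :=
  ⟨Pi.single ⟨j, hj⟩ a, D.ofCoeffs_single _ _⟩

theorem range_ofCoeffs_le {N : Submodule k D.u}
    (hN : ∀ a, ∀ j < p ^ n, D.incl a * D.x ^ j ∈ N) : LinearMap.range D.ofCoeffs ≤ N := by
  rintro _ ⟨c, rfl⟩
  rw [ofCoeffs_apply]
  exact sum_mem fun j _ => hN _ _ j.2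

theorem incl_mul_x_pow_top_mem (a : RestrictedEnveloping k p h) :
    D.incl a * D.x ^ p ^ n ∈ LinearMap.range D.ofCoeffs := by
  have htop := D.aeval_x
  rw [MonogenicHopf.aeval_pPolynomial, add_assoc, add_eq_zero_iff_eq_neg] at htop
  rw [htop, mul_neg, mul_add, Finset.mul_sum, ← map_mul, ← mul_one (D.incl (a * _)),
    ← pow_zero D.x]
  refine neg_mem (add_mem (sum_mem fun i _ => ?_)
    (D.incl_mul_x_pow_mem _ (Nat.pow_pos hp.out.pos)))
  rw [mul_smul_comm]
  exact Submodule.smul_mem _ _ (D.incl_mul_x_pow_mem _ (Nat.pow_lt_pow_right hp.out.one_lt i.2))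

theorem range_ofCoeffs_le_comap_mulLeft (u : D.u) :
    LinearMap.range D.ofCoeffs ≤ (LinearMap.range D.ofCoeffs).comap (LinearMap.mulLeft k u) := by
  induction u using induction with
  | add u v hu hv =>
    intro w hw
    rw [Submodule.mem_comap, LinearMap.mulLeft_apply, add_mul]
    exact add_mem (hu hw) (hv hw)
  | mul u v hu hv => exact fun w hw => by simpa [mul_assoc] using hu (hv hw)
  | incl a =>
    refine D.range_ofCoeffs_le fun b j hj => ?_
    rw [Submodule.mem_comap, LinearMap.mulLeft_apply, ← mul_assoc, ← map_mul]
    exact D.incl_mul_x_pow_mem _ hj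
  | x =>
    refine D.range_ofCoeffs_le fun b j hj => ?_
    rw [Submodule.mem_comap, LinearMap.mulLeft_apply, ← mul_assoc, x_mul_incl, add_mul, mul_assoc,
      ← pow_succ']
    refine add_mem ?_ (D.incl_mul_x_pow_mem _ hj)
    obtain hlt | heq := (Nat.succ_le_of_lt hj).lt_or_eq
    · exact D.incl_mul_x_pow_mem _ hlt
    · rw [show j + 1 = p ^ n from heq]
      exact D.incl_mul_x_pow_top_mem b

theorem ofCoeffs_surjective : Function.Surjective D.ofCoeffs := fun u => by
  have hone : (1 : D.u) ∈ LinearMap.range D.ofCoeffs := by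
    simpa using D.incl_mul_x_pow_mem 1 (Nat.pow_pos hp.out.pos)
  simpa using D.range_ofCoeffs_le_comap_mulLeft u hone

/-- Every element of `u(D)` is `∑ a_j x^j` with unique `a_j ∈ A`, `j < p^n`. -/
def coeffEquiv : (Fin (p ^ n) → RestrictedEnveloping k p h) ≃ₗ[k] D.u :=
  LinearEquiv.ofBijective D.ofCoeffs ⟨D.ofCoeffs_injective, D.ofCoeffs_surjective⟩

theorem coeffEquiv_symm_apply (a : RestrictedEnveloping k p h) {j : ℕ} (hj : j < p ^ n) :
    D.coeffEquiv.symm (D.incl a * D.x ^ j) = Pi.single ⟨j, hj⟩ a := by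
  rw [LinearEquiv.symm_apply_eq]
  exact (D.ofCoeffs_single ⟨j, hj⟩ a).symm

/-- The coefficient `a_0` of `∑ a_j x^j`. -/
def constCoeff : D.u →ₗ[k] RestrictedEnveloping k p h :=
  LinearMap.proj ⟨0, Nat.pow_pos hp.out.pos⟩ ∘ₗ D.coeffEquiv.symm.toLinearMap

theorem constCoeff_incl_mul_x_pow (a : RestrictedEnveloping k p h) {j : ℕ} (hj : j < p ^ n) :
    D.constCoeff (D.incl a * D.x ^ j) = if j = 0 then a else 0 := by
  rw [constCoeff, LinearMap.comp_apply, LinearEquiv.coe_coe, D.coeffEquiv_symm_apply a hj,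
    LinearMap.proj_apply, Pi.single_apply]
  simp [Fin.ext_iff, eq_comm]

@[simp]
theorem constCoeff_incl (a : RestrictedEnveloping k p h) : D.constCoeff (D.incl a) = a := by
  simpa using D.constCoeff_incl_mul_x_pow a (Nat.pow_pos (n := n) hp.out.pos)

theorem incl_injective : Function.Injective D.incl :=
  Function.LeftInverse.injective D.constCoeff_incl

theorem finrank_u [FiniteDimensional k h] : Module.finrank k D.u =
    p ^ (Module.finrank k (HopfExt.primitives k (RestrictedEnveloping k p h)) + n) := by
  rw [← D.coeffEquiv.finrank_eq, Module.finrank_pi_fintype]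
  simp [RestrictedEnveloping.finrank_eq, RestrictedEnveloping.finrank_primitives, pow_add, mul_comm]

end Coefficients

end CompatibleDatum

/-! ### The Hopf algebra structure of `u(D)` -/

theorem Cobar.map_eq_zero_of_augSq {k A M N : Type*} [Field k] [Ring A] [Bialgebra k A]
    [AddCommGroup M] [Module k M] [AddCommGroup N] [Module k N] {f : A →ₗ[k] M} {g : A →ₗ[k] N}
    (hfg : (∀ a ∈ augIdeal k A, f a = 0) ∨ ∀ a ∈ augIdeal k A, g a = 0) {c : A ⊗[k] A}
    (hc : c ∈ augSq k A) : TensorProduct.map f g c = 0 := by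
  obtain ⟨t, rfl⟩ := hc
  induction t with
  | zero => simp
  | add x y hx hy => rw [map_add, map_add, hx, hy, add_zero]
  | tmul a b =>
    rw [TensorProduct.map_tmul, TensorProduct.map_tmul]
    obtain hf | hg := hfg
    · rw [Submodule.subtype_apply, hf _ a.2, TensorProduct.zero_tmul]
    · rw [Submodule.subtype_apply, Submodule.subtype_apply, hg _ b.2, TensorProduct.tmul_zero]

namespace CompatibleDatum

open Polynomial TensorProduct

variable {k : Type*} {p : ℕ} {h : Type*} [Field k] [hp : Fact p.Prime] [CharP k p]
  [LieRing h] [LieAlgebra k h] [IsLieAbelian h] [RestrictedLieAlgebra k p h]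
  {n : ℕ} {lam : Fin n → k} (D : CompatibleDatum k p h lam)

section Comultiplication

/-- The map `A ⊗ A → u(D) ⊗ u(D)` induced by the canonical map `A → u(D)`. -/
def inclSq : RestrictedEnveloping k p h ⊗[k] RestrictedEnveloping k p h →ₐ[k] D.u ⊗[k] D.u :=
  Algebra.TensorProduct.map D.incl D.incl

@[simp]
theorem inclSq_tmul (a b : RestrictedEnveloping k p h) :
    D.inclSq (a ⊗ₜ b) = D.incl a ⊗ₜ D.incl b := rfl

theorem map_inclSq {M N : Type*} [AddCommGroup M] [Module k M] [AddCommGroup N] [Module k N]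
    (f : D.u →ₗ[k] M) (g : D.u →ₗ[k] N)
    (c : RestrictedEnveloping k p h ⊗[k] RestrictedEnveloping k p h) :
    TensorProduct.map f g (D.inclSq c) =
      TensorProduct.map (f ∘ₗ D.incl.toLinearMap) (g ∘ₗ D.incl.toLinearMap) c := by
  rw [TensorProduct.map_comp]
  rfl

/-- The element `x ⊗ 1 + 1 ⊗ x` of `u(D) ⊗ u(D)`; the comultiplication of `x` adds `χ` to it. -/
def xSq : D.u ⊗[k] D.u := D.x ⊗ₜ 1 + 1 ⊗ₜ D.x

theorem lie_xSq_inclSq (c : RestrictedEnveloping k p h ⊗[k] RestrictedEnveloping k p h) :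
    ⁅D.xSq, D.inclSq c⁆ = D.inclSq (Cobar.act D.ρz.toLinearMap c) := by
  induction c with
  | zero => simp
  | add c d hc hd => rw [map_add, lie_add, hc, hd, map_add, map_add]
  | tmul a b =>
    have hρ (a : RestrictedEnveloping k p h) : D.ρz.toLinearMap a = D.ρz a := rfl
    simp only [LieRing.of_associative_ring_bracket, xSq, inclSq_tmul, add_mul, mul_add,
      Algebra.TensorProduct.tmul_mul_tmul, one_mul, mul_one, x_mul_incl, add_tmul, tmul_add,
      Cobar.act, LinearMap.add_apply, LinearMap.rTensor_tmul, LinearMap.lTensor_tmul, map_add, hρ]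
    abel

theorem aeval_xSq : aeval D.xSq (pPolynomial k p lam) =
    -(D.inclSq (D.Θ ⊗ₜ 1) + D.inclSq (1 ⊗ₜ D.Θ)) := by
  have hcomm : Commute (D.x ⊗ₜ[k] (1 : D.u)) ((1 : D.u) ⊗ₜ[k] D.x) := by simp [commute_iff_eq]
  have hx : aeval D.x (pPolynomial k p lam) = -D.incl D.Θ := eq_neg_of_add_eq_zero_left D.aeval_x
  have hleft : aeval (D.x ⊗ₜ[k] (1 : D.u)) (pPolynomial k p lam) = -D.inclSq (D.Θ ⊗ₜ 1) := by
    rw [← Algebra.TensorProduct.includeLeft_apply (S := k), aeval_algHom_apply, hx]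
    simp [neg_tmul]
  have hright : aeval ((1 : D.u) ⊗ₜ[k] D.x) (pPolynomial k p lam) = -D.inclSq (1 ⊗ₜ D.Θ) := by
    rw [← Algebra.TensorProduct.includeRight_apply, aeval_algHom_apply, hx]
    simp [tmul_neg]
  rw [xSq, MonogenicHopf.aeval_add_of_commute k p lam hcomm, hleft, hright, neg_add]

/-- The comultiplication of `u(D)`, extending that of `A` with `Δ(x) = x ⊗ 1 + 1 ⊗ x + χ`. -/
def comul : D.u →ₐ[k] D.u ⊗[k] D.u :=
  D.lift (D.inclSq.comp (Bialgebra.comulAlgHom k _)) (D.xSq + D.inclSq D.χ)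
    (fun a => by
      have hder := D.ρ.comul_derivation (MonogenicHopf.zPrim k p lam) a
      have hχ : ⁅D.inclSq D.χ, D.inclSq (Coalgebra.comul (R := k) a)⁆ = 0 := by
        rw [LieRing.of_associative_ring_bracket, ← map_mul, mul_comm, map_mul, sub_self]
      change ⁅_, D.inclSq (Coalgebra.comul (R := k) a)⁆ = _
      rw [add_lie, hχ, add_zero, lie_xSq_inclSq]
      exact congrArg D.inclSq hder.symm)
    (by
      have hΦ : Cobar.opPhi p lam D.ρz.toLinearMap D.χ = Cobar.d1 k _ D.Θ := D.Φ_χ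
      rw [Cobar.aeval_add_map lam D.lie_xSq_inclSq, hΦ, Cobar.d1_apply, aeval_xSq,
        AlgHom.comp_apply, Bialgebra.comulAlgHom_apply]
      simp only [map_sub, map_add]
      abel)

theorem comul_incl (a : RestrictedEnveloping k p h) :
    D.comul (D.incl a) = D.inclSq (Coalgebra.comul (R := k) a) := by
  rw [comul, lift_incl]; rfl

theorem comul_x : D.comul D.x = D.x ⊗ₜ 1 + 1 ⊗ₜ D.x + D.inclSq D.χ := by
  rw [comul, lift_x, xSq]

theorem counit_ρz (a : RestrictedEnveloping k p h) : Coalgebra.counit (R := k) (D.ρz a) = 0 :=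
  D.ρ.counit_derivation _ a

/-- The counit of `u(D)`, extending that of `A` with `ε(x) = 0`. -/
def counit : D.u →ₐ[k] k :=
  D.lift (Bialgebra.counitAlgHom k _) 0
    (fun a => by simp [counit_ρz])
    (by
      have hΘ : Coalgebra.counit (R := k) D.Θ = 0 := D.Θ_mem
      simp [MonogenicHopf.aeval_pPolynomial, hp.out.ne_zero, hΘ])

theorem counit_incl (a : RestrictedEnveloping k p h) :
    D.counit (D.incl a) = Coalgebra.counit (R := k) a := by
  rw [counit, lift_incl]; rfl

theorem counit_x : D.counit D.x = 0 := by
  rw [counit, lift_x]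

end Comultiplication

section Coassociativity

/-- The map `A ⊗ (A ⊗ A) → u(D) ⊗ (u(D) ⊗ u(D))` induced by the canonical map `A → u(D)`. -/
def inclCube : RestrictedEnveloping k p h ⊗[k]
    (RestrictedEnveloping k p h ⊗[k] RestrictedEnveloping k p h) →ₐ[k]
      D.u ⊗[k] (D.u ⊗[k] D.u) :=
  Algebra.TensorProduct.map D.incl D.inclSq

theorem assoc_inclSq_tmul (c : RestrictedEnveloping k p h ⊗[k] RestrictedEnveloping k p h)
    (b : RestrictedEnveloping k p h) : Algebra.TensorProduct.assoc k k k D.u D.u D.u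
      (D.inclSq c ⊗ₜ D.incl b) = D.inclCube (Algebra.TensorProduct.assoc k k k _ _ _ (c ⊗ₜ b)) := by
  induction c with
  | zero => simp
  | add c d hc hd => simp only [map_add, add_tmul, hc, hd]
  | tmul a a' => simp [inclCube]

theorem assoc_map_comul_inclSq (c : RestrictedEnveloping k p h ⊗[k] RestrictedEnveloping k p h) :
    Algebra.TensorProduct.assoc k k k D.u D.u D.u
      (Algebra.TensorProduct.map D.comul (.id k D.u) (D.inclSq c)) =
    D.inclCube (Algebra.TensorProduct.assoc k k k _ _ _
      (Algebra.TensorProduct.map (Bialgebra.comulAlgHom k _) (.id k _) c)) := by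
  induction c with
  | zero => simp
  | add c d hc hd => simp only [map_add, hc, hd]
  | tmul a b =>
    rw [inclSq_tmul, Algebra.TensorProduct.map_tmul, comul_incl, AlgHom.id_apply,
      assoc_inclSq_tmul]
    rfl

theorem map_id_comul_inclSq (c : RestrictedEnveloping k p h ⊗[k] RestrictedEnveloping k p h) :
    Algebra.TensorProduct.map (.id k D.u) D.comul (D.inclSq c) =
    D.inclCube (Algebra.TensorProduct.map (.id k _) (Bialgebra.comulAlgHom k _) c) := by
  induction c with
  | zero => simp
  | add c d hc hd => simp only [map_add, hc, hd]
  | tmul a b =>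
    rw [inclSq_tmul, Algebra.TensorProduct.map_tmul, comul_incl, AlgHom.id_apply]
    rfl

theorem cocycle_identity :
    1 ⊗ₜ D.inclSq D.χ + Algebra.TensorProduct.map (.id k D.u) D.comul (D.inclSq D.χ) =
      Algebra.TensorProduct.assoc k k k D.u D.u D.u
          (Algebra.TensorProduct.map D.comul (.id k D.u) (D.inclSq D.χ)) +
        Algebra.TensorProduct.assoc k k k D.u D.u D.u (D.inclSq D.χ ⊗ₜ 1) := by
  have hd2 : Cobar.d2 k _ D.χ = 0 := D.χ_mem.2
  have hA := congrArg D.inclCube (sub_eq_zero.mp ((Cobar.d2_eq D.χ).symm.trans hd2))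
  have hone : D.inclCube ((Algebra.TensorProduct.includeRight : _ →ₐ[k] _) D.χ) =
      1 ⊗ₜ D.inclSq D.χ := by
    rw [inclCube, Algebra.TensorProduct.includeRight_apply, Algebra.TensorProduct.map_tmul, map_one]
  have hassoc : D.inclCube (Algebra.TensorProduct.assoc k k k _ _ _
      ((Algebra.TensorProduct.includeLeft : _ →ₐ[k] _) D.χ)) =
      Algebra.TensorProduct.assoc k k k D.u D.u D.u (D.inclSq D.χ ⊗ₜ 1) := by
    rw [Algebra.TensorProduct.includeLeft_apply, ← assoc_inclSq_tmul, map_one]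
  rw [map_add, map_add, ← assoc_map_comul_inclSq, ← map_id_comul_inclSq, hone, hassoc] at hA
  exact hA.trans (by abel)

theorem comul_coassoc : (Algebra.TensorProduct.assoc k k k D.u D.u D.u).toAlgHom.comp
    ((Algebra.TensorProduct.map D.comul (.id k D.u)).comp D.comul) =
    (Algebra.TensorProduct.map (.id k D.u) D.comul).comp D.comul := by
  refine algHom_ext (fun a => ?_) ?_
  · change Algebra.TensorProduct.assoc k k k D.u D.u D.u
      (Algebra.TensorProduct.map D.comul (.id k D.u) (D.comul (D.incl a))) =
      Algebra.TensorProduct.map (.id k D.u) D.comul (D.comul (D.incl a))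
    rw [comul_incl, assoc_map_comul_inclSq, map_id_comul_inclSq]
    exact congrArg D.inclCube (Coalgebra.coassoc_apply a)
  · change Algebra.TensorProduct.assoc k k k D.u D.u D.u
      (Algebra.TensorProduct.map D.comul (.id k D.u) (D.comul D.x)) =
      Algebra.TensorProduct.map (.id k D.u) D.comul (D.comul D.x)
    have hχ := D.cocycle_identity
    simp only [comul_x, map_add, Algebra.TensorProduct.map_tmul, AlgHom.id_apply, map_one,
      add_tmul, tmul_add, Algebra.TensorProduct.assoc_tmul, Algebra.TensorProduct.one_def]
    linear_combination (norm := abel) -hχ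

theorem counit_comp_incl : D.counit.toLinearMap ∘ₗ D.incl.toLinearMap = Coalgebra.counit :=
  LinearMap.ext D.counit_incl

theorem map_counit_id_inclSq (c : RestrictedEnveloping k p h ⊗[k] RestrictedEnveloping k p h) :
    Algebra.TensorProduct.map D.counit (.id k D.u) (D.inclSq c) =
      TensorProduct.map Coalgebra.counit D.incl.toLinearMap c := by
  rw [← D.counit_comp_incl]
  exact D.map_inclSq D.counit.toLinearMap LinearMap.id c

theorem map_id_counit_inclSq (c : RestrictedEnveloping k p h ⊗[k] RestrictedEnveloping k p h) :
    Algebra.TensorProduct.map (.id k D.u) D.counit (D.inclSq c) =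
      TensorProduct.map D.incl.toLinearMap Coalgebra.counit c := by
  rw [← D.counit_comp_incl]
  exact D.map_inclSq LinearMap.id D.counit.toLinearMap c

theorem counit_comul_left : (Algebra.TensorProduct.map D.counit (.id k D.u)).comp D.comul =
    (Algebra.TensorProduct.lid k D.u).symm := by
  refine algHom_ext (fun a => ?_) ?_
  · rw [AlgHom.comp_apply, comul_incl, map_counit_id_inclSq, ← LinearMap.lTensor_comp_rTensor,
      LinearMap.comp_apply, Coalgebra.rTensor_counit_comul]
    simp
  · rw [AlgHom.comp_apply, comul_x, map_add, map_counit_id_inclSq,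
      Cobar.map_eq_zero_of_augSq (.inl fun a (ha : Coalgebra.counit (R := k) a = 0) => ha)
        D.χ_mem.1]
    simp [counit_x]

theorem counit_comul_right : (Algebra.TensorProduct.map (.id k D.u) D.counit).comp D.comul =
    (Algebra.TensorProduct.rid k k D.u).symm := by
  refine algHom_ext (fun a => ?_) ?_
  · rw [AlgHom.comp_apply, comul_incl, map_id_counit_inclSq, ← LinearMap.rTensor_comp_lTensor,
      LinearMap.comp_apply, Coalgebra.lTensor_counit_comul]
    simp
  · rw [AlgHom.comp_apply, comul_x, map_add, map_id_counit_inclSq,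
      Cobar.map_eq_zero_of_augSq (.inr fun a (ha : Coalgebra.counit (R := k) a = 0) => ha)
        D.χ_mem.1]
    simp [counit_x]

end Coassociativity

end CompatibleDatum

namespace Cobar

open TensorProduct

variable {k A : Type*} [Field k] [CommRing A] [HopfAlgebra k A]

section Antipode

variable (k A) in
/-- The algebra map `a ⊗ b ↦ S(a) b` of a commutative Hopf algebra. -/
def antipodeMul : A ⊗[k] A →ₐ[k] A :=
  Algebra.TensorProduct.productMap (HopfAlgebra.antipodeAlgHom k A) (.id k A)

variable (k A) in
/-- The algebra map `a ⊗ b ↦ a S(b)` of a commutative Hopf algebra. -/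
def mulAntipode : A ⊗[k] A →ₐ[k] A :=
  Algebra.TensorProduct.productMap (.id k A) (HopfAlgebra.antipodeAlgHom k A)

@[simp]
theorem antipodeMul_tmul (a b : A) : antipodeMul k A (a ⊗ₜ b) = HopfAlgebra.antipode k a * b := by
  simp [antipodeMul]

@[simp]
theorem mulAntipode_tmul (a b : A) : mulAntipode k A (a ⊗ₜ b) = a * HopfAlgebra.antipode k b := by
  simp [mulAntipode]

theorem antipodeMul_comul (a : A) :
    antipodeMul k A (Coalgebra.comul a) = algebraMap k A (Coalgebra.counit a) := by
  rw [← HopfAlgebra.mul_antipode_rTensor_comul_apply]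
  induction Coalgebra.comul (R := k) a with
  | zero => simp
  | add c d hc hd => simp only [map_add, hc, hd]
  | tmul a b => simp

theorem mulAntipode_comul (a : A) :
    mulAntipode k A (Coalgebra.comul a) = algebraMap k A (Coalgebra.counit a) := by
  rw [← HopfAlgebra.mul_antipode_lTensor_comul_apply]
  induction Coalgebra.comul (R := k) a with
  | zero => simp
  | add c d hc hd => simp only [map_add, hc, hd]
  | tmul a b => simp

theorem antipodeMul_d1 (a : A) : antipodeMul k A (d1 k A a) =
    a + HopfAlgebra.antipode k a - algebraMap k A (Coalgebra.counit a) := by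
  rw [d1_apply, map_sub, map_add, antipodeMul_comul]
  simp [add_comm]

theorem mulAntipode_d1 (a : A) : mulAntipode k A (d1 k A a) =
    a + HopfAlgebra.antipode k a - algebraMap k A (Coalgebra.counit a) := by
  rw [d1_apply, map_sub, map_add, mulAntipode_comul]
  simp

variable (k A) in
/-- The algebra map `a ⊗ b ⊗ c ↦ a S(b) c` of a commutative Hopf algebra. -/
def mulAntipodeMul : A ⊗[k] (A ⊗[k] A) →ₐ[k] A :=
  Algebra.TensorProduct.productMap (.id k A) (antipodeMul k A)

theorem mulAntipodeMul_tmul (a : A) (c : A ⊗[k] A) :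
    mulAntipodeMul k A (a ⊗ₜ c) = a * antipodeMul k A c := by
  simp [mulAntipodeMul]

theorem mulAntipodeMul_assoc (c : A ⊗[k] A) (b : A) :
    mulAntipodeMul k A (TensorProduct.assoc k _ _ _ (c ⊗ₜ b)) = mulAntipode k A c * b := by
  induction c with
  | zero => simp
  | add c d hc hd => simp only [add_tmul, map_add, hc, hd, add_mul]
  | tmul a b => simp [mulAntipodeMul_tmul, mul_assoc]

theorem mulAntipodeMul_d2 (c : A ⊗[k] A) :
    mulAntipodeMul k A (d2 k A c) = antipodeMul k A c - mulAntipode k A c -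
      TensorProduct.lid k A (TensorProduct.map Coalgebra.counit .id c) +
      TensorProduct.rid k A (TensorProduct.map .id Coalgebra.counit c) := by
  induction c with
  | zero => simp
  | add c d hc hd => simp only [map_add, hc, hd]; abel
  | tmul a b =>
    rw [d2_tmul, map_sub, mulAntipodeMul_assoc, mulAntipodeMul_tmul, mulAntipode_d1,
      antipodeMul_d1]
    simp [Algebra.smul_def]
    ring

theorem antipodeMul_eq_mulAntipode {c : A ⊗[k] A} (hc : c ∈ cocycles k A) :
    antipodeMul k A c = mulAntipode k A c := by
  have hd2 : d2 k A c = 0 := hc.2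
  have hcontract := mulAntipodeMul_d2 c
  rw [hd2, map_zero,
    map_eq_zero_of_augSq (.inl fun a (ha : Coalgebra.counit (R := k) a = 0) => ha) hc.1,
    map_eq_zero_of_augSq (.inr fun a (ha : Coalgebra.counit (R := k) a = 0) => ha) hc.1,
    map_zero, map_zero, sub_zero, add_zero] at hcontract
  exact sub_eq_zero.mp hcontract.symm

theorem map_antipodeMul {d : Derivation k A A}
    (hd : ∀ a, d (HopfAlgebra.antipode k a) = HopfAlgebra.antipode k (d a)) (c : A ⊗[k] A) :
    d (antipodeMul k A c) = antipodeMul k A (act d.toLinearMap c) := by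
  have hcoe (a : A) : d.toLinearMap a = d a := rfl
  induction c with
  | zero => simp
  | add c e hc he => simp only [map_add, hc, he]
  | tmul a b => simp [act, hcoe, hd, mul_comm, add_comm]

end Antipode

end Cobar

section AntipodeMultiplicativity

open TensorProduct

variable {k U : Type*} [Field k] [Ring U] [Algebra k U] {S : U →ₗ[k] U}

theorem HopfExt.mul_rTensor_mul (hS : ∀ u v, S (u * v) = S v * S u) {c d : U ⊗[k] U} {r s : k}
    (hc : LinearMap.mul' k U (S.rTensor U c) = algebraMap k U r)
    (hd : LinearMap.mul' k U (S.rTensor U d) = algebraMap k U s) :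
    LinearMap.mul' k U (S.rTensor U (c * d)) = algebraMap k U (r * s) := by
  have hmul (c : U ⊗[k] U) (a b : U) : LinearMap.mul' k U (S.rTensor U (c * (a ⊗ₜ b))) =
      S a * LinearMap.mul' k U (S.rTensor U c) * b := by
    induction c with
    | zero => simp
    | add c d hc hd => simp only [map_add, add_mul, mul_add, hc, hd]
    | tmul c d => simp [hS, mul_assoc]
  have hsmul : LinearMap.mul' k U (S.rTensor U (c * d)) =
      r • LinearMap.mul' k U (S.rTensor U d) := by
    clear hd
    induction d with
    | zero => simp
    | add d e hd he => simp only [map_add, mul_add, smul_add, hd, he]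
    | tmul a b => rw [hmul, hc]; simp [Algebra.algebraMap_eq_smul_one]
  rw [hsmul, hd, map_mul, Algebra.smul_def]

theorem HopfExt.mul_lTensor_mul (hS : ∀ u v, S (u * v) = S v * S u) {c d : U ⊗[k] U} {r s : k}
    (hc : LinearMap.mul' k U (S.lTensor U c) = algebraMap k U r)
    (hd : LinearMap.mul' k U (S.lTensor U d) = algebraMap k U s) :
    LinearMap.mul' k U (S.lTensor U (c * d)) = algebraMap k U (r * s) := by
  have hmul (a b : U) (d : U ⊗[k] U) : LinearMap.mul' k U (S.lTensor U ((a ⊗ₜ b) * d)) =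
      a * LinearMap.mul' k U (S.lTensor U d) * S b := by
    induction d with
    | zero => simp
    | add c d hc hd => simp only [map_add, add_mul, mul_add, hc, hd]
    | tmul c d => simp [hS, mul_assoc]
  have hsmul : LinearMap.mul' k U (S.lTensor U (c * d)) =
      s • LinearMap.mul' k U (S.lTensor U c) := by
    clear hc
    induction c with
    | zero => simp
    | add c e hc he => simp only [map_add, add_mul, smul_add, hc, he]
    | tmul a b => rw [hmul, hd]; simp [Algebra.algebraMap_eq_smul_one]
  rw [hsmul, hc, mul_comm, map_mul, Algebra.smul_def]

end AntipodeMultiplicativity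

theorem MonogenicHopf.aeval_neg {k : Type*} {p : ℕ} [Field k] [hp : Fact p.Prime] [CharP k p]
    {n : ℕ} (lam : Fin n → k) {R : Type*} [Ring R] [Algebra k R] (y : R) :
    Polynomial.aeval (-y) (pPolynomial k p lam) = -Polynomial.aeval y (pPolynomial k p lam) := by
  have hzero : Polynomial.aeval (0 : R) (pPolynomial k p lam) = 0 := by
    simp [aeval_pPolynomial, hp.out.ne_zero]
  have hadd := aeval_add_of_commute k p lam (Commute.refl y).neg_right
  rw [add_neg_cancel, hzero] at hadd
  exact (neg_eq_of_add_eq_zero_right hadd.symm).symm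

namespace CompatibleDatum

open Polynomial TensorProduct MulOpposite

variable {k : Type*} {p : ℕ} {h : Type*} [Field k] [hp : Fact p.Prime] [CharP k p]
  [LieRing h] [LieAlgebra k h] [IsLieAbelian h] [RestrictedLieAlgebra k p h]
  {n : ℕ} {lam : Fin n → k} (D : CompatibleDatum k p h lam)

section Antipode

theorem ρz_antipode (a : RestrictedEnveloping k p h) :
    D.ρz (HopfAlgebra.antipode k a) = HopfAlgebra.antipode k (D.ρz a) := by
  induction a using RestrictedEnveloping.induction with
  | hal r => simp [Algebra.algebraMap_eq_smul_one]
  | hι v =>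
    have hι (v : h) : HopfAlgebra.antipode k (RestrictedEnveloping.ι k p h v) =
        -RestrictedEnveloping.ι k p h v := RestrictedEnveloping.antipode_ι k p h v
    rw [hι, map_neg, ρz, AlgebraicRep.derivation_ι, hι]
  | hadd a b ha hb => simp only [map_add, ha, hb]
  | hmul a b ha hb => simp [HopfAlgebra.antipode_mul_distrib, ha, hb]

theorem lie_x_incl_antipodeMul (c : RestrictedEnveloping k p h ⊗[k] RestrictedEnveloping k p h) :
    ⁅D.x, (D.incl.comp (Cobar.antipodeMul k _)) c⁆ =
      (D.incl.comp (Cobar.antipodeMul k _)) (Cobar.act D.ρz.toLinearMap c) := by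
  rw [AlgHom.comp_apply, AlgHom.comp_apply, lie_x_incl, Cobar.map_antipodeMul D.ρz_antipode]

theorem aeval_x_add_antipodeMul :
    aeval (D.x + D.incl (Cobar.antipodeMul k _ D.χ)) (pPolynomial k p lam) =
      D.incl (HopfAlgebra.antipode k D.Θ) := by
  have hΦ : Cobar.opPhi p lam D.ρz.toLinearMap D.χ = Cobar.d1 k _ D.Θ := D.Φ_χ
  have hΘ : Coalgebra.counit (R := k) D.Θ = 0 := D.Θ_mem
  have hadd := Cobar.aeval_add_map lam D.lie_x_incl_antipodeMul D.χ
  rw [hΦ, eq_neg_of_add_eq_zero_left D.aeval_x, AlgHom.comp_apply, AlgHom.comp_apply,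
    Cobar.antipodeMul_d1, hΘ] at hadd
  simpa using hadd

/-- The antipode of `u(D)`, as an algebra map to the opposite algebra: it extends the antipode of
`A`, and sends `x` to `-x - ∑ S(χ₁) χ₂`. -/
def antipodeOp : D.u →ₐ[k] D.uᵐᵒᵖ :=
  D.lift (AlgHom.toOpposite (D.incl.comp (HopfAlgebra.antipodeAlgHom k _)) fun a b => by
      simp only [AlgHom.comp_apply, commute_iff_eq, ← map_mul, mul_comm])
    (op (-(D.x + D.incl (Cobar.antipodeMul k _ D.χ))))
    (fun a => by
      have hχ : ⁅D.incl (Cobar.antipodeMul k _ D.χ), D.incl (HopfAlgebra.antipode k a)⁆ = 0 := by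
        rw [LieRing.of_associative_ring_bracket, ← map_mul, mul_comm, map_mul, sub_self]
      have hlie : ⁅D.x + D.incl (Cobar.antipodeMul k _ D.χ), D.incl (HopfAlgebra.antipode k a)⁆ =
          D.incl (HopfAlgebra.antipode k (D.ρz a)) := by
        rw [add_lie, hχ, add_zero, lie_x_incl, ρz_antipode]
      change op _ * op (D.incl (HopfAlgebra.antipode k a)) -
        op (D.incl (HopfAlgebra.antipode k a)) * op _ =
          op (D.incl (HopfAlgebra.antipode k (D.ρz a)))
      rw [← op_mul, ← op_mul, ← op_sub, ← hlie, LieRing.of_associative_ring_bracket]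
      simp only [mul_neg, neg_mul]
      abel_nf)
    (by
      change _ + op (D.incl (HopfAlgebra.antipode k D.Θ)) = 0
      rw [aeval_op_apply, MonogenicHopf.aeval_neg, aeval_x_add_antipodeMul, ← op_add,
        neg_add_cancel, op_zero])

/-- The antipode of `u(D)`. -/
def antipode : D.u →ₗ[k] D.u :=
  (opLinearEquiv k).symm.toLinearMap ∘ₗ D.antipodeOp.toLinearMap

theorem antipode_mul (u v : D.u) : D.antipode (u * v) = D.antipode v * D.antipode u := by
  simp [antipode]

theorem antipode_one : D.antipode 1 = 1 := by
  simp [antipode]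

theorem antipode_incl (a : RestrictedEnveloping k p h) :
    D.antipode (D.incl a) = D.incl (HopfAlgebra.antipode k a) := by
  rw [antipode, antipodeOp, LinearMap.comp_apply, AlgHom.toLinearMap_apply, lift_incl]
  rfl

theorem antipode_x : D.antipode D.x = -(D.x + D.incl (Cobar.antipodeMul k _ D.χ)) := by
  rw [antipode, antipodeOp, LinearMap.comp_apply, AlgHom.toLinearMap_apply, lift_x]
  rfl

theorem mul_antipode_rTensor_inclSq
    (c : RestrictedEnveloping k p h ⊗[k] RestrictedEnveloping k p h) :
    LinearMap.mul' k D.u (D.antipode.rTensor D.u (D.inclSq c)) =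
      D.incl (Cobar.antipodeMul k _ c) := by
  induction c with
  | zero => simp
  | add c d hc hd => simp only [map_add, hc, hd]
  | tmul a b => simp [antipode_incl]

theorem mul_antipode_lTensor_inclSq
    (c : RestrictedEnveloping k p h ⊗[k] RestrictedEnveloping k p h) :
    LinearMap.mul' k D.u (D.antipode.lTensor D.u (D.inclSq c)) =
      D.incl (Cobar.mulAntipode k _ c) := by
  induction c with
  | zero => simp
  | add c d hc hd => simp only [map_add, hc, hd]
  | tmul a b => simp [antipode_incl]

theorem mul_antipode_rTensor_comul (u : D.u) :
    LinearMap.mul' k D.u (D.antipode.rTensor D.u (D.comul u)) = algebraMap k D.u (D.counit u) := by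
  induction u using induction with
  | incl a =>
    rw [comul_incl, mul_antipode_rTensor_inclSq, Cobar.antipodeMul_comul, counit_incl,
      AlgHom.commutes]
  | x =>
    rw [comul_x, map_add, map_add, mul_antipode_rTensor_inclSq, counit_x]
    simp [antipode_x, antipode_one]
  | add u v hu hv => simp only [map_add, hu, hv]
  | mul u v hu hv =>
    rw [map_mul D.comul, HopfExt.mul_rTensor_mul D.antipode_mul hu hv, map_mul D.counit]

theorem mul_antipode_lTensor_comul (u : D.u) :
    LinearMap.mul' k D.u (D.antipode.lTensor D.u (D.comul u)) = algebraMap k D.u (D.counit u) := by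
  induction u using induction with
  | incl a =>
    rw [comul_incl, mul_antipode_lTensor_inclSq, Cobar.mulAntipode_comul, counit_incl,
      AlgHom.commutes]
  | x =>
    rw [comul_x, map_add, map_add, mul_antipode_lTensor_inclSq, counit_x,
      ← Cobar.antipodeMul_eq_mulAntipode D.χ_mem]
    simp [antipode_x, antipode_one]
  | add u v hu hv => simp only [map_add, hu, hv]
  | mul u v hu hv =>
    rw [map_mul D.comul, HopfExt.mul_lTensor_mul D.antipode_mul hu hv, map_mul D.counit]

/-- The Hopf algebra structure of `u(D)`. -/
def hopfStructure : HopfStructure k D.u where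
  comul := D.comul
  counit := D.counit
  antipode := D.antipode
  coassoc := D.comul_coassoc
  counit_left := D.counit_comul_left
  counit_right := D.counit_comul_right
  antipode_left := D.mul_antipode_rTensor_comul
  antipode_right := D.mul_antipode_lTensor_comul

theorem isPrescribed : D.IsPrescribed D.hopfStructure where
  comul_incl := D.comul_incl
  counit_incl := D.counit_incl
  comul_x := D.comul_x
  counit_x := D.counit_x

end Antipode

end CompatibleDatum

/-! ### Connectedness -/

namespace HopfExt

open TensorProduct

section TensorFiltration

variable {k : Type*} [Field k]

/-- The filtration of `V ⊗ V` induced by a filtration `F` of `V`: its `m`-th term is the sum of the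
`F i ⊗ F j` with `i + j ≤ m`. -/
def tensorFiltration {V : Type*} [AddCommGroup V] [Module k V] (F : ℕ → Submodule k V) (m : ℕ) :
    Submodule k (V ⊗[k] V) :=
  Submodule.span k {y | ∃ i j : ℕ, i + j ≤ m ∧ ∃ a ∈ F i, ∃ b ∈ F j, a ⊗ₜ[k] b = y}

variable {V W : Type*} [AddCommGroup V] [Module k V] [AddCommGroup W] [Module k W]
  {F : ℕ → Submodule k V} {G : ℕ → Submodule k W}

theorem tmul_mem_tensorFiltration {m i j : ℕ} (hm : i + j ≤ m) {a b : V} (ha : a ∈ F i)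
    (hb : b ∈ F j) : a ⊗ₜ[k] b ∈ tensorFiltration F m :=
  Submodule.subset_span ⟨i, j, hm, a, ha, b, hb, rfl⟩

theorem tensorFiltration_mono : Monotone (tensorFiltration F) := fun _ _ hm =>
  Submodule.span_mono fun _ ⟨i, j, hij, e⟩ => ⟨i, j, hij.trans hm, e⟩

theorem exists_mem_tensorFiltration (hF : ∀ v, ∃ m, v ∈ F m) (c : V ⊗[k] V) :
    ∃ m, c ∈ tensorFiltration F m := by
  induction c with
  | zero => exact ⟨0, zero_mem _⟩
  | add c d hc hd =>
    obtain ⟨i, hi⟩ := hc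
    obtain ⟨j, hj⟩ := hd
    exact ⟨max i j, add_mem (tensorFiltration_mono (le_max_left _ _) hi)
      (tensorFiltration_mono (le_max_right _ _) hj)⟩
  | tmul a b =>
    obtain ⟨i, hi⟩ := hF a
    obtain ⟨j, hj⟩ := hF b
    exact ⟨i + j, tmul_mem_tensorFiltration le_rfl hi hj⟩

theorem map_mem_tensorFiltration {f : V →ₗ[k] W} (hf : ∀ m, ∀ a ∈ F m, f a ∈ G m) {m : ℕ}
    {c : V ⊗[k] V} (hc : c ∈ tensorFiltration F m) :
    TensorProduct.map f f c ∈ tensorFiltration G m := by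
  suffices hle : tensorFiltration F m ≤ (tensorFiltration G m).comap (TensorProduct.map f f) from
    hle hc
  refine Submodule.span_le.mpr ?_
  rintro _ ⟨i, j, hij, a, ha, b, hb, rfl⟩
  exact tmul_mem_tensorFiltration hij (hf _ _ ha) (hf _ _ hb)

theorem mul_mem_tensorFiltration {H : Type*} [Ring H] [Algebra k H] {F : ℕ → Submodule k H}
    (hF : ∀ i j, ∀ a ∈ F i, ∀ b ∈ F j, a * b ∈ F (i + j)) {i j : ℕ} {c d : H ⊗[k] H}
    (hc : c ∈ tensorFiltration F i) (hd : d ∈ tensorFiltration F j) :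
    c * d ∈ tensorFiltration F (i + j) := by
  have hcd := Submodule.mul_mem_mul hc hd
  rw [tensorFiltration, tensorFiltration, Submodule.span_mul_span] at hcd
  refine Submodule.span_mono ?_ hcd
  rintro _ ⟨_, ⟨i, j, hij, a, ha, b, hb, rfl⟩, _, ⟨i', j', hij', a', ha', b', hb', rfl⟩, rfl⟩
  exact ⟨i + i', j + j', by omega, a * a', hF _ _ a ha a' ha', b * b', hF _ _ b hb b' hb', by simp⟩

end TensorFiltration

section WeightFiltration

variable {k : Type*} {H : Type*} [Field k] [Ring H] [Algebra k H]
  {J : Type*} {g : J → H} {w : J → ℕ}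

variable (k g w) in
/-- The filtration of an algebra by weight, for a family of elements `g j` of weights `w j`: its
`m`-th term is spanned by the products of the `g j` of total weight at most `m`. -/
def weightFiltration (m : ℕ) : Submodule k H :=
  Submodule.span k {y | ∃ l : List J, (l.map w).sum ≤ m ∧ (l.map g).prod = y}

theorem weightFiltration_mono : Monotone (weightFiltration k g w) := fun _ _ hm =>
  Submodule.span_mono fun _ ⟨l, hl, e⟩ => ⟨l, hl.trans hm, e⟩

theorem one_mem_weightFiltration (m : ℕ) : (1 : H) ∈ weightFiltration k g w m :=
  Submodule.subset_span ⟨[], by simp, by simp⟩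

theorem mem_weightFiltration (j : J) : g j ∈ weightFiltration k g w (w j) :=
  Submodule.subset_span ⟨[j], by simp, by simp⟩

theorem mul_mem_weightFiltration {i j : ℕ} {a b : H} (ha : a ∈ weightFiltration k g w i)
    (hb : b ∈ weightFiltration k g w j) : a * b ∈ weightFiltration k g w (i + j) := by
  have hab := Submodule.mul_mem_mul ha hb
  rw [weightFiltration, weightFiltration, Submodule.span_mul_span] at hab
  refine Submodule.span_mono ?_ hab
  rintro _ ⟨_, ⟨l, hl, rfl⟩, _, ⟨l', hl', rfl⟩, rfl⟩
  exact ⟨l ++ l', by simpa using add_le_add hl hl', by simp⟩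

theorem weightFiltration_zero_le (hw : ∀ j, w j ≠ 0) :
    weightFiltration k g w 0 ≤ Submodule.span k {1} := by
  refine Submodule.span_mono ?_
  rintro _ ⟨l, hl, rfl⟩
  cases l with
  | nil => simp
  | cons j l => simp [hw j] at hl

theorem exists_mem_weightFiltration {a : H} (ha : a ∈ Algebra.adjoin k (Set.range g)) :
    ∃ m, a ∈ weightFiltration k g w m := by
  induction ha using Algebra.adjoin_induction with
  | mem a ha =>
    obtain ⟨j, rfl⟩ := ha
    exact ⟨_, mem_weightFiltration j⟩
  | algebraMap r =>
    rw [Algebra.algebraMap_eq_smul_one]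
    exact ⟨0, Submodule.smul_mem _ _ (one_mem_weightFiltration 0)⟩
  | add a b _ _ ha hb =>
    obtain ⟨i, hi⟩ := ha
    obtain ⟨j, hj⟩ := hb
    exact ⟨max i j, add_mem (weightFiltration_mono (le_max_left _ _) hi)
      (weightFiltration_mono (le_max_right _ _) hj)⟩
  | mul a b _ _ ha hb =>
    obtain ⟨i, hi⟩ := ha
    obtain ⟨j, hj⟩ := hb
    exact ⟨i + j, mul_mem_weightFiltration hi hj⟩

theorem map_mem_weightFiltration {H' J' : Type*} [Ring H'] [Algebra k H'] {g' : J' → H'}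
    {w' : J' → ℕ} {f : H →ₐ[k] H'} {e : J → J'} (hg : ∀ j, f (g j) = g' (e j))
    (hw : ∀ j, w' (e j) = w j) {m : ℕ} {a : H} (ha : a ∈ weightFiltration k g w m) :
    f a ∈ weightFiltration k g' w' m := by
  suffices hle : weightFiltration k g w m ≤ (weightFiltration k g' w' m).comap f.toLinearMap from
    hle ha
  refine Submodule.span_le.mpr ?_
  rintro _ ⟨l, hl, rfl⟩
  exact Submodule.subset_span ⟨l.map e, by simpa [Function.comp_def, hw] using hl,
    by simp [map_list_prod, Function.comp_def, hg]⟩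

theorem comul_mem_tensorFiltration {Δ : H →ₐ[k] H ⊗[k] H}
    (hΔ : ∀ j, Δ (g j) ∈ tensorFiltration (weightFiltration k g w) (w j)) {m : ℕ} {a : H}
    (ha : a ∈ weightFiltration k g w m) : Δ a ∈ tensorFiltration (weightFiltration k g w) m := by
  suffices hle : weightFiltration k g w m ≤
      (tensorFiltration (weightFiltration k g w) m).comap Δ.toLinearMap from hle ha
  refine Submodule.span_le.mpr ?_
  rintro _ ⟨l, hl, rfl⟩
  refine tensorFiltration_mono hl ?_
  clear hl
  change Δ _ ∈ _
  induction l with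
  | nil =>
    rw [List.map_nil, List.map_nil, List.prod_nil, List.sum_nil, map_one,
      Algebra.TensorProduct.one_def]
    exact tmul_mem_tensorFiltration (zero_add 0).le (one_mem_weightFiltration 0)
      (one_mem_weightFiltration 0)
  | cons j l ih =>
    rw [List.map_cons, List.map_cons, List.prod_cons, List.sum_cons, map_mul]
    exact mul_mem_tensorFiltration (fun _ _ _ ha _ hb => mul_mem_weightFiltration ha hb) (hΔ j) ih

end WeightFiltration

section Subcoalgebra

variable {k : Type*} {H : Type*} [Field k] [AddCommGroup H] [Module k H] [Coalgebra k H]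

theorem IsSubcoalgebra.lid_rTensor_comul_mem {C : Submodule k H} (hC : IsSubcoalgebra k C) {c : H}
    (hc : c ∈ C) (φ : H →ₗ[k] k) :
    TensorProduct.lid k H (φ.rTensor H (Coalgebra.comul c)) ∈ C := by
  obtain ⟨t, ht⟩ := hC c hc
  rw [← ht]
  clear ht
  induction t with
  | zero => simp
  | add s t hs ht => rw [map_add, map_add, map_add]; exact add_mem hs ht
  | tmul a b => simpa using C.smul_mem _ b.2

theorem counit_lid_rTensor_comul (φ : H →ₗ[k] k) (c : H) :
    Coalgebra.counit (R := k) (TensorProduct.lid k H (φ.rTensor H (Coalgebra.comul c))) = φ c := by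
  have hswap (t : H ⊗[k] H) : Coalgebra.counit (R := k) (TensorProduct.lid k H (φ.rTensor H t)) =
      φ (TensorProduct.rid k H (Coalgebra.counit.lTensor H t)) := by
    induction t with
    | zero => simp
    | add s t hs ht => simp only [map_add, hs, ht]
    | tmul a b => simp [mul_comm]
  rw [hswap, Coalgebra.lTensor_counit_comul, TensorProduct.rid_tmul, one_smul]

end Subcoalgebra

section Connected

variable {k : Type*} {H : Type*} [Field k] [Ring H] [Bialgebra k H] {F : ℕ → Submodule k H}

theorem lid_rTensor_mem_span_one (hzero : F 0 ≤ Submodule.span k {1}) (hmono : Monotone F) {m : ℕ}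
    {φ : H →ₗ[k] k} (hφ : F m ≤ LinearMap.ker φ) {t : H ⊗[k] H}
    (ht : t ∈ tensorFiltration F (m + 1)) :
    TensorProduct.lid k H (φ.rTensor H t) ∈ Submodule.span k {(1 : H)} := by
  suffices hle : tensorFiltration F (m + 1) ≤ (Submodule.span k {(1 : H)}).comap
      ((TensorProduct.lid k H).toLinearMap ∘ₗ φ.rTensor H) from hle ht
  refine Submodule.span_le.mpr ?_
  rintro _ ⟨i, j, hij, a, ha, b, hb, rfl⟩
  change TensorProduct.lid k H (φ a ⊗ₜ b) ∈ Submodule.span k {(1 : H)}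
  rw [TensorProduct.lid_tmul]
  by_cases hi : i ≤ m
  · rw [show φ a = 0 from hφ (hmono hi ha), zero_smul]
    exact zero_mem _
  · obtain rfl : j = 0 := by omega
    exact Submodule.smul_mem _ _ (hzero hb)

theorem one_mem_of_isSubcoalgebra (hzero : F 0 ≤ Submodule.span k {1}) (hmono : Monotone F)
    (hex : ∀ u : H, ∃ m, u ∈ F m)
    (hΔ : ∀ m, ∀ u ∈ F m, Coalgebra.comul (R := k) u ∈ tensorFiltration F m)
    {C : Submodule k H} (hC : IsSubcoalgebra k C) (hbot : C ≠ ⊥) : (1 : H) ∈ C := by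
  classical
  obtain ⟨c, hc, hc0⟩ := Submodule.exists_mem_ne_zero_of_ne_bot hbot
  suffices hscalar : ∃ r : k, r ≠ 0 ∧ r • (1 : H) ∈ C by
    obtain ⟨r, hr, hrC⟩ := hscalar
    simpa [inv_smul_smul₀ hr] using C.smul_mem r⁻¹ hrC
  have hmin (i : ℕ) (hi : i < Nat.find (hex c)) : c ∉ F i := Nat.find_min (hex c) hi
  have hm : c ∈ F (Nat.find (hex c)) := Nat.find_spec (hex c)
  generalize Nat.find (hex c) = m at hmin hm
  cases m with
  | zero =>
    obtain ⟨r, rfl⟩ := Submodule.mem_span_singleton.mp (hzero hm)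
    exact ⟨r, fun hr => hc0 (by rw [hr, zero_smul]), hc⟩
  | succ m =>
    -- A functional vanishing on `F m` but not at `c` contracts `Δ c` to a non-zero scalar in `C`.
    obtain ⟨φ, hφc, hφ⟩ := Submodule.exists_le_ker_of_notMem (hmin m (Nat.lt_succ_self m))
    obtain ⟨r, hr⟩ := Submodule.mem_span_singleton.mp
      (lid_rTensor_mem_span_one hzero hmono hφ (hΔ _ c hm))
    have hrφ : r = φ c := by simpa [← hr] using counit_lid_rTensor_comul φ c
    exact ⟨r, hrφ ▸ hφc, hr ▸ hC.lid_rTensor_comul_mem hc φ⟩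

theorem isSubcoalgebra_span_one : IsSubcoalgebra k (Submodule.span k {(1 : H)}) := by
  intro c hc
  obtain ⟨r, rfl⟩ := Submodule.mem_span_singleton.mp hc
  let e : Submodule.span k {(1 : H)} := ⟨1, Submodule.mem_span_singleton_self 1⟩
  exact ⟨r • (e ⊗ₜ e), by simp [e, Algebra.TensorProduct.one_def]⟩

theorem isConnected_of_filtration (hzero : F 0 ≤ Submodule.span k {1}) (hmono : Monotone F)
    (hex : ∀ u : H, ∃ m, u ∈ F m)
    (hΔ : ∀ m, ∀ u ∈ F m, Coalgebra.comul (R := k) u ∈ tensorFiltration F m) :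
    IsConnected k H := by
  have hone : (1 : H) ≠ 0 := fun h => by simpa using congrArg (Coalgebra.counit (R := k)) h
  have hbot : Submodule.span k {(1 : H)} ≠ ⊥ := by simpa using hone
  have hle {C : Submodule k H} (hC : IsSubcoalgebra k C) (hC0 : C ≠ ⊥) :
      Submodule.span k {(1 : H)} ≤ C :=
    (Submodule.span_singleton_le_iff_mem _ _).mpr
      (one_mem_of_isSubcoalgebra hzero hmono hex hΔ hC hC0)
  have hcoradical : coradical k H = Submodule.span k {1} := by
    refine le_antisymm (sSup_le fun C hC => ?_)
      (le_sSup ⟨isSubcoalgebra_span_one, hbot, fun E hE hE1 => ?_⟩)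
    · exact ((hC.2.2 _ isSubcoalgebra_span_one (hle hC.1 hC.2.1)).resolve_left hbot).ge
    · exact or_iff_not_imp_left.mpr fun hE0 => le_antisymm hE1 (hle hE hE0)
  rw [IsConnected, hcoradical]
  exact finrank_span_singleton hone

end Connected

end HopfExt

theorem RestrictedEnveloping.adjoin_range_ι {k : Type*} {p : ℕ} {L : Type*} [Field k]
    [Fact p.Prime] [CharP k p] [LieRing L] [LieAlgebra k L] [RestrictedLieAlgebra k p L] :
    Algebra.adjoin k (Set.range (ι k p L)) = ⊤ := by
  refine eq_top_iff.mpr fun a _ => ?_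
  induction a using RestrictedEnveloping.induction with
  | hal r => exact Subalgebra.algebraMap_mem _ r
  | hι v => exact Algebra.subset_adjoin ⟨v, rfl⟩
  | hadd a b ha hb => exact add_mem (ha trivial) (hb trivial)
  | hmul a b ha hb => exact mul_mem (ha trivial) (hb trivial)

namespace CompatibleDatum

open HopfExt TensorProduct

section Connected

variable {k : Type*} {p : ℕ} {h : Type*} [Field k] [Fact p.Prime] [CharP k p]
  [LieRing h] [LieAlgebra k h] [IsLieAbelian h] [RestrictedLieAlgebra k p h]
  {n : ℕ} {lam : Fin n → k} (D : CompatibleDatum k p h lam)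

/-- The generators of the algebra `u(D)`: the elements of `h`, and `x`. -/
def gen : h ⊕ Unit → D.u :=
  Sum.elim (fun v => D.incl (RestrictedEnveloping.ι k p h v)) fun _ => D.x

/-- Weights for the generators of `u(D)`, with weight `N` for `x` and weight `1` for the elements
of `h`. -/
def weight (h : Type*) (N : ℕ) : h ⊕ Unit → ℕ := Sum.elim (fun _ => 1) fun _ => N

theorem adjoin_range_gen : Algebra.adjoin k (Set.range D.gen) = ⊤ := by
  refine eq_top_iff.mpr fun u _ => ?_
  induction u using induction with
  | incl a =>
    have ha : D.incl a ∈
        (Algebra.adjoin k (Set.range (RestrictedEnveloping.ι k p h))).map D.incl :=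
      ⟨a, by rw [RestrictedEnveloping.adjoin_range_ι]; trivial, rfl⟩
    rw [AlgHom.map_adjoin] at ha
    refine Algebra.adjoin_mono ?_ ha
    rintro _ ⟨_, ⟨v, rfl⟩, rfl⟩
    exact ⟨.inl v, rfl⟩
  | x => exact Algebra.subset_adjoin ⟨.inr (), rfl⟩
  | add u v hu hv => exact add_mem (hu trivial) (hv trivial)
  | mul u v hu hv => exact mul_mem (hu trivial) (hv trivial)

theorem incl_mem_weightFiltration (N : ℕ) {m : ℕ} {a : RestrictedEnveloping k p h}
    (ha : a ∈ weightFiltration k (RestrictedEnveloping.ι k p h) (fun _ => 1) m) :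
    D.incl a ∈ weightFiltration k D.gen (weight h N) m :=
  map_mem_weightFiltration (g' := D.gen) (f := D.incl) (e := Sum.inl (β := Unit))
    (fun _ => by simp only [gen, Sum.elim_inl]) (fun _ => by simp only [weight, Sum.elim_inl]) ha

theorem comul_incl_ι (v : h) : D.comul (D.incl (RestrictedEnveloping.ι k p h v)) =
    D.incl (RestrictedEnveloping.ι k p h v) ⊗ₜ[k] 1 +
      1 ⊗ₜ[k] D.incl (RestrictedEnveloping.ι k p h v) := by
  have hv : Coalgebra.comul (R := k) (RestrictedEnveloping.ι k p h v) =
      RestrictedEnveloping.ι k p h v ⊗ₜ[k] 1 + 1 ⊗ₜ[k] RestrictedEnveloping.ι k p h v :=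
    RestrictedEnveloping.comul_ι k p h v
  rw [comul_incl, hv, map_add, inclSq_tmul, inclSq_tmul, map_one]

theorem comul_gen_mem_tensorFiltration {N : ℕ}
    (hχ : D.χ ∈ tensorFiltration
      (weightFiltration k (RestrictedEnveloping.ι k p h) fun _ => 1) N) (j : h ⊕ Unit) :
    D.comul (D.gen j) ∈
      tensorFiltration (weightFiltration k D.gen (weight h (N + 1))) (weight h (N + 1) j) := by
  have hprim : D.gen j ⊗ₜ[k] 1 + 1 ⊗ₜ[k] D.gen j ∈
      tensorFiltration (weightFiltration k D.gen (weight h (N + 1))) (weight h (N + 1) j) :=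
    add_mem
      (tmul_mem_tensorFiltration (add_zero _).le (mem_weightFiltration j)
        (one_mem_weightFiltration 0))
      (tmul_mem_tensorFiltration (zero_add _).le (one_mem_weightFiltration 0)
        (mem_weightFiltration j))
  obtain v | _ := j
  · exact (D.comul_incl_ι v).symm ▸ hprim
  · refine D.comul_x.symm ▸ add_mem hprim (tensorFiltration_mono (Nat.le_succ N) ?_)
    exact map_mem_tensorFiltration (f := D.incl.toLinearMap)
      (fun _ _ => D.incl_mem_weightFiltration (N + 1)) hχ

theorem isConnected : letI : HopfAlgebra k D.u := D.hopfStructure.toHopfAlgebra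
    HopfExt.IsConnected k D.u := by
  let : HopfAlgebra k D.u := D.hopfStructure.toHopfAlgebra
  obtain ⟨N, hN⟩ : ∃ N, D.χ ∈ tensorFiltration
      (weightFiltration k (RestrictedEnveloping.ι k p h) fun _ => 1) N :=
    exists_mem_tensorFiltration (fun a => exists_mem_weightFiltration
      (RestrictedEnveloping.adjoin_range_ι (k := k) (p := p) (L := h) ▸ Algebra.mem_top)) D.χ
  -- With `x` heavier than `χ`, the comultiplication respects the weight filtration.
  refine isConnected_of_filtration (F := weightFiltration k D.gen (weight h (N + 1)))
    (weightFiltration_zero_le ?_) weightFiltration_mono (fun u => exists_mem_weightFiltration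
      (D.adjoin_range_gen ▸ Algebra.mem_top))
    fun m u hu => comul_mem_tensorFiltration (Δ := D.comul) (D.comul_gen_mem_tensorFiltration hN) hu
  rintro (_ | _) <;> simp [weight]

end Connected

end CompatibleDatum

/-! ### The extension of `A` by `B` -/

namespace CompatibleDatum

open Polynomial TensorProduct

variable {k : Type*} {p : ℕ} {h : Type*} [Field k] [hp : Fact p.Prime] [CharP k p]
  [LieRing h] [LieAlgebra k h] [IsLieAbelian h] [RestrictedLieAlgebra k p h]
  {n : ℕ} {lam : Fin n → k} (D : CompatibleDatum k p h lam)

section Extension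

instance : HopfAlgebra k D.u := D.hopfStructure.toHopfAlgebra

theorem coalgebra_comul_apply (u : D.u) : Coalgebra.comul (R := k) u = D.comul u := rfl

/-- The canonical map `ι : A → u(D)`, as a map of bialgebras. -/
def inclHom : RestrictedEnveloping k p h →ₐc[k] D.u :=
  BialgHom.ofAlgHom D.incl (AlgHom.ext D.counit_incl)
    (AlgHom.ext fun a => (D.comul_incl a).symm)

theorem inclHom_apply (a : RestrictedEnveloping k p h) : D.inclHom a = D.incl a := rfl

/-- The projection `π : u(D) → B`, as a map of algebras. -/
def projAlgHom : D.u →ₐ[k] MonogenicHopf k p lam :=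
  D.lift ((Algebra.ofId k _).comp (Bialgebra.counitAlgHom k _)) (MonogenicHopf.z k p lam)
    (fun a => by simp [LieRing.of_associative_ring_bracket, mul_comm, counit_ρz])
    (by
      have hΘ : Coalgebra.counit (R := k) D.Θ = 0 := D.Θ_mem
      simp [hΘ, MonogenicHopf.aeval_z])

theorem projAlgHom_incl (a : RestrictedEnveloping k p h) :
    D.projAlgHom (D.incl a) = algebraMap k _ (Coalgebra.counit (R := k) a) := by
  rw [projAlgHom, lift_incl]; rfl

theorem projAlgHom_x : D.projAlgHom D.x = MonogenicHopf.z k p lam := by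
  rw [projAlgHom, lift_x]

theorem projAlgHom_comp_incl : D.projAlgHom.toLinearMap ∘ₗ D.incl.toLinearMap =
    Algebra.linearMap k (MonogenicHopf k p lam) ∘ₗ Coalgebra.counit :=
  LinearMap.ext D.projAlgHom_incl

theorem projAlgHom_incl_eq_zero (a : RestrictedEnveloping k p h)
    (ha : a ∈ Cobar.augIdeal k (RestrictedEnveloping k p h)) :
    D.projAlgHom (D.incl a) = 0 := by
  have hε : Coalgebra.counit (R := k) a = 0 := ha
  rw [projAlgHom_incl, hε, map_zero]

/-- The coaction `(id ⊗ π) ∘ Δ` of `B` on `u(D)`. -/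
def coaction : D.u →ₐ[k] D.u ⊗[k] MonogenicHopf k p lam :=
  (Algebra.TensorProduct.map (.id k D.u) D.projAlgHom).comp D.comul

theorem coaction_apply (u : D.u) : D.coaction u =
    TensorProduct.map LinearMap.id D.projAlgHom.toLinearMap (D.comul u) := rfl

theorem coaction_incl (a : RestrictedEnveloping k p h) :
    D.coaction (D.incl a) = D.incl a ⊗ₜ 1 := by
  rw [coaction_apply, comul_incl, map_inclSq, projAlgHom_comp_incl, LinearMap.id_comp,
    ← LinearMap.map_comp_lTensor, LinearMap.comp_apply, Coalgebra.lTensor_counit_comul]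
  simp

theorem map_id_projAlgHom_inclSq
    {c : RestrictedEnveloping k p h ⊗[k] RestrictedEnveloping k p h} (hc : c ∈ Cobar.augSq k _) :
    TensorProduct.map LinearMap.id D.projAlgHom.toLinearMap (D.inclSq c) = 0 := by
  rw [map_inclSq]
  exact Cobar.map_eq_zero_of_augSq (.inr D.projAlgHom_incl_eq_zero) hc

theorem map_projAlgHom_id_inclSq
    {c : RestrictedEnveloping k p h ⊗[k] RestrictedEnveloping k p h} (hc : c ∈ Cobar.augSq k _) :
    TensorProduct.map D.projAlgHom.toLinearMap LinearMap.id (D.inclSq c) = 0 := by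
  rw [map_inclSq]
  exact Cobar.map_eq_zero_of_augSq (.inl D.projAlgHom_incl_eq_zero) hc

theorem coaction_x : D.coaction D.x = D.x ⊗ₜ 1 + 1 ⊗ₜ MonogenicHopf.z k p lam := by
  rw [coaction_apply, comul_x, map_add, D.map_id_projAlgHom_inclSq D.χ_mem.1]
  simp [projAlgHom_x]

theorem map_projAlgHom_comul (u : D.u) :
    Algebra.TensorProduct.map D.projAlgHom D.projAlgHom (D.comul u) =
      Algebra.TensorProduct.map D.projAlgHom (.id k _) (D.coaction u) := by
  rw [coaction, AlgHom.comp_apply, ← AlgHom.comp_apply _ (Algebra.TensorProduct.map _ _),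
    ← Algebra.TensorProduct.map_comp, AlgHom.comp_id, AlgHom.id_comp]

/-- The projection `π : u(D) → B`, as a map of bialgebras. -/
def proj : D.u →ₐc[k] MonogenicHopf k p lam :=
  BialgHom.ofAlgHom D.projAlgHom
    (algHom_ext
      (fun a => by
        refine Eq.trans ?_ (D.counit_incl a).symm
        rw [AlgHom.comp_apply, projAlgHom_incl, AlgHom.commutes]
        rfl)
      (by
        refine Eq.trans ?_ D.counit_x.symm
        rw [AlgHom.comp_apply, projAlgHom_x]
        exact MonogenicHopf.counit_z k p lam))
    (algHom_ext
      (fun a => by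
        refine (D.map_projAlgHom_comul (D.incl a)).trans ?_
        rw [coaction_incl, AlgHom.comp_apply, projAlgHom_incl, AlgHom.commutes]
        simp [projAlgHom_incl, Algebra.TensorProduct.algebraMap_apply])
      (by
        refine (D.map_projAlgHom_comul D.x).trans ?_
        rw [coaction_x, AlgHom.comp_apply, projAlgHom_x]
        refine Eq.trans ?_ (MonogenicHopf.comul_z k p lam).symm
        simp [projAlgHom_x]))

theorem proj_apply (u : D.u) : D.proj u = D.projAlgHom u := rfl

theorem proj_surjective : Function.Surjective D.proj := by
  intro b
  refine ⟨∑ j, (MonogenicHopf.powerBasis k p lam).repr b j • D.x ^ (j : ℕ), ?_⟩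
  conv_rhs => rw [← (MonogenicHopf.powerBasis k p lam).sum_repr b]
  simp [proj_apply, projAlgHom_x, MonogenicHopf.powerBasis_apply]

/-- The map `u(D) → A ⊗ B` applying `constCoeff` to the first factor of the coaction; it sends
`a x ^ j` to `a ⊗ z ^ j`. -/
def toTensor : D.u →ₗ[k] RestrictedEnveloping k p h ⊗[k] MonogenicHopf k p lam :=
  D.constCoeff.rTensor _ ∘ₗ D.coaction.toLinearMap

theorem toTensor_apply (u : D.u) : D.toTensor u = D.constCoeff.rTensor _ (D.coaction u) := rfl

theorem toTensor_incl_mul_x_pow (a : RestrictedEnveloping k p h) {j : ℕ} (hj : j < p ^ n) :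
    D.toTensor (D.incl a * D.x ^ j) = a ⊗ₜ (MonogenicHopf.z k p lam ^ j) := by
  have hcomm : Commute (D.x ⊗ₜ[k] (1 : MonogenicHopf k p lam))
      ((1 : D.u) ⊗ₜ[k] MonogenicHopf.z k p lam) := by simp [commute_iff_eq]
  have hcoaction : D.coaction (D.incl a * D.x ^ j) = ∑ i ∈ Finset.range (j + 1),
      j.choose i • ((D.incl a * D.x ^ i) ⊗ₜ[k] (MonogenicHopf.z k p lam ^ (j - i))) := by
    rw [map_mul, map_pow, coaction_incl, coaction_x, hcomm.add_pow, Finset.mul_sum]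
    refine Finset.sum_congr rfl fun i _ => ?_
    rw [← mul_assoc, ← Nat.cast_comm, ← nsmul_eq_mul]
    simp [Algebra.TensorProduct.tmul_pow]
  rw [toTensor_apply, hcoaction, map_sum, Finset.sum_eq_single 0]
  · simp [constCoeff_incl]
  · intro i hi hi0
    have hi' : i < p ^ n := by have := Finset.mem_range.mp hi; omega
    rw [map_nsmul, LinearMap.rTensor_tmul, D.constCoeff_incl_mul_x_pow a hi', if_neg hi0,
      zero_tmul, smul_zero]
  · simp

theorem toTensor_injective : Function.Injective D.toTensor := by
  refine (injective_iff_map_eq_zero _).mpr fun u hu => ?_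
  obtain ⟨c, rfl⟩ := D.ofCoeffs_surjective u
  have hc (i : Fin (p ^ n)) : c i = 0 := by
    have hi := congrArg (TensorProduct.rid k _ ∘
      ((MonogenicHopf.powerBasis k p lam).coord i).lTensor (RestrictedEnveloping k p h)) hu
    simp only [Function.comp_apply, map_zero] at hi
    rw [ofCoeffs_apply, map_sum, Finset.sum_congr rfl fun j _ =>
      D.toTensor_incl_mul_x_pow (c j) j.2, map_sum, map_sum] at hi
    simpa only [LinearMap.lTensor_tmul, MonogenicHopf.coord_pow i (Fin.is_lt _), rid_tmul,
      ← Fin.ext_iff, ite_smul, one_smul, zero_smul, Finset.sum_ite_eq', Finset.mem_univ,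
      if_true] using hi
  rw [funext hc]
  exact map_zero _

theorem mem_range_incl_iff (u : D.u) : u ∈ Set.range D.incl ↔ D.coaction u = u ⊗ₜ 1 := by
  refine ⟨?_, fun hu => ⟨D.constCoeff u, D.toTensor_injective ?_⟩⟩
  · rintro ⟨a, rfl⟩
    exact D.coaction_incl a
  · rw [toTensor_apply, toTensor_apply, coaction_incl, hu, LinearMap.rTensor_tmul,
      LinearMap.rTensor_tmul, constCoeff_incl]

theorem map_projAlgHom_id_comul (u : D.u) :
    Algebra.TensorProduct.map D.projAlgHom (.id k D.u) (D.comul u) =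
      Algebra.TensorProduct.comm k _ _ (D.coaction u) := by
  suffices hcomp : (Algebra.TensorProduct.map D.projAlgHom (.id k D.u)).comp D.comul =
      (Algebra.TensorProduct.comm k D.u (MonogenicHopf k p lam)).toAlgHom.comp D.coaction from
    congrArg (fun f => f u) hcomp
  refine algHom_ext (fun a => ?_) ?_
  · change TensorProduct.map D.projAlgHom.toLinearMap LinearMap.id (D.comul (D.incl a)) =
      Algebra.TensorProduct.comm k D.u _ (D.coaction (D.incl a))
    rw [coaction_incl, comul_incl, map_inclSq, projAlgHom_comp_incl, LinearMap.id_comp,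
      ← LinearMap.map_comp_rTensor, LinearMap.comp_apply, Coalgebra.rTensor_counit_comul]
    simp
  · change TensorProduct.map D.projAlgHom.toLinearMap LinearMap.id (D.comul D.x) =
      Algebra.TensorProduct.comm k D.u _ (D.coaction D.x)
    rw [coaction_x, comul_x, map_add, D.map_projAlgHom_id_inclSq D.χ_mem.1]
    simp [projAlgHom_x, add_comm]

/-- The image of the augmentation ideal `A⁺` in `u(D)`. -/
def augImage : Submodule k D.u :=
  (Cobar.augIdeal k (RestrictedEnveloping k p h)).map D.incl.toLinearMap

theorem incl_mem_augImage {a : RestrictedEnveloping k p h}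
    (ha : Coalgebra.counit (R := k) a = 0) : D.incl a ∈ D.augImage := ⟨a, ha, rfl⟩

theorem mul_incl_mem_augImage_mul_top (u : D.u) {a : RestrictedEnveloping k p h}
    (ha : Coalgebra.counit (R := k) a = 0) : u * D.incl a ∈ D.augImage * ⊤ := by
  induction u using induction generalizing a with
  | incl b =>
    rw [← map_mul, ← mul_one (D.incl _)]
    exact Submodule.mul_mem_mul (D.incl_mem_augImage (by simp [ha])) trivial
  | x =>
    rw [x_mul_incl, ← mul_one (D.incl (D.ρz a))]
    exact add_mem (Submodule.mul_mem_mul (D.incl_mem_augImage ha) trivial)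
      (Submodule.mul_mem_mul (D.incl_mem_augImage (D.counit_ρz a)) trivial)
  | add u v hu hv => rw [add_mul]; exact add_mem (hu ha) (hv ha)
  | mul u v hu hv =>
    have hy : v * D.incl a ∈ D.augImage * ⊤ := hv ha
    rw [mul_assoc]
    generalize v * D.incl a = y at hy
    induction hy using Submodule.mul_induction_on' with
    | add v _ w _ hv hw => rw [mul_add]; exact add_mem hv hw
    | mem_mul_mem b hb w _ =>
      obtain ⟨b, hb, rfl⟩ := hb
      have hmem := Submodule.mul_mem_mul (hu hb) (Submodule.mem_top (x := w))
      rw [mul_assoc, mul_assoc] at hmem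
      exact (mul_le_mul' le_rfl le_top : _ ≤ D.augImage * ⊤) hmem

theorem incl_mul_mem_top_mul_augImage (u : D.u) {a : RestrictedEnveloping k p h}
    (ha : Coalgebra.counit (R := k) a = 0) : D.incl a * u ∈ ⊤ * D.augImage := by
  induction u using induction generalizing a with
  | incl b =>
    rw [← map_mul, ← one_mul (D.incl _)]
    exact Submodule.mul_mem_mul trivial (D.incl_mem_augImage (by simp [ha]))
  | x =>
    rw [eq_sub_of_add_eq (D.x_mul_incl a).symm, ← one_mul (D.incl (D.ρz a))]
    exact sub_mem (Submodule.mul_mem_mul trivial (D.incl_mem_augImage ha))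
      (Submodule.mul_mem_mul trivial (D.incl_mem_augImage (D.counit_ρz a)))
  | add u v hu hv => rw [mul_add]; exact add_mem (hu ha) (hv ha)
  | mul u v hu hv =>
    have hy : D.incl a * u ∈ ⊤ * D.augImage := hu ha
    rw [← mul_assoc]
    generalize D.incl a * u = y at hy
    induction hy using Submodule.mul_induction_on' with
    | add u _ w _ hu hw => rw [add_mul]; exact add_mem hu hw
    | mem_mul_mem w _ b hb =>
      obtain ⟨b, hb, rfl⟩ := hb
      have hmem := Submodule.mul_mem_mul (Submodule.mem_top (x := w)) (hv hb)
      rw [← mul_assoc, ← mul_assoc] at hmem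
      exact (mul_le_mul' le_top le_rfl : _ ≤ ⊤ * D.augImage) hmem

theorem augImage_mul_top : D.augImage * ⊤ = ⊤ * D.augImage := by
  refine le_antisymm (Submodule.mul_le.mpr ?_) (Submodule.mul_le.mpr ?_)
  · rintro _ ⟨a, ha, rfl⟩ u -
    exact D.incl_mul_mem_top_mul_augImage u ha
  · rintro u - _ ⟨a, ha, rfl⟩
    exact D.mul_incl_mem_augImage_mul_top u ha

theorem ker_projAlgHom : LinearMap.ker D.projAlgHom.toLinearMap = D.augImage * ⊤ := by
  refine le_antisymm (fun u hu => ?_) (Submodule.mul_le.mpr ?_)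
  · obtain ⟨c, rfl⟩ := D.ofCoeffs_surjective u
    rw [LinearMap.mem_ker, AlgHom.toLinearMap_apply, ofCoeffs_apply, map_sum] at hu
    simp only [map_mul, map_pow, projAlgHom_incl, projAlgHom_x, ← Algebra.smul_def,
      ← MonogenicHopf.powerBasis_apply] at hu
    have hcounit := Fintype.linearIndependent_iff.mp
      (MonogenicHopf.powerBasis k p lam).linearIndependent _ hu
    rw [ofCoeffs_apply]
    exact sum_mem fun j _ => Submodule.mul_mem_mul (D.incl_mem_augImage (hcounit j)) trivial
  · rintro _ ⟨a, ha, rfl⟩ u -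
    rw [LinearMap.mem_ker, AlgHom.toLinearMap_apply, AlgHom.toLinearMap_apply, map_mul,
      D.projAlgHom_incl_eq_zero a ha, zero_mul]

theorem isExtension : HopfExt.IsExtension D.inclHom D.proj where
  injective := D.incl_injective
  surjective := D.proj_surjective
  normal := D.augImage_mul_top
  ker_eq := D.ker_projAlgHom
  right_coinvariants := D.mem_range_incl_iff
  left_coinvariants u := by
    refine (D.mem_range_incl_iff u).trans ?_
    change _ ↔ Algebra.TensorProduct.map D.projAlgHom (.id k D.u) (D.comul u) = 1 ⊗ₜ u
    have hflip : (1 : MonogenicHopf k p lam) ⊗ₜ[k] u =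
        Algebra.TensorProduct.comm k D.u (MonogenicHopf k p lam) (u ⊗ₜ 1) := rfl
    rw [map_projAlgHom_id_comul, hflip, EmbeddingLike.apply_eq_iff_eq]

theorem isCocentral : HopfExt.IsCocentral D.proj := by
  intro u
  exact (D.map_projAlgHom_id_comul u).trans (LinearMap.rTensor_comm _ _).symm

end Extension

end CompatibleDatum

/-! ### Primitive elements of `u(D)` -/

theorem HopfExt.tmul_one_add_one_tmul_pow_prime_pow {k A B : Type*} {p : ℕ} [Field k]
    [hp : Fact p.Prime] [CharP k p] [Ring A] [Algebra k A] [Ring B] [Algebra k B] (a : A) (b : B)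
    (m : ℕ) : (a ⊗ₜ[k] (1 : B) + (1 : A) ⊗ₜ b) ^ p ^ m = (a ^ p ^ m) ⊗ₜ 1 + 1 ⊗ₜ (b ^ p ^ m) := by
  induction m with
  | zero => simp
  | succ m ih =>
    have hcomm : Commute ((a ^ p ^ m) ⊗ₜ[k] (1 : B)) ((1 : A) ⊗ₜ[k] (b ^ p ^ m)) := by
      simp [commute_iff_eq]
    rw [pow_succ, pow_mul, ih, add_pow_of_commute k p hcomm]
    simp [Algebra.TensorProduct.tmul_pow, pow_mul]

namespace CompatibleDatum

open TensorProduct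

variable {k : Type*} {p : ℕ} {h : Type*} [Field k] [hp : Fact p.Prime] [CharP k p]
  [LieRing h] [LieAlgebra k h] [IsLieAbelian h] [RestrictedLieAlgebra k p h]
  {n : ℕ} {lam : Fin n → k} (D : CompatibleDatum k p h lam)

section PPowerSums

/-- The `p`-polynomial `∑ c_i x^{p^i}` in the generator `x` of `u(D)`. -/
def pPowerSum (c : Fin n → k) : D.u := ∑ i, c i • D.x ^ p ^ (i : ℕ)

theorem projAlgHom_pPowerSum (c : Fin n → k) : D.projAlgHom (D.pPowerSum c) =
    ∑ i, c i • MonogenicHopf.z k p lam ^ p ^ (i : ℕ) := by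
  simp [pPowerSum, projAlgHom_x]

theorem counit_pPowerSum (c : Fin n → k) : D.counit (D.pPowerSum c) = 0 := by
  simp [pPowerSum, counit_x, zero_pow (pow_ne_zero _ hp.out.ne_zero)]

theorem comul_x_pow (m : ℕ) : D.comul (D.x ^ p ^ m) =
    (D.x ^ p ^ m) ⊗ₜ 1 + 1 ⊗ₜ (D.x ^ p ^ m) + D.inclSq (D.cocycle m) := by
  rw [map_pow, comul_x, ← HopfExt.tmul_one_add_one_tmul_pow_prime_pow]
  exact Cobar.add_map_pow_prime_pow D.lie_xSq_inclSq D.χ m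

theorem comul_pPowerSum (c : Fin n → k) : D.comul (D.pPowerSum c) =
    D.pPowerSum c ⊗ₜ 1 + 1 ⊗ₜ D.pPowerSum c +
      D.inclSq (∑ i, c i • (D.cocycle i : RestrictedEnveloping k p h ⊗[k] _)) := by
  simp only [pPowerSum, map_sum, map_smul, comul_x_pow, smul_add, Finset.sum_add_distrib,
    sum_tmul, tmul_sum, ← smul_tmul', tmul_smul]

theorem coaction_pPowerSum (c : Fin n → k) : D.coaction (D.pPowerSum c) =
    D.pPowerSum c ⊗ₜ 1 + 1 ⊗ₜ D.projAlgHom (D.pPowerSum c) := by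
  simp only [pPowerSum, map_sum, map_smul, map_pow, coaction_x, projAlgHom_x,
    HopfExt.tmul_one_add_one_tmul_pow_prime_pow, smul_add, Finset.sum_add_distrib, sum_tmul,
    tmul_sum, ← smul_tmul', tmul_smul]

theorem eq_zero_of_pPowerSum_eq_incl {c : Fin n → k} {a : RestrictedEnveloping k p h}
    (hc : D.pPowerSum c = D.incl a) : c = 0 := by
  funext i
  have hproj : ∑ j, c j • MonogenicHopf.z k p lam ^ p ^ (j : ℕ) =
      Coalgebra.counit (R := k) a • MonogenicHopf.z k p lam ^ 0 := by
    rw [← D.projAlgHom_pPowerSum, hc, projAlgHom_incl, pow_zero, Algebra.algebraMap_eq_smul_one]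
  have hcoord := congrArg
    ((MonogenicHopf.powerBasis k p lam).coord (MonogenicHopf.powIdx p n i)) hproj
  have hlt (j : Fin n) : p ^ (j : ℕ) < p ^ n := (MonogenicHopf.powIdx p n j).2
  have hval : (MonogenicHopf.powIdx p n i : ℕ) = p ^ (i : ℕ) := rfl
  simp only [map_sum, map_smul, MonogenicHopf.coord_pow _ (hlt _),
    MonogenicHopf.coord_pow _ (Nat.pow_pos hp.out.pos), hval,
    Nat.pow_right_inj hp.out.one_lt, ← Fin.ext_iff] at hcoord
  simpa [(pow_ne_zero (i : ℕ) hp.out.ne_zero).symm] using hcoord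

end PPowerSums

section Primitives

theorem inclSq_injective : Function.Injective D.inclSq :=
  TensorProduct.map_injective_of_flat_flat _ _ D.incl_injective D.incl_injective

theorem comul_incl_eq_sub_d1 (a : RestrictedEnveloping k p h) :
    D.comul (D.incl a) = D.incl a ⊗ₜ 1 + 1 ⊗ₜ D.incl a - D.inclSq (Cobar.d1 k _ a) := by
  rw [comul_incl, Cobar.d1_apply]
  simp

theorem pPowerSum_add_incl_mem_primitives_iff (c : Fin n → k) (b : RestrictedEnveloping k p h) :
    D.pPowerSum c + D.incl b ∈ HopfExt.primitives k D.u ↔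
      Cobar.d1 k _ b = ∑ i, c i • (D.cocycle i : RestrictedEnveloping k p h ⊗[k] _) := by
  have hcomul : D.comul (D.pPowerSum c + D.incl b) =
      (D.pPowerSum c + D.incl b) ⊗ₜ 1 + 1 ⊗ₜ (D.pPowerSum c + D.incl b) +
        (D.inclSq (∑ i, c i • (D.cocycle i : RestrictedEnveloping k p h ⊗[k] _)) -
          D.inclSq (Cobar.d1 k _ b)) := by
    rw [map_add, comul_pPowerSum, comul_incl_eq_sub_d1, add_tmul, tmul_add]
    abel
  rw [HopfExt.mem_primitives, coalgebra_comul_apply, hcomul, add_eq_left, sub_eq_zero,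
    D.inclSq_injective.eq_iff, eq_comm]

theorem sum_cohomologyClass_eq_zero_iff (c : Fin n → k) :
    ∑ i, c i • D.cohomologyClass i = 0 ↔ ∃ b : RestrictedEnveloping k p h,
      Coalgebra.counit (R := k) b = 0 ∧
        Cobar.d1 k _ b = ∑ i, c i • (D.cocycle i : RestrictedEnveloping k p h ⊗[k] _) := by
  have hmk : ∑ i, c i • D.cohomologyClass i =
      Submodule.Quotient.mk (∑ i, c i • D.cocycle i) := by
    simp only [cohomologyClass, ← Submodule.mkQ_apply, map_sum, map_smul]
  rw [hmk, Submodule.Quotient.mk_eq_zero, Submodule.submoduleOf, Submodule.mem_comap]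
  simp only [Submodule.subtype_apply, Submodule.coe_sum, Submodule.coe_smul]
  rfl

theorem incl_ι_mem_primitives (v : h) :
    D.incl (RestrictedEnveloping.ι k p h v) ∈ HopfExt.primitives k D.u :=
  HopfExt.mem_primitives.mpr (D.comul_incl_ι v)

theorem projAlgHom_mem_primitives {y : D.u} (hy : y ∈ HopfExt.primitives k D.u) :
    D.projAlgHom y ∈ HopfExt.primitives k (MonogenicHopf k p lam) := by
  rw [HopfExt.mem_primitives]
  refine (CoalgHomClass.map_comp_comul_apply D.proj y).symm.trans ?_
  rw [HopfExt.mem_primitives.mp hy, map_add, TensorProduct.map_tmul, TensorProduct.map_tmul]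
  simp [proj_apply]

theorem coaction_of_mem_primitives {y : D.u} (hy : y ∈ HopfExt.primitives k D.u) :
    D.coaction y = y ⊗ₜ 1 + 1 ⊗ₜ D.projAlgHom y := by
  rw [coaction_apply, ← coalgebra_comul_apply, HopfExt.mem_primitives.mp hy]
  simp

theorem exists_eq_of_mem_primitives {y : D.u} (hy : y ∈ HopfExt.primitives k D.u) :
    ∃ (c : Fin n → k) (b : RestrictedEnveloping k p h), Coalgebra.counit (R := k) b = 0 ∧
      y = D.pPowerSum c + D.incl b := by
  obtain ⟨c, hc⟩ : ∃ c : Fin n → k, D.projAlgHom y = D.projAlgHom (D.pPowerSum c) :=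
    ⟨_, (MonogenicHopf.eq_sum_of_mem_primitives (D.projAlgHom_mem_primitives hy)).trans
      (D.projAlgHom_pPowerSum _).symm⟩
  obtain ⟨b, hb⟩ := (D.mem_range_incl_iff (y - D.pPowerSum c)).mpr (by
    rw [map_sub, D.coaction_of_mem_primitives hy, coaction_pPowerSum, hc, sub_tmul]
    abel)
  have hεy : D.counit y = 0 := HopfExt.counit_of_mem_primitives hy
  refine ⟨c, b, ?_, by rw [hb]; abel⟩
  rw [← counit_incl, hb, map_sub, hεy, counit_pPowerSum, sub_zero]

theorem primitives_eq_of_linearIndependent [FiniteDimensional k h]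
    (hli : LinearIndependent k fun i : Fin n => D.cohomologyClass i) :
    (HopfExt.primitives k D.u : Set D.u) =
      Set.range fun a : h => D.incl (RestrictedEnveloping.ι k p h a) := by
  refine Set.Subset.antisymm (fun y hy => ?_) (Set.range_subset_iff.mpr D.incl_ι_mem_primitives)
  obtain ⟨c, b, hb, rfl⟩ := D.exists_eq_of_mem_primitives hy
  have hd1 := (D.pPowerSum_add_incl_mem_primitives_iff c b).mp hy
  have hc := Fintype.linearIndependent_iff.mp hli c
    ((D.sum_cohomologyClass_eq_zero_iff c).mpr ⟨b, hb, hd1⟩)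
  have hbP : b ∈ (HopfExt.primitives k (RestrictedEnveloping k p h) :
      Set (RestrictedEnveloping k p h)) := by
    simp only [hc, zero_smul, Finset.sum_const_zero, Cobar.d1_apply] at hd1
    exact (sub_eq_zero.mp hd1).symm
  rw [RestrictedEnveloping.primitives_eq_range] at hbP
  obtain ⟨v, rfl⟩ := hbP
  exact ⟨v, by simp [pPowerSum, hc]⟩

theorem linearIndependent_of_primitives_eq
    (hP : (HopfExt.primitives k D.u : Set D.u) =
      Set.range fun a : h => D.incl (RestrictedEnveloping.ι k p h a)) :
    LinearIndependent k fun i : Fin n => D.cohomologyClass i := by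
  refine Fintype.linearIndependent_iff.mpr fun c hc => congrFun ?_
  obtain ⟨b, -, hd1⟩ := (D.sum_cohomologyClass_eq_zero_iff c).mp hc
  have hy := (D.pPowerSum_add_incl_mem_primitives_iff c b).mpr hd1
  rw [← SetLike.mem_coe, hP] at hy
  obtain ⟨v, hv⟩ := hy
  refine D.eq_zero_of_pPowerSum_eq_incl (a := RestrictedEnveloping.ι k p h v - b) ?_
  rw [map_sub]
  exact eq_sub_of_add_eq hv.symm

/-- The map from `h` to the restricted Lie algebra `P(u(D))`, induced by the canonical map
`A → u(D)`. -/
def toPrimitives : h →ₗ⁅k⁆ HopfExt.primitives k D.u where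
  toFun v := ⟨D.incl (RestrictedEnveloping.ι k p h v), D.incl_ι_mem_primitives v⟩
  map_add' v w := Subtype.ext (by simp)
  map_smul' c v := Subtype.ext (by simp)
  map_lie' {v w} := Subtype.ext (by
    change D.incl (RestrictedEnveloping.ι k p h ⁅v, w⁆) = _
    rw [LieSubalgebra.coe_bracket, trivial_lie_zero, map_zero, map_zero,
      ((Commute.all _ _).map D.incl).lie_eq])

theorem coe_toPrimitives (v : h) :
    (D.toPrimitives v : D.u) = D.incl (RestrictedEnveloping.ι k p h v) := rfl

theorem toPrimitives_pMap (v : h) : D.toPrimitives (RestrictedLieAlgebra.pMap k p v) =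
    HopfExt.primitivePow p (D.toPrimitives v) := by
  refine Subtype.ext ?_
  change _ = (D.toPrimitives v : D.u) ^ p
  rw [coe_toPrimitives, coe_toPrimitives, RestrictedEnveloping.ι_pMap, map_pow]

theorem toPrimitives_injective [FiniteDimensional k h] : Function.Injective D.toPrimitives :=
  fun _ _ hvw => RestrictedEnveloping.ι_injective k p h
    (D.incl_injective (congrArg Subtype.val hvw))

theorem primitives_eq_range_iff : (HopfExt.primitives k D.u : Set D.u) =
      Set.range (fun a : h => D.incl (RestrictedEnveloping.ι k p h a)) ↔
    Function.Surjective D.toPrimitives := by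
  have hrange : (Set.range fun a : h => D.incl (RestrictedEnveloping.ι k p h a)) =
      Subtype.val '' Set.range D.toPrimitives := by
    rw [← Set.range_comp]
    rfl
  have hval : (HopfExt.primitives k D.u : Set D.u) =
      Subtype.val '' (Set.univ : Set (HopfExt.primitives k D.u)) := by
    rw [Set.image_univ]
    exact Subtype.range_coe.symm
  rw [hrange, hval, Subtype.val_injective.image_injective.eq_iff, eq_comm, Set.range_eq_univ]

theorem tfae_primitives [FiniteDimensional k h] : List.TFAE [
    LinearIndependent k (fun i : Fin n => D.cohomologyClass i),
    (HopfExt.primitives k D.u : Set D.u) =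
      Set.range (fun a : h => D.incl (RestrictedEnveloping.ι k p h a)),
    ∃ e : HopfExt.primitives k D.u ≃ₗ⁅k⁆ h, ∀ y,
      e (HopfExt.primitivePow p y) = RestrictedLieAlgebra.pMap k p (e y),
    Nonempty (HopfExt.primitives k D.u ≃ₗ[k] h)] := by
  tfae_have 1 → 2 := D.primitives_eq_of_linearIndependent
  tfae_have 2 → 1 := D.linearIndependent_of_primitives_eq
  tfae_have 2 → 3 := fun hP => by
    let e := LieEquiv.ofBijective D.toPrimitives
      ⟨D.toPrimitives_injective, D.primitives_eq_range_iff.mp hP⟩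
    have he (v : h) : e.symm (D.toPrimitives v) = v := e.symm_apply_apply v
    refine ⟨e.symm, fun y => ?_⟩
    obtain ⟨v, rfl⟩ := D.primitives_eq_range_iff.mp hP y
    rw [← D.toPrimitives_pMap, he, he]
  tfae_have 3 → 4 := fun ⟨e, _⟩ => ⟨e.toLinearEquiv⟩
  tfae_have 4 → 2 := fun ⟨e⟩ => by
    have : FiniteDimensional k (HopfExt.primitives k D.u) := e.symm.finiteDimensional
    rw [primitives_eq_range_iff]
    exact (LinearMap.injective_iff_surjective_of_finrank_eq_finrank
      (f := (D.toPrimitives : h →ₗ[k] HopfExt.primitives k D.u)) e.finrank_eq.symm).mp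
      D.toPrimitives_injective
  tfae_finish

end Primitives

end CompatibleDatum

end

theorem theorem0p1 {k : Type*} [Field k] {p : ℕ} [Fact p.Prime] [CharP k p]
    {h : Type*} [LieRing h] [LieAlgebra k h] [IsLieAbelian h] [RestrictedLieAlgebra k p h]
    [FiniteDimensional k h] {n : ℕ} (hn : 1 ≤ n) (lam : Fin n → k)
    (D : CompatibleDatum k p h lam) :
    ∃ S : HopfStructure k D.u, D.IsPrescribed S ∧
      letI : HopfAlgebra k D.u := S.toHopfAlgebra
      -- (a)
      (HopfExt.IsConnected k D.u ∧
        Module.finrank k D.u =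
          p ^ (Module.finrank k (HopfExt.primitives k (RestrictedEnveloping k p h)) + n)) ∧
      -- (b)
      (∃ (ι : RestrictedEnveloping k p h →ₐc[k] D.u) (π : D.u →ₐc[k] MonogenicHopf k p lam),
        (∀ a, ι a = D.incl a) ∧ π D.x = MonogenicHopf.z k p lam ∧
        HopfExt.IsExtension ι π ∧ HopfExt.IsCocentral π) ∧
      -- (c)
      List.TFAE [
        LinearIndependent k (fun i : Fin n => D.cohomologyClass i),
        (HopfExt.primitives k D.u : Set D.u) =
          Set.range (fun a : h => D.incl (RestrictedEnveloping.ι k p h a)),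
        ∃ e : HopfExt.primitives k D.u ≃ₗ⁅k⁆ h, ∀ y,
          e (HopfExt.primitivePow p y) = RestrictedLieAlgebra.pMap k p (e y),
        Nonempty (HopfExt.primitives k D.u ≃ₗ[k] h)] :=
  ⟨D.hopfStructure, D.isPrescribed, ⟨D.isConnected, D.finrank_u⟩,
    ⟨D.inclHom, D.proj, D.inclHom_apply, D.projAlgHom_x, D.isExtension, D.isCocentral⟩,
    D.tfae_primitives⟩
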